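/- **Theorem (Locality of site entropies).** Let $d\in\{2,3\}$, $m\in\mathbb N$. *Setting.* Let $\Lambda^{\rm hom}=\mathsf A\mathbb Z^d$ with $\mathsf A\in\mathbb R^{d\times d}$ non-singular, and let $\Lambda\subset\mathbb R^d$ satisfy $\Lambda\setminus B_{R^{\rm def}}=\Lambda^{\rm hom}\setminus B_{R^{\rm def}}$ for some $R^{\rm def}>0$, with $\Lambda\cap B_{R^{\rm def}}$ finite. For each $\ell\in\Lambda$ let $\mathcal R_\ell\subset\Lambda-\ell$ be finite, let $Du(\ell)=(u(\ell+\rho)-u(\ell))_{\rho\in\mathcal R_\ell}$ for $u:\Lambda\to\mathbb R^m$, and let $V_\ell\in C^3((\mathbb R^m)^{\mathcal R_\ell};\mathbb R)$. Assume that $\mathcal R_\ell=\mathcal R$ and $V_\ell=V$ for all $\ell\in\Lambda\setminus B_{R^{\rm def}}$, where $\mathcal R$ is finite, $\mathcal R=-\mathcal R$, $\operatorname{span}_{\mathbb Z}\mathcal R=\Lambda^{\rm hom}$, and $V\in C^3((\mathbb R^m)^{\mathcal R};\mathbb R)$ satisfies $V((-g_{-\rho})_{\rho\in\mathcal R})=V(g)$.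 Assume that the homogeneous lattice is stable: there is $c_0>0$ such that $$\langle H^{\rm hom}v,v\rangle:=\sum_{\ell\in\Lambda^{\rm hom}}\nabla^2V(0)[D_{\mathcal R}v(\ell),D_{\mathcal R}v(\ell)]\ \ge\ c_0\sum_{\ell\in\Lambda^{\rm hom}}|D_{\mathcal R}v(\ell)|^2$$ for all finitely supported $v:\Lambda^{\rm hom}\to\mathbb R^m$, where $D_{\mathcal R}v(\ell)=(v(\ell+\rho)-v(\ell))_{\rho\in\mathcal R}$. *Site entropy.* Let $\dot{\mathcal W}^{1,2}=\{u:\Lambda\to\mathbb R^m:\sum_{\ell\in\Lambda}|Du(\ell)|^2<\infty\}$. With $\mathcal B=\pi\mathsf A^{-T}(-1,1)^d$ and $$\hat h(k)=\sum_{\rho,\sigma\in\mathcal R}(e^{-ik\cdot\rho}-1)(e^{ik\cdot\sigma}-1)\,V_{,\rho\sigma}(0),\qquad F(x)=\frac1{|\mathcal B|}\int_{\mathcal B}e^{-ik\cdot x}\,\hat h(k)^{-1/2}\,dk\quad(x\in\Lambda^{\rm hom}),$$ where $V_{,\rho\sigma}$ is the $m\times m$ block of second partial derivatives of $V$, the operator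 $\mathbf F=(H^{\rm hom})^{-1/2}$ maps $w\in\ell^2(\Lambda;\mathbb C^m)$ to $$(\mathbf Fw)(\ell)=\sum_{n\in\Lambda\cap\Lambda^{\rm hom}}\big(F(\ell-n)-F(-n)\big)w(n)\quad(\ell\in\Lambda\cap\Lambda^{\rm hom}),\qquad(\mathbf Fw)(\ell)=w(\ell)\quad(\ell\in\Lambda\setminus\Lambda^{\rm hom}).$$ For $u\in\dot{\mathcal W}^{1,2}$ let $\mathbf F^*H(u)\mathbf F$ denote the bounded operator on $\ell^2(\Lambda;\mathbb C^m)$ with $$\langle g,\mathbf F^*H(u)\mathbf Ff\rangle=\sum_{\ell\in\Lambda}\nabla^2V_\ell(Du(\ell))\big[\overline{D\mathbf Fg(\ell)},D\mathbf Ff(\ell)\big]\qquad\text{for all }f,g\in\ell^2(\Lambda;\mathbb C^m)$$ ($\nabla^2V_\ell$ extended complex-bilinearly). For $0<\underline\sigma<\overline\sigma$ let $\mathcal U(\underline\sigma,\overline\sigma)$ be the set of all $u\in\dot{\mathcal W}^{1,2}$ whose operator has spectrum satisfying $\sigma(\mathbf F^*H(u)\mathbf F)\cap(0,\infty)\subset[\underline\sigma,\overline\sigma]$.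 Fix a circle $\mathcal C$ contained in the open right half-plane and having $[\underline\sigma,\overline\sigma]$ in its interior, and set, for $\ell\in\Lambda$, $$\mathcal S_\ell(u)=-\tfrac12\operatorname{Tr}\big[\log^+(\mathbf F^*H(u)\mathbf F)\big]_{\ell\ell},\qquad \log^+T=\frac1{2\pi i}\oint_{\mathcal C}\log(z)\,(zI-T)^{-1}\,dz ,$$ where $[\,\cdot\,]_{\ell\ell}$ is the $m\times m$ block belonging to the site $\ell$ (and the real part of the trace is taken). *Claim.* The operator $\mathbf F^*H(u)\mathbf F$ exists for every $u\in\dot{\mathcal W}^{1,2}$. Let $0<\underline\sigma<\overline\sigma$, $\mathcal C$ as above, and $u\in\mathcal U(\underline\sigma,\overline\sigma)$. Then $\mathcal S_\ell$ is differentiable at $u$ with respect to $u_n=u(n)$ for all $\ell,n\in\Lambda$, and there are constants $C_2>0$ and $r_0>0$, independent of $\ell$ and $n$, such that for all $\ell,n\in\Lambda$ with $r_{n\ell}:=|n-\ell|\ge r_0$, $$\left|\frac{\partial\mathcal S_\ell(u)}{\partial u_n}\right|\le C_2\,|r_{n\ell}|^{-2d}.$$ -/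

import Mathlib

open scoped Matrix

noncomputable section

namespace SiteEntropy

/-- Physical space `ℝ^d`. -/
abbrev Space (d : ℕ) := EuclideanSpace ℝ (Fin d)

/-- Values of real displacements, `ℝ^m`. -/
abbrev Disp (m : ℕ) := EuclideanSpace ℝ (Fin m)

/-- The complexification `ℂ^m` of `ℝ^m`. -/
abbrev CDisp (m : ℕ) := EuclideanSpace ℂ (Fin m)

/-- The Bravais lattice `A ℤ^d`. -/
def bravais {d : ℕ} (A : Matrix (Fin d) (Fin d) ℝ) : Set (Space d) :=
  Set.range fun z : Fin d → ℤ => WithLp.toLp 2 (A *ᵥ fun i => (z i : ℝ))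

/-- A single-species Bravais lattice `A ℤ^d` together with a reference configuration `Λ` having a
localized point defect, and a finite-range site potential on `Λ` which is homogeneous outside the
defect core. Displacements take values in `ℝ^m`. -/
structure DefectCrystal (d m : ℕ) where
  /-- the lattice matrix -/
  A : Matrix (Fin d) (Fin d) ℝ
  det_ne_zero : A.det ≠ 0
  /-- the reference configuration with defect -/
  sites : Set (Space d)
  /-- radius of the defect core -/
  coreRadius : ℝ
  coreRadius_pos : 0 < coreRadius
  sites_diff_core :
    sites \ Metric.ball 0 coreRadius = bravais A \ Metric.ball 0 coreRadius
  finite_core : (sites ∩ Metric.ball 0 coreRadius).Finite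
  /-- the homogeneous interaction stencil `𝓡` -/
  stencil : Finset (Space d)
  stencil_neg : ∀ ρ ∈ stencil, -ρ ∈ stencil
  stencil_span : (Submodule.span ℤ (stencil : Set (Space d)) : Set (Space d)) = bravais A
  /-- the homogeneous site potential `V` -/
  pot : (stencil → Disp m) → ℝ
  pot_contDiff : ContDiff ℝ 3 pot
  pot_symm : ∀ g : stencil → Disp m,
    pot (fun ρ => -g ⟨-ρ.1, stencil_neg ρ.1 ρ.2⟩) = pot g
  /-- the interaction stencil `𝓡_ℓ` of the site `ℓ` -/
  siteStencil : sites → Finset (Space d)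
  siteStencil_mem : ∀ (ℓ : sites), ∀ ρ ∈ siteStencil ℓ, ℓ.1 + ρ ∈ sites
  /-- the site potential `V_ℓ` of the site `ℓ` -/
  sitePot : ∀ ℓ : sites, (siteStencil ℓ → Disp m) → ℝ
  sitePot_contDiff : ∀ ℓ : sites, ContDiff ℝ 3 (sitePot ℓ)
  homogeneous : ∀ ℓ : sites, coreRadius ≤ ‖ℓ.1‖ →
    ∃ h : siteStencil ℓ = stencil, ∀ g : siteStencil ℓ → Disp m,
      sitePot ℓ g = pot fun ρ => g ⟨ρ.1, h.symm ▸ ρ.2⟩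

/-- The second partial derivative `V_{,ρσ}(g)`, entry `(i, j)`, that is
`∂² V(g) / ∂ g_{ρ i} ∂ g_{σ j}`. -/
def partial₂ {d m : ℕ} {R : Finset (Space d)} (V : (R → Disp m) → ℝ) (g : R → Disp m)
    (ρ : R) (i : Fin m) (σ : R) (j : Fin m) : ℝ :=
  fderiv ℝ (fderiv ℝ V) g (Pi.single ρ (EuclideanSpace.single i 1))
    (Pi.single σ (EuclideanSpace.single j 1))

namespace DefectCrystal

variable {d m : ℕ} (X : DefectCrystal d m)

/-! ### The homogeneous lattice -/

/-- Lattice stability: `⟨H^hom v, v⟩ ≥ c₀ ‖Dv‖²_{ℓ²}` for all compactly supported displacements `v`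
of the homogeneous lattice, where
`⟨H^hom v, v⟩ = ∑_{ℓ ∈ A ℤ^d} ∇²V(0)[Dv(ℓ), Dv(ℓ)]`. (Only the values of `v` on the lattice
enter.) -/
def LatticeStable : Prop :=
  ∃ c₀ : ℝ, 0 < c₀ ∧ ∀ v : Space d → Disp m, v.support.Finite →
    c₀ * ∑' ℓ : bravais X.A, ∑ ρ : X.stencil, ‖v (ℓ.1 + ρ.1) - v ℓ.1‖ ^ 2 ≤
      ∑' ℓ : bravais X.A,
        fderiv ℝ (fderiv ℝ X.pot) 0
          (fun ρ => v (ℓ.1 + ρ.1) - v ℓ.1) (fun ρ => v (ℓ.1 + ρ.1) - v ℓ.1)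

/-- The symbol `ĥ(k)` of `H^hom`:
`ĥ(k)_{ij} = ∑_{ρ,σ} (e^{-ik·ρ} - 1) (e^{ik·σ} - 1) V_{,ρσ}(0)_{ij}`. -/
def symbol (k : Space d) : Matrix (Fin m) (Fin m) ℂ :=
  Matrix.of fun i j => ∑ ρ : X.stencil, ∑ σ : X.stencil,
    (Complex.exp (-Complex.I * (inner ℝ k ρ.1 : ℝ)) - 1) *
      (Complex.exp (Complex.I * (inner ℝ k σ.1 : ℝ)) - 1) *
        (partial₂ X.pot 0 ρ i σ j : ℂ)

/-- The fundamental domain `𝓑 = π A^{-T} (-1,1)^d` of reciprocal space, i.e. all `k` with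
`(Aᵀ k)_j ∈ (-π, π)` for every `j`. -/
def brillouin : Set (Space d) :=
  {k | ∀ j : Fin d, |∑ i, X.A i j * k i| < Real.pi}

/-- The convolution kernel of `(H^hom)^{-1/2}`:
`F(x) = |𝓑|⁻¹ ∫_𝓑 e^{-ik·x} ĥ(k)^{-1/2} dk` for lattice vectors `x`. -/
def kernel (x : Space d) : Matrix (Fin m) (Fin m) ℂ :=
  Matrix.of fun i j => ⨍ k in X.brillouin,
    Complex.exp (-Complex.I * (inner ℝ k x : ℝ)) *
      (cfc (fun t : ℝ => t ^ (-(1 / 2) : ℝ)) (X.symbol k)) i j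

/-! ### Function spaces and operators on the defective configuration -/

/-- The finite difference stencil `Dv(ℓ) = (v(ℓ+ρ) - v(ℓ))_{ρ ∈ 𝓡_ℓ}`. -/
def D {Y : Type*} [Sub Y] (v : X.sites → Y) (ℓ : X.sites) (ρ : X.siteStencil ℓ) : Y :=
  v ⟨ℓ.1 + ρ.1, X.siteStencil_mem ℓ ρ.1 ρ.2⟩ - v ℓ

/-- The space of finite-energy displacements: `‖Du‖_{ℓ²} < ∞`. -/
def energySpace : Set (X.sites → Disp m) :=
  {u | Summable fun ℓ : X.sites => ∑ ρ : X.siteStencil ℓ, ‖X.D u ℓ ρ‖ ^ 2}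

/-- The (complexified) Hilbert space `ℓ²(Λ; ℂ^m)`. -/
abbrev L2 : Type := lp (fun _ : X.sites => CDisp m) 2

open Classical in
/-- The operator `𝐅 = (H^hom)^{-1/2}`: `(𝐅w)(ℓ) = ∑_n (F(ℓ-n) - F(-n)) w(n)`.
Sites of `Λ` that are not lattice sites (finitely many interstitials, where the kernel of the
homogeneous crystal has no meaning) are decoupled, and `𝐅` is the identity there. If `Λ` is a
subset of the lattice, the case distinctions are void. -/
def opF (w : X.L2) (ℓ : X.sites) : CDisp m :=
  if ℓ.1 ∈ bravais X.A then
    ∑' n : X.sites, if n.1 ∈ bravais X.A then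
      WithLp.toLp 2 ((X.kernel (ℓ.1 - n.1) - X.kernel (-n.1)) *ᵥ (w n).ofLp) else 0
  else w ℓ

/-- The contribution of the site `ℓ` to the Hessian `⟨H(u) v, w⟩`, extended sesquilinearly:
`∇²V_ℓ(Du(ℓ))[conj Dw(ℓ), Dv(ℓ)]`. -/
def hessianSite (u : X.sites → Disp m) (w v : X.sites → CDisp m) (ℓ : X.sites) : ℂ :=
  ∑ ρ : X.siteStencil ℓ, ∑ i : Fin m, ∑ σ : X.siteStencil ℓ, ∑ j : Fin m,
    (partial₂ (X.sitePot ℓ) (X.D u ℓ) ρ i σ j : ℂ) *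
      (starRingEnd ℂ (X.D w ℓ ρ i) * X.D v ℓ σ j)

/-- `T = 𝐅* H(u) 𝐅`, as a bounded operator on `ℓ²`:
`⟨g, T f⟩ = ∑_ℓ ∇²V_ℓ(Du(ℓ))[conj D𝐅g(ℓ), D𝐅f(ℓ)]` for all `f, g ∈ ℓ²`. -/
def IsFHF (u : X.sites → Disp m) (T : X.L2 →L[ℂ] X.L2) : Prop :=
  ∀ f g : X.L2, HasSum (X.hessianSite u (X.opF g) (X.opF f)) (inner ℂ g (T f))

open Classical in
/-- The operator `𝐅* H(u) 𝐅` (it is unique, and `0` by convention if it does not exist). -/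
def FHF (u : X.sites → Disp m) : X.L2 →L[ℂ] X.L2 :=
  if h : ∃ T, X.IsFHF u T then h.choose else 0

/-- The class `𝒰(σ₁, σ₂)` of finite-energy displacements with
`σ(𝐅* H(u) 𝐅) ∩ (0, ∞) ⊆ [σ₁, σ₂]`. -/
def stableClass (σ₁ σ₂ : ℝ) : Set (X.sites → Disp m) :=
  {u | u ∈ X.energySpace ∧
    ∀ t : ℝ, 0 < t → (t : ℂ) ∈ spectrum ℂ (X.FHF u) → t ∈ Set.Icc σ₁ σ₂}

/-- `log⁺ T = (2πi)⁻¹ ∮_𝒞 log z (z - T)⁻¹ dz` for the circle `𝒞` with centre `c` and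
radius `r`. -/
def logPlus (c r : ℝ) (T : X.L2 →L[ℂ] X.L2) : X.L2 →L[ℂ] X.L2 :=
  (2 * Real.pi * Complex.I : ℂ)⁻¹ • ∮ z in C((c : ℂ), r), Complex.log z • resolvent T z

open Classical in
/-- The trace of the `m × m` block `[L]_{ℓℓ}`. -/
def blockTrace (L : X.L2 →L[ℂ] X.L2) (ℓ : X.sites) : ℂ :=
  ∑ i : Fin m, inner ℂ (lp.single 2 ℓ (EuclideanSpace.single i 1) : X.L2)
    (L (lp.single 2 ℓ (EuclideanSpace.single i 1)))

/-- The site entropy `S_ℓ(u) = -½ Tr [log⁺(𝐅* H(u) 𝐅)]_{ℓℓ}`, with `log⁺` given by the circle with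
centre `c` and radius `r`. -/
def siteEntropy (c r : ℝ) (ℓ : X.sites) (u : X.sites → Disp m) : ℝ :=
  -(1 / 2) * (X.blockTrace (X.logPlus c r (X.FHF u)) ℓ).re

open Classical in
/-- The site entropy `S_ℓ` as a function of the displacement of the atom `n` only, all other
displacements being those of `u`. -/
def siteEntropyAlong (c r : ℝ) (ℓ n : X.sites) (u : X.sites → Disp m) (x : Disp m) : ℝ :=
  X.siteEntropy c r ℓ (Function.update u n x)

end DefectCrystal

end SiteEntropy

end

open SiteEntropy

open scoped Matrix

noncomputable section

open MeasureTheory Set Filter Topology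

/-! ### Characters and Fourier coefficients on the unit cube -/

namespace SiteEntropy

/-! The operator T = 𝐅*H(u)𝐅 is the identity plus localized rank one operators with square summable
coefficients. Plancherel gives 𝐅*H^hom𝐅 = 1 on the lattice (`hasSum_homForm_latDiff`). Away from the
core, ∇²V(Du(ℓ)) - ∇²V(0) = O(|Du(ℓ)|), which lies in ℓ². The core and the interstitials add
finitely many terms (`hasSum_pert`, `exists_isLocalizedPerturbation`). The vectors involved
represent f ↦ D𝐅f at a site. Their entries and their Gram matrix decay like |x-y|^{-d}, a rate that
just fails to be summable.

This critical rate comes from Fourier analysis. A difference factor times ĥ^{-1/2}, or two of them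
times ĥ^{-1}, is bounded near the origin but not smooth there. Subordination writes ĥ^{-α/2} as a
time integral of e^{-tĥ}. Each time slice is entire and periodic, so shifting the contour by min(1,
t^{-1/2}) into the complex domain gives exponential decay on the parabolic scale, and integration
over t leaves (1+|z|)^{-d} (`VanishingFactor.exists_norm_power_coeff_le`). Lattice stability enters
through a quadratic lower bound on the symbol, found by testing with truncated plane waves
(`LatticeStable.exists_homForm_lower`).

For the resolvent, let T = 1 + ∑ N_b |ψ_b⟩⟨χ_b| and w = (z-T)^{-1}v. Then (z-1)⟨χ_a,w⟩ = ⟨χ_a,v⟩ +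
∑_b N_b⟨χ_a,ψ_b⟩⟨χ_b,w⟩. A product of two critical weights is bounded by one of them times their sum
(`decay_mul_decay_le`), and Cauchy-Schwarz bounds the remaining sum of |N_b| times a weight. So the
right-hand side preserves critical decay, with small norm once finitely many indices are removed
(`decay_of_inequality`). Those indices are handled through the adjoint resolvent
(`IsLocalizedPerturbation.exists_resolvent_decay`). The factor z-1 is bounded below on the circle
because 1 is in the spectrum (`one_mem_spectrum`) and hence in [σ₁, σ₂].

Finally, moving the atom n changes T by a finite rank operator localized near n (`FHF_update`). The
derivative of log⁺ in the direction E is (2πi)⁻¹∮ log z · R(z) E R(z) dz. For rank one E its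
diagonal entry at ℓ is an integral of products of two resolvent matrix elements linking n and ℓ,
each O(|n-ℓ|^{-d}); hence the exponent 2d. -/

/-- The unit cube `(-1/2, 1/2]^d` with Lebesgue measure. -/
def cube (d : ℕ) : Measure (Fin d → ℝ) :=
  Measure.pi fun _ => (volume : Measure ℝ).restrict (Ioc (-1 / 2) (-1 / 2 + 1))

/-- The character `w ↦ e^{2πi z·w}` of `ℂ^d` with frequency `z ∈ ℤ^d`. -/
def character {d : ℕ} (z : Fin d → ℤ) (w : Fin d → ℂ) : ℂ :=
  Complex.exp (2 * Real.pi * Complex.I * ∑ j, z j * w j)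

/-- The real points of `ℂ^d`. -/
def ofReal {d : ℕ} (x : Fin d → ℝ) : Fin d → ℂ := fun j => (x j : ℂ)

/-- The Fourier coefficients of a function on the unit cube. -/
def cubeCoeff {d : ℕ} (f : (Fin d → ℝ) → ℂ) (z : Fin d → ℤ) : ℂ :=
  ∫ x, character (-z) (ofReal x) * f x ∂cube d

section Basic
variable {d : ℕ}

lemma cube_eq : cube d = (volume : Measure (Fin d → ℝ)).restrict
    {x | ∀ j, x j ∈ Ioc (-1 / 2 : ℝ) (-1 / 2 + 1)} := by
  rw [cube, ← Measure.restrict_pi_pi]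
  congr 1
  ext x
  simp

instance : IsProbabilityMeasure
    ((volume : Measure ℝ).restrict (Ioc (-1 / 2) (-1 / 2 + 1))) := by
  constructor
  rw [Measure.restrict_apply_univ, Real.volume_Ioc]
  norm_num

instance : IsProbabilityMeasure (cube d) := by unfold cube; infer_instance

lemma ae_cube_mem : ∀ᵐ x ∂cube d, ∀ j, x j ∈ Ioc (-1 / 2 : ℝ) (-1 / 2 + 1) := by
  rw [cube_eq]
  exact ae_restrict_mem (MeasurableSet.univ_pi' fun i => measurableSet_Ioc)

lemma ae_cube_abs_le : ∀ᵐ x ∂cube d, ∀ j, |x j| ≤ 1 / 2 := by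
  filter_upwards [ae_cube_mem] with x hx j
  have := hx j
  rw [abs_le]; constructor <;> [linarith [this.1]; linarith [this.2]]

lemma continuous_ofReal : Continuous (ofReal (d := d)) := by unfold ofReal; fun_prop

lemma continuous_character (z : Fin d → ℤ) : Continuous (character z) := by
  unfold character; fun_prop

lemma character_add (z z' : Fin d → ℤ) (w : Fin d → ℂ) :
    character (z + z') w = character z w * character z' w := by
  simp only [character, ← Complex.exp_add, Pi.add_apply, Int.cast_add, add_mul,
    Finset.sum_add_distrib, mul_add]

lemma character_zero (w : Fin d → ℂ) : character 0 w = 1 := by simp [character]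

lemma character_ofReal (z : Fin d → ℤ) (x : Fin d → ℝ) :
    character z (ofReal x) = Complex.exp ((2 * Real.pi * ∑ j, z j * x j : ℝ) * Complex.I) := by
  simp only [character, ofReal]; congr 1; push_cast; ring

lemma norm_character_ofReal (z : Fin d → ℤ) (x : Fin d → ℝ) :
    ‖character z (ofReal x)‖ = 1 := by
  rw [character_ofReal, Complex.norm_exp_ofReal_mul_I]

lemma conj_character_ofReal (z : Fin d → ℤ) (x : Fin d → ℝ) :
    starRingEnd ℂ (character z (ofReal x)) = character (-z) (ofReal x) := by
  rw [character_ofReal, character_ofReal, ← Complex.exp_conj]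
  congr 1
  simp only [map_mul, Complex.conj_ofReal, Complex.conj_I, Pi.neg_apply, Int.cast_neg]
  push_cast
  simp only [neg_mul, Finset.sum_neg_distrib]
  ring
end Basic

/-! ### Parseval's identity, transported from the torus to the cube -/

section Torus
variable {d : ℕ}

local instance : MeasureSpace UnitAddCircle := ⟨AddCircle.haarAddCircle⟩

/-- The section of the projection `ℝ^d → ℝ^d / ℤ^d` with values in the unit cube. -/
def torusSection (x : UnitAddTorus (Fin d)) : Fin d → ℝ :=
  (UnitAddTorus.measurableEquivPiIoc (fun _ : Fin d => (-1 / 2 : ℝ)) x).1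

/-- Parseval lives on the torus, whereas contour shifts need actual points of ℝ^d. This
identification moves Fourier coefficients from one setting to the other. -/
lemma measurePreserving_torusSection :
    MeasurePreserving (torusSection (d := d)) volume (cube d) := by
  have h1 := UnitAddTorus.measurePreserving_equivPiIoc (fun _ : Fin d => (-1 / 2 : ℝ))
  have hm : MeasurableSet {x : Fin d → ℝ | ∀ j, x j ∈ Ioc (-1 / 2 : ℝ) (-1 / 2 + 1)} :=
    MeasurableSet.univ_pi' fun i => measurableSet_Ioc
  have h2 : MeasurePreserving
      (Subtype.val : {x : Fin d → ℝ // ∀ j, x j ∈ Ioc (-1 / 2 : ℝ) (-1 / 2 + 1)} → _)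
      (Measure.comap Subtype.val volume) (cube d) := by
    refine ⟨measurable_subtype_coe, ?_⟩
    rw [cube_eq]
    exact map_comap_subtype_coe hm volume
  exact h2.comp h1

lemma mFourier_eq_character (n : Fin d → ℤ) (x : UnitAddTorus (Fin d)) :
    UnitAddTorus.mFourier n x = character n (ofReal (torusSection x)) := by
  have hx : x = fun i => ((torusSection x i : ℝ) : UnitAddCircle) :=
    ((UnitAddTorus.measurableEquivPiIoc (fun _ : Fin d => (-1 / 2 : ℝ))).symm_apply_apply x).symm
  conv_lhs => rw [hx]
  simp only [UnitAddTorus.mFourier, ContinuousMap.coe_mk, fourier_coe_apply, character,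
    ← Complex.exp_sum, ofReal]
  congr 1
  simp only [Complex.ofReal_one, div_one, Finset.mul_sum]
  exact Finset.sum_congr rfl fun i _ => by ring

/-- **Parseval's identity** on the unit cube. -/
theorem hasSum_conj_cubeCoeff_mul {f g : (Fin d → ℝ) → ℂ}
    (hf : MemLp f 2 (cube d)) (hg : MemLp g 2 (cube d)) :
    HasSum (fun z => starRingEnd ℂ (cubeCoeff f z) * cubeCoeff g z)
      (∫ x, starRingEnd ℂ (f x) * g x ∂cube d) := by
  have mp := measurePreserving_torusSection (d := d)
  have hf' := hf.comp_measurePreserving mp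
  have hg' := hg.comp_measurePreserving mp
  have h1 := UnitAddTorus.hasSum_prod_mFourierCoeff (hf'.toLp _) (hg'.toLp _)
  have key : ∀ {h : (Fin d → ℝ) → ℂ} (hh : MemLp (h ∘ torusSection) 2 volume)
      (h2 : MemLp h 2 (cube d)) (z : Fin d → ℤ),
      UnitAddTorus.mFourierCoeff (hh.toLp _) z = cubeCoeff h z := by
    intro h hh h2 z
    have h3 : cubeCoeff h z =
        ∫ x, character (-z) (ofReal (torusSection x)) * h (torusSection x) := by
      unfold cubeCoeff
      rw [← mp.map_eq, integral_map mp.measurable.aemeasurable]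
      rw [mp.map_eq]
      exact (((continuous_character _).comp continuous_ofReal).aestronglyMeasurable).mul h2.1
    rw [h3, UnitAddTorus.mFourierCoeff]
    refine integral_congr_ae ?_
    filter_upwards [hh.coeFn_toLp] with x hx
    rw [hx, mFourier_eq_character]; rfl
  have h4 : ∫ x, starRingEnd ℂ (f x) * g x ∂cube d =
      ∫ t, starRingEnd ℂ ((hf'.toLp _ : UnitAddTorus (Fin d) → ℂ) t) *
        (hg'.toLp _ : UnitAddTorus (Fin d) → ℂ) t := by
    rw [← mp.map_eq, integral_map mp.measurable.aemeasurable]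
    · refine integral_congr_ae ?_
      filter_upwards [hf'.coeFn_toLp, hg'.coeFn_toLp] with x hx hy
      rw [hx, hy]; rfl
    · rw [mp.map_eq]
      exact (Complex.continuous_conj.comp_aestronglyMeasurable hf.1).mul hg.1
  rw [h4]
  simpa only [key hf' hf, key hg' hg] using h1

end Torus

/-! ### Contour shifts for periodic entire functions -/

section Shift
variable {d : ℕ} {E : Type*} [NormedAddCommGroup E] [NormedSpace ℂ E]

/-- Continuous functions on `ℂ^d` which are entire and `1`-periodic in each variable. -/
structure PeriodicEntire (f : (Fin d → ℂ) → E) : Prop where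
  continuous : Continuous f
  differentiable : ∀ w j, Differentiable ℂ fun z => f (Function.update w j z)
  periodic : ∀ w j z, f (Function.update w j (z + 1)) = f (Function.update w j z)

/-- The real point `x` moved by `η` in the `j`-th imaginary direction. -/
def imShift (x : Fin d → ℝ) (j : Fin d) (η : ℝ) : Fin d → ℂ :=
  Function.update (ofReal x) j (x j + η * Complex.I)

lemma imShift_zero (x : Fin d → ℝ) (j : Fin d) : imShift x j 0 = ofReal x := by
  simp [imShift, ofReal]

lemma continuous_imShift (j : Fin d) (η : ℝ) : Continuous fun x => imShift x j η := by
  unfold imShift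
  exact continuous_ofReal.update j (by fun_prop)

/-- Cauchy's theorem on the rectangle between the two horizontal lines; the contributions of the
vertical sides cancel by periodicity. -/
lemma integral_unit_interval_imShift {f : ℂ → E} (hf : Differentiable ℂ f)
    (hp : ∀ z, f (z + 1) = f z) (η : ℝ) :
    ∫ x : ℝ in Ioc (-1 / 2) (-1 / 2 + 1), f (x + η * Complex.I) =
      ∫ x : ℝ in Ioc (-1 / 2) (-1 / 2 + 1), f x := by
  have h := Complex.integral_boundary_rect_eq_zero_of_differentiableOn f (-1 / 2 : ℝ)
    ((-1 / 2 + 1 : ℝ) + η * Complex.I) hf.differentiableOn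
  have h1 : ∀ y : ℝ, f (((-1 / 2 + 1 : ℝ) : ℂ) + y * Complex.I) =
      f (((-1 / 2 : ℝ) : ℂ) + y * Complex.I) := by
    intro y; rw [← hp (((-1 / 2 : ℝ) : ℂ) + y * Complex.I)]; congr 1; push_cast; ring
  simp only [Complex.ofReal_re, Complex.ofReal_im, Complex.add_re, Complex.mul_re, Complex.I_re,
    Complex.add_im, Complex.mul_im, Complex.I_im, mul_zero, mul_one, sub_zero, add_zero, zero_add,
    Complex.ofReal_zero, zero_mul, h1, add_sub_cancel_right, sub_eq_zero] at h
  rw [← intervalIntegral.integral_of_le (by norm_num), ← intervalIntegral.integral_of_le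
    (by norm_num), h]

lemma integrable_cube_of_continuous {F : Type*} [NormedAddCommGroup F] {f : (Fin d → ℝ) → F}
    (hf : Continuous f) :
    Integrable f (cube d) := by
  have h : IntegrableOn f (Icc (fun _ => -1 / 2) (fun _ => -1 / 2 + 1)) :=
    hf.continuousOn.integrableOn_compact isCompact_Icc
  rw [cube_eq]
  exact h.mono_set fun x hx => ⟨fun j => (hx j).1.le, fun j => (hx j).2⟩

lemma integral_cube_succ {n : ℕ} (j : Fin (n + 1)) {f : (Fin (n + 1) → ℝ) → E}
    (hf : Continuous f) :
    ∫ x, f x ∂cube (n + 1) = ∫ y, (∫ t in Ioc (-1 / 2 : ℝ) (-1 / 2 + 1),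
      f (j.insertNth t y)) ∂cube n := by
  have mp := measurePreserving_piFinSuccAbove
    (fun _ : Fin (n + 1) => (volume : Measure ℝ).restrict (Ioc (-1 / 2) (-1 / 2 + 1))) j
  have h1 := mp.symm.integral_comp' f
  rw [cube, ← h1]
  have hi : Integrable (fun p => f ((MeasurableEquiv.piFinSuccAbove (fun _ => ℝ) j).symm p))
      (((volume : Measure ℝ).restrict (Ioc (-1 / 2) (-1 / 2 + 1))).prod
        (Measure.pi fun _ : Fin n => (volume : Measure ℝ).restrict (Ioc (-1 / 2) (-1 / 2 + 1)))) :=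
    mp.symm.integrable_comp_of_integrable (integrable_cube_of_continuous hf)
  rw [integral_prod_symm _ hi]
  rfl

/-- Fubini isolates the j-th variable, where the one-dimensional contour shift applies with the
other variables frozen at real values. -/
theorem PeriodicEntire.integral_imShift {f : (Fin d → ℂ) → E} (hf : PeriodicEntire f)
    (j : Fin d) (η : ℝ) : ∫ x, f (imShift x j η) ∂cube d = ∫ x, f (ofReal x) ∂cube d := by
  cases d with
  | zero => exact j.elim0
  | succ n =>
    rw [integral_cube_succ j (f := fun x => f (imShift x j η))
        (hf.continuous.comp (continuous_imShift j η)),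
      integral_cube_succ j (f := fun x => f (ofReal x)) (hf.continuous.comp continuous_ofReal)]
    refine integral_congr_ae (Eventually.of_forall fun y => ?_)
    -- A base point W that does not depend on t exists because the j-th coordinate is overwritten in
    -- any case.
    obtain ⟨W, hW⟩ : ∃ W : Fin (n + 1) → ℂ, ∀ t : ℝ, ∀ w : ℂ,
        Function.update (ofReal (j.insertNth t y : Fin (n+1) → ℝ)) j w = Function.update W j w := by
      refine ⟨ofReal (j.insertNth 0 y : Fin (n+1) → ℝ), fun t w => ?_⟩
      ext i
      rcases eq_or_ne i j with rfl | hi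
      · simp
      · obtain ⟨k, rfl⟩ := Fin.exists_succAbove_eq hi
        simp [ofReal]
    have h2 : ∀ t : ℝ, ofReal (j.insertNth t y : Fin (n+1) → ℝ) = Function.update W j t := by
      intro t
      rw [← hW t]
      simp [ofReal]
    simp only [imShift, h2, Fin.insertNth_apply_same, Function.update_idem]
    exact integral_unit_interval_imShift (hf.differentiable W j) (hf.periodic W j) η

lemma PeriodicEntire.mul {f g : (Fin d → ℂ) → ℂ} (hf : PeriodicEntire f) (hg : PeriodicEntire g) :
    PeriodicEntire fun w => f w * g w :=
  ⟨hf.1.mul hg.1, fun w j => (hf.2 w j).mul (hg.2 w j),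
    fun w j z => by simp only [hf.3, hg.3]⟩

lemma PeriodicEntire.comp_clm {F : Type*} [NormedAddCommGroup F] [NormedSpace ℂ F]
    {f : (Fin d → ℂ) → E} (hf : PeriodicEntire f) (L : E →L[ℂ] F) :
    PeriodicEntire fun w => L (f w) :=
  ⟨L.continuous.comp hf.1, fun w j => L.differentiable.comp (hf.2 w j),
    fun w j z => by simp only [hf.3]⟩

lemma PeriodicEntire.sum {ι : Type*} {s : Finset ι} {f : ι → (Fin d → ℂ) → E}
    (hf : ∀ i ∈ s, PeriodicEntire (f i)) : PeriodicEntire fun w => ∑ i ∈ s, f i w :=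
  ⟨continuous_finsetSum _ fun i hi => (hf i hi).1,
    fun w j => by
      have := Differentiable.fun_sum (u := s) (A := fun i z => f i (Function.update w j z))
        fun i hi => (hf i hi).2 w j
      exact this,
    fun w j z => Finset.sum_congr rfl fun i hi => (hf i hi).3 w j z⟩

lemma PeriodicEntire.sub {f g : (Fin d → ℂ) → E} (hf : PeriodicEntire f)
    (hg : PeriodicEntire g) : PeriodicEntire fun w => f w - g w :=
  ⟨hf.1.sub hg.1, fun w j => (hf.2 w j).sub (hg.2 w j),
    fun w j z => by simp only [hf.3, hg.3]⟩

lemma PeriodicEntire.const (a : E) : PeriodicEntire fun _ : Fin d → ℂ => a :=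
  ⟨continuous_const, fun _ _ => differentiable_const _, fun _ _ _ => rfl⟩

lemma PeriodicEntire.exp {A : Type*} [NormedRing A] [NormedAlgebra ℂ A] [CompleteSpace A]
    {f : (Fin d → ℂ) → A} (hf : PeriodicEntire f) :
    PeriodicEntire fun w => NormedSpace.exp (f w) := by
  have hd : Differentiable ℂ (NormedSpace.exp : A → A) := fun x =>
    (NormedSpace.exp_analytic (𝕂 := ℂ) x).differentiableAt
  exact ⟨hd.continuous.comp hf.1, fun w j => hd.comp (hf.2 w j), fun w j z => by simp only [hf.3]⟩

lemma periodicEntire_character (z : Fin d → ℤ) : PeriodicEntire (character z) := by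
  have key : ∀ w : Fin d → ℂ, ∀ j u, ∑ i, (z i : ℂ) * Function.update w j u i =
      z j * u + ∑ i ∈ Finset.univ.erase j, (z i : ℂ) * w i := by
    intro w j u
    rw [← Finset.add_sum_erase _ _ (Finset.mem_univ j), Function.update_self]
    congr 1
    exact Finset.sum_congr rfl fun i hi => by
      rw [Function.update_of_ne (Finset.ne_of_mem_erase hi)]
  refine ⟨continuous_character z, fun w j => ?_, fun w j u => ?_⟩
  · simp only [character, key]
    fun_prop
  · simp only [character, key, mul_add, mul_one, Complex.exp_add]
    have h := Complex.exp_int_mul_two_pi_mul_I (z j)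
    rw [mul_comm] at h
    rw [h]; ring

/-- Only the shifted coordinate contributes to the modulus. With η of the sign of z_j this is the
exponential gain of a contour shift. -/
lemma norm_character_imShift (z : Fin d → ℤ) (x : Fin d → ℝ) (j : Fin d) (η : ℝ) :
    ‖character z (imShift x j η)‖ = Real.exp (-(2 * Real.pi * z j * η)) := by
  have : ∑ i, (z i : ℂ) * imShift x j η i = (∑ i, z i * x i : ℝ) + (z j * η : ℝ) * Complex.I := by
    rw [← Finset.add_sum_erase _ _ (Finset.mem_univ j),
      ← Finset.add_sum_erase (a := j) (f := fun i => (z i : ℝ) * x i) _ (Finset.mem_univ j)]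
    have : ∑ i ∈ Finset.univ.erase j, (z i : ℂ) * imShift x j η i =
        ((∑ i ∈ Finset.univ.erase j, (z i : ℝ) * x i : ℝ) : ℂ) := by
      push_cast
      exact Finset.sum_congr rfl fun i hi => by
        rw [imShift, Function.update_of_ne (Finset.ne_of_mem_erase hi)]; rfl
    rw [this, imShift, Function.update_self]
    push_cast; ring
  rw [character, Complex.norm_exp, this]
  congr 1
  simp
  ring

end Shift

/-! ### Growth of the semigroup from a bound on the numerical range -/

section Semigroup
variable {H : Type*} [NormedAddCommGroup H] [InnerProductSpace ℂ H] [CompleteSpace H]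

/-- The semigroup `e^{-tB}`. -/
def semigroup (B : H →L[ℂ] H) (t : ℝ) : H →L[ℂ] H := NormedSpace.exp ((t : ℂ) • (-B))

lemma hasDerivAt_semigroup_apply (B : H →L[ℂ] H) (v : H) (t : ℝ) :
    HasDerivAt (fun s => semigroup B s v) (-(B (semigroup B t v))) t := by
  have h := (hasDerivAt_exp_smul_const' (𝕂 := ℂ) (-B) (t : ℂ)).scomp t
    Complex.ofRealCLM.hasDerivAt
  have h2 := ((ContinuousLinearMap.apply ℂ H v).restrictScalars ℝ).hasFDerivAt.comp_hasDerivAt t h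
  simpa [semigroup, Function.comp_def] using h2

/-- Energy estimate: the squared norm of the orbit, multiplied by e^{2μs}, has nonpositive
derivative in s. The sign of μ plays no role, which matters for shifted symbols near the origin. -/
theorem norm_semigroup_apply_le {B : H →L[ℂ] H} {μ : ℝ}
    (hB : ∀ v, μ * ‖v‖ ^ 2 ≤ (inner ℂ v (B v)).re) {t : ℝ} (ht : 0 ≤ t) (v : H) :
    ‖semigroup B t v‖ ≤ Real.exp (-(μ * t)) * ‖v‖ := by
  let _ : InnerProductSpace ℝ H := InnerProductSpace.rclikeToReal ℂ H
  let φ : ℝ → ℝ := fun s => ‖semigroup B s v‖ ^ 2 * Real.exp (2 * μ * s)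
  have hφ : ∀ s, HasDerivAt φ (2 * inner ℝ (semigroup B s v) (-(B (semigroup B s v))) *
      Real.exp (2 * μ * s) + ‖semigroup B s v‖ ^ 2 * (Real.exp (2 * μ * s) * (2 * μ))) s := by
    intro s
    have h1 := (hasDerivAt_semigroup_apply B v s).norm_sq
    have h2 : HasDerivAt (fun s : ℝ => Real.exp (2 * μ * s)) (Real.exp (2 * μ * s) * (2 * μ)) s := by
      simpa using ((hasDerivAt_id s).const_mul (2 * μ)).exp
    exact h1.mul h2
  have hanti : Antitone φ := by
    refine antitone_of_deriv_nonpos (fun s => (hφ s).differentiableAt) fun s => ?_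
    rw [(hφ s).deriv]
    have h3 : inner ℝ (semigroup B s v) (-(B (semigroup B s v))) =
        -(inner ℂ (semigroup B s v) (B (semigroup B s v))).re := by
      rw [real_inner_eq_re_inner ℂ, inner_neg_right]; simp
    rw [h3]
    have := hB (semigroup B s v)
    have he := Real.exp_pos (2 * μ * s)
    nlinarith [mul_le_mul_of_nonneg_right this he.le]
  have h0 := hanti ht
  simp only [φ, mul_zero, Real.exp_zero, mul_one] at h0
  have h1 : semigroup B 0 v = v := by simp [semigroup, NormedSpace.exp_zero]
  rw [h1] at h0
  refine abs_le_of_sq_le_sq' ?_ (by positivity) |>.2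
  have h2 : (Real.exp (-(μ * t)) * ‖v‖) ^ 2 = ‖v‖ ^ 2 * Real.exp (-(2 * μ * t)) := by
    rw [mul_pow, ← Real.exp_nat_mul]; ring_nf
  rw [h2, Real.exp_neg, ← div_eq_mul_inv, le_div_iff₀ (Real.exp_pos _)]
  exact h0

end Semigroup

/-! ### Elliptic symbols and heat-kernel majorants -/

section Decay
variable {d m : ℕ}

/-- Operator-valued symbols on the torus which are analytic and whose numerical range on slightly
shifted tori grows quadratically. -/
structure EllipticSymbol (d m : ℕ) where
  toFun : (Fin d → ℂ) → (CDisp m →L[ℂ] CDisp m)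
  entire : PeriodicEntire toFun
  lower : ℝ
  upper : ℝ
  lower_pos : 0 < lower
  upper_nonneg : 0 ≤ upper
  bound : ∀ x : Fin d → ℝ, (∀ j, |x j| ≤ 1 / 2) → ∀ j η, |η| ≤ 1 → ∀ v : CDisp m,
    (lower * ∑ i, x i ^ 2 - upper * η ^ 2) * ‖v‖ ^ 2 ≤ (inner ℂ v (toFun (imShift x j η) v)).re

/-- Analytic factors vanishing to order `α` at the origin. -/
structure VanishingFactor (q : (Fin d → ℂ) → ℂ) (α : ℕ) : Prop where
  entire : PeriodicEntire q
  bound : ∃ C : ℝ, 0 ≤ C ∧ ∀ x : Fin d → ℝ, (∀ j, |x j| ≤ 1 / 2) → ∀ j η, |η| ≤ 1 →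
    ‖q (imShift x j η)‖ ≤ C * (‖x‖ + |η|) ^ α

/-- The scale `min(1, t^{-1/2})`. -/
def heatScale (t : ℝ) : ℝ := min 1 (√t)⁻¹

lemma heatScale_pos {t : ℝ} (ht : 0 < t) : 0 < heatScale t :=
  lt_min one_pos (inv_pos.2 (Real.sqrt_pos.2 ht))

lemma heatScale_le_one (t : ℝ) : heatScale t ≤ 1 := min_le_left _ _

lemma mul_heatScale_sq_le {t : ℝ} (ht : 0 < t) : t * heatScale t ^ 2 ≤ 1 := by
  have h : heatScale t ≤ (√t)⁻¹ := min_le_right _ _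
  calc t * heatScale t ^ 2 ≤ t * ((√t)⁻¹) ^ 2 := by
        gcongr; exact (heatScale_pos ht).le
    _ = 1 := by rw [inv_pow, Real.sq_sqrt ht.le]; field_simp

/-- Lets half of a Gaussian exponent absorb the polynomial prefactor of the majorant. -/
lemma add_one_sq_le {c : ℝ} (hc : 0 < c) {y : ℝ} :
    (y + 1) ^ 2 ≤ (2 + 4 / c) * Real.exp (c * y ^ 2 / 2) := by
  have h1 : c * y ^ 2 / 2 + 1 ≤ Real.exp (c * y ^ 2 / 2) := Real.add_one_le_exp _
  have h2 : (y + 1) ^ 2 ≤ 2 + 2 * y ^ 2 := by nlinarith [sq_nonneg (y - 1)]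
  have h3 : (2 + 4 / c) * (c * y ^ 2 / 2 + 1) = 2 + 2 * y ^ 2 + (c * y ^ 2 + 4 / c) := by
    field_simp; ring
  have h4 : 0 ≤ c * y ^ 2 + 4 / c := by positivity
  nlinarith [mul_le_mul_of_nonneg_left h1 (by positivity : 0 ≤ 2 + 4 / c)]

lemma integral_cube_gaussian_le {c : ℝ} (hc : 0 < c) :
    ∫ x, Real.exp (-(c * ∑ i, x i ^ 2)) ∂cube d ≤ (√(Real.pi / c)) ^ d := by
  have h1 : ∀ x : Fin d → ℝ, Real.exp (-(c * ∑ i, x i ^ 2)) =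
      ∏ i, Real.exp (-c * x i ^ 2) := by
    intro x; rw [← Real.exp_sum, ← Finset.mul_sum]; ring_nf
  simp only [h1, cube]
  rw [integral_fintype_prod_eq_prod (𝕜 := ℝ) (fun _ : Fin d => fun t : ℝ => Real.exp (-c * t ^ 2))]
  have h2 : ∫ t in Ioc (-1 / 2 : ℝ) (-1 / 2 + 1), Real.exp (-c * t ^ 2) ≤ √(Real.pi / c) := by
    rw [← integral_gaussian]
    exact setIntegral_le_integral (integrable_exp_neg_mul_sq hc)
      (Eventually.of_forall fun t => (Real.exp_pos _).le)
  calc _ ≤ ∏ _i : Fin d, √(Real.pi / c) := Finset.prod_le_prod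
        (fun i _ => integral_nonneg fun t => (Real.exp_pos _).le) fun i _ => h2
    _ = _ := by simp

lemma norm_sq_le_sum_sq (x : Fin d → ℝ) : ‖x‖ ^ 2 ≤ ∑ i, x i ^ 2 := by
  have h : ‖x‖ ≤ √(∑ i, x i ^ 2) := by
    refine (pi_norm_le_iff_of_nonneg (Real.sqrt_nonneg _)).2 fun i => ?_
    rw [Real.norm_eq_abs]
    exact Real.abs_le_sqrt (Finset.single_le_sum (f := fun i => x i ^ 2)
      (fun i _ => sq_nonneg _) (Finset.mem_univ i))
  calc ‖x‖ ^ 2 ≤ (√(∑ i, x i ^ 2)) ^ 2 := by gcongr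
    _ = _ := Real.sq_sqrt (Finset.sum_nonneg fun i _ => sq_nonneg _)

/-- The heat-kernel type majorant. -/
def majorant (c : ℝ) (α : ℕ) (t : ℝ) (x : Fin d → ℝ) : ℝ :=
  (‖x‖ + heatScale t) ^ α * Real.exp (-(c * t * ∑ i, x i ^ 2))

lemma continuous_majorant (c : ℝ) (α : ℕ) (t : ℝ) : Continuous (majorant (d := d) c α t) := by
  unfold majorant; fun_prop

lemma ae_norm_cube_le : ∀ᵐ x ∂cube d, ‖x‖ ≤ 1 := by
  filter_upwards [ae_cube_abs_le (d := d)] with x hx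
  refine (pi_norm_le_iff_of_nonneg zero_le_one).2 fun i => ?_
  rw [Real.norm_eq_abs]; linarith [hx i]

/-- The majorant has integral at most of order `min(1, t^{-1/2})^{d+α}`. -/
lemma exists_integral_majorant_le {c : ℝ} (hc : 0 < c) {α : ℕ} (hα : α ≤ 2) :
    ∃ C : ℝ, 0 ≤ C ∧ ∀ t, 0 < t →
      ∫ x, majorant c α t x ∂cube d ≤ C * heatScale t ^ (d + α) := by
  -- The first summand serves t ≤ 1, where the heat scale is 1 and the cube has measure 1; the
  -- second serves t ≥ 1, where the Gaussian integral gives t^{-d/2}.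
  set K : ℝ := 2 ^ α + (2 + 4 / c) * (√(Real.pi / (c / 2))) ^ d with hK
  refine ⟨K, by positivity, fun t ht => ?_⟩
  rcases le_total t 1 with h1 | h1
  · have hs : heatScale t = 1 := by
      refine min_eq_left ((one_le_inv₀ (Real.sqrt_pos.2 ht)).2 ?_)
      exact Real.sqrt_le_one.2 h1
    have : ∫ x, majorant c α t x ∂cube d ≤ ∫ _, (2 : ℝ) ^ α ∂cube d := by
      refine integral_mono_ae (integrable_cube_of_continuous (continuous_majorant c α t))
        (integrable_const _) ?_
      filter_upwards [ae_norm_cube_le (d := d)] with x hx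
      rw [majorant, hs]
      calc (‖x‖ + 1) ^ α * Real.exp (-(c * t * ∑ i, x i ^ 2)) ≤ 2 ^ α * 1 := by
            gcongr
            · linarith
            · rw [Real.exp_le_one_iff]
              have : 0 ≤ ∑ i, x i ^ 2 := Finset.sum_nonneg fun i _ => sq_nonneg _
              have := mul_nonneg (mul_pos hc ht).le this
              linarith
        _ = 2 ^ α := mul_one _
    rw [hs, one_pow, mul_one]
    refine this.trans ?_
    simp only [integral_const, probReal_univ, smul_eq_mul, one_mul, hK]
    have : 0 ≤ (2 + 4 / c) * (√(Real.pi / (c / 2))) ^ d := by positivity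
    linarith
  · have hst : 1 ≤ √t := Real.one_le_sqrt.2 h1
    have hs : heatScale t = (√t)⁻¹ := min_eq_right (inv_le_one_of_one_le₀ hst)
    have h0 : 0 < √t := by positivity
    have hpt : ∀ x : Fin d → ℝ, majorant c α t x ≤
        (√t)⁻¹ ^ α * (2 + 4 / c) * Real.exp (-(c * t / 2 * ∑ i, x i ^ 2)) := by
      intro x
      have e1 : ‖x‖ + (√t)⁻¹ = (√t)⁻¹ * (√t * ‖x‖ + 1) := by field_simp
      -- The base is at least 1, so α ≤ 2 reduces the power to a square.
      have e2 : (√t * ‖x‖ + 1) ^ α ≤ (2 + 4 / c) * Real.exp (c * (√t * ‖x‖) ^ 2 / 2) := by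
        refine le_trans ?_ (add_one_sq_le hc)
        exact pow_le_pow_right₀ (by linarith [mul_nonneg h0.le (norm_nonneg x)]) hα
      have e3 : c * (√t * ‖x‖) ^ 2 / 2 ≤ c * t / 2 * ∑ i, x i ^ 2 := by
        rw [mul_pow, Real.sq_sqrt ht.le]
        have := mul_le_mul_of_nonneg_left (norm_sq_le_sum_sq x) (by positivity : 0 ≤ c * t / 2)
        linarith
      rw [majorant, hs, e1, mul_pow]
      refine (mul_assoc _ _ _).trans_le ?_
      rw [mul_assoc ((√t)⁻¹ ^ α)]
      refine mul_le_mul_of_nonneg_left ?_ (by positivity)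
      calc (√t * ‖x‖ + 1) ^ α * Real.exp (-(c * t * ∑ i, x i ^ 2)) ≤
          ((2 + 4 / c) * Real.exp (c * t / 2 * ∑ i, x i ^ 2)) *
            Real.exp (-(c * t * ∑ i, x i ^ 2)) := by
            gcongr
            exact e2.trans (mul_le_mul_of_nonneg_left (Real.exp_le_exp.2 e3) (by positivity))
        _ = _ := by
            rw [mul_assoc, ← Real.exp_add]; ring_nf
    calc ∫ x, majorant c α t x ∂cube d
        ≤ ∫ x, (√t)⁻¹ ^ α * (2 + 4 / c) * Real.exp (-(c * t / 2 * ∑ i, x i ^ 2)) ∂cube d :=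
          integral_mono (integrable_cube_of_continuous (continuous_majorant c α t))
            (integrable_cube_of_continuous (by fun_prop)) hpt
      _ ≤ (√t)⁻¹ ^ α * (2 + 4 / c) * (√(Real.pi / (c * t / 2))) ^ d := by
          rw [integral_const_mul]
          gcongr
          exact integral_cube_gaussian_le (by positivity)
      _ = (2 + 4 / c) * (√(Real.pi / (c / 2))) ^ d * heatScale t ^ (d + α) := by
          have : Real.pi / (c * t / 2) = (Real.pi / (c / 2)) * t⁻¹ := by field_simp
          rw [this, Real.sqrt_mul (by positivity), Real.sqrt_inv, mul_pow, hs, pow_add]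
          ring
      _ ≤ _ := by
          have := (heatScale_pos ht).le
          gcongr
          rw [hK]
          have : (0 : ℝ) ≤ 2 ^ α := by positivity
          linarith

/-- `exp(-y)` decays faster than any power of `1 + y`. -/
lemma exp_neg_le_inv_pow (n : ℕ) {y : ℝ} (hy : 0 ≤ y) :
    Real.exp (-y) ≤ (n.factorial * Real.exp 1) * ((1 + y) ^ n)⁻¹ := by
  have h := Real.pow_div_factorial_le_exp (x := 1 + y) (by positivity) n
  rw [div_le_iff₀ (by positivity), Real.exp_add] at h
  rw [Real.exp_neg, ← div_eq_mul_inv, le_div_iff₀ (by positivity), inv_mul_le_iff₀ (Real.exp_pos _)]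
  linarith

/-- The exponential is traded for the inverse power n+1. For t ≥ 1 the powers of √t carrying α
cancel; for t ≤ 1 the hypothesis α ≥ 1 bounds the singularity by t^{-1/2}. What remains can be
integrated in closed form. -/
lemma heatScale_weight_le {α : ℕ} (hα : α = 1 ∨ α = 2) (n : ℕ) :
    ∃ C : ℝ, 0 ≤ C ∧ ∀ t r : ℝ, 0 < t → 0 ≤ r →
      t ^ ((α : ℝ) / 2 - 1) * (heatScale t ^ (n + α) * Real.exp (-(heatScale t * r))) ≤
        C * ((√t)⁻¹ * ((√t + r + 1) ^ (n + 1))⁻¹) := by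
  set K : ℝ := ((n + 1).factorial * Real.exp 1) with hK
  have hK0 : 0 ≤ K := by positivity
  refine ⟨K * 2 ^ (n + 1), by positivity, fun t r ht hr => ?_⟩
  have hs0 : 0 < √t := Real.sqrt_pos.2 ht
  have hpow : t ^ ((α : ℝ) / 2 - 1) = √t ^ α * (√t ^ 2)⁻¹ := by
    rw [Real.sq_sqrt ht.le, Real.rpow_sub ht, Real.rpow_one, div_eq_mul_inv,
      Real.sqrt_eq_rpow, ← Real.rpow_natCast, ← Real.rpow_mul ht.le]
    congr 2; ring
  have hexp := exp_neg_le_inv_pow (n + 1) (mul_nonneg (heatScale_pos ht).le hr)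
  rw [hpow]
  rcases le_total t 1 with h1 | h1
  · have hst : √t ≤ 1 := Real.sqrt_le_one.2 h1
    have hs : heatScale t = 1 := min_eq_left ((one_le_inv₀ hs0).2 hst)
    rw [hs, one_mul] at hexp
    rw [hs, one_pow, one_mul, one_mul]
    have e1 : √t ^ α * (√t ^ 2)⁻¹ ≤ (√t)⁻¹ := by
      rcases hα with rfl | rfl
      · apply le_of_eq; field_simp
      · rw [mul_inv_cancel₀ (by positivity)]; exact (one_le_inv₀ hs0).2 hst
    have e2 : ((1 + r) ^ (n + 1))⁻¹ ≤ 2 ^ (n + 1) * ((√t + r + 1) ^ (n + 1))⁻¹ := by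
      rw [← div_eq_mul_inv, ← div_pow, ← inv_pow]
      gcongr
      rw [le_div_iff₀ (by positivity), inv_mul_le_iff₀ (by positivity)]
      linarith
    calc √t ^ α * (√t ^ 2)⁻¹ * Real.exp (-r)
        ≤ (√t)⁻¹ * (K * (2 ^ (n + 1) * ((√t + r + 1) ^ (n + 1))⁻¹)) := by
          gcongr
          exact hexp.trans (by gcongr)
      _ = _ := by ring
  · have hst : 1 ≤ √t := Real.one_le_sqrt.2 h1
    have hs : heatScale t = (√t)⁻¹ := min_eq_right (inv_le_one_of_one_le₀ hst)
    rw [hs] at hexp ⊢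
    have e3 : ((1 + (√t)⁻¹ * r) ^ (n + 1))⁻¹ = √t ^ (n + 1) * ((√t + r) ^ (n + 1))⁻¹ := by
      have : 1 + (√t)⁻¹ * r = (√t)⁻¹ * (√t + r) := by field_simp
      rw [this, mul_pow, mul_inv, inv_pow, inv_inv]
    have e2 : ((√t + r) ^ (n + 1))⁻¹ ≤ 2 ^ (n + 1) * ((√t + r + 1) ^ (n + 1))⁻¹ := by
      rw [← div_eq_mul_inv, ← div_pow, ← inv_pow]
      gcongr
      rw [le_div_iff₀ (by positivity), inv_mul_le_iff₀ (by positivity)]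
      linarith
    calc √t ^ α * (√t ^ 2)⁻¹ * ((√t)⁻¹ ^ (n + α) * Real.exp (-((√t)⁻¹ * r)))
        ≤ √t ^ α * (√t ^ 2)⁻¹ * ((√t)⁻¹ ^ (n + α) *
          (K * (√t ^ (n + 1) * (2 ^ (n + 1) * ((√t + r + 1) ^ (n + 1))⁻¹)))) := by
          gcongr
          refine hexp.trans ?_
          rw [e3]; gcongr
      _ = _ := by
          rw [pow_add, pow_succ (√t) n, inv_pow, inv_pow]
          field_simp

/-- An explicit primitive is -(2/n)(√t + L)^{-n}; the singularity t^{-1/2} at 0 is the derivative of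
√t up to a factor. -/
lemma integrableOn_sqrt_weight {n : ℕ} (hn : 0 < n) {L : ℝ} (hL : 0 < L) :
    IntegrableOn (fun t : ℝ => (√t)⁻¹ * ((√t + L) ^ (n + 1))⁻¹) (Ioi 0) ∧
    ∫ t in Ioi (0 : ℝ), (√t)⁻¹ * ((√t + L) ^ (n + 1))⁻¹ = 2 / n * (L ^ n)⁻¹ := by
  set g : ℝ → ℝ := fun t => -(2 / n) * ((√t + L) ^ n)⁻¹ with hg
  have hcont : ContinuousWithinAt g (Ici 0) 0 := by
    have : ContinuousAt g 0 := by
      refine ContinuousAt.mul continuousAt_const (ContinuousAt.inv₀ ?_ ?_)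
      · fun_prop
      · simp only [Real.sqrt_zero, zero_add]; positivity
    exact this.continuousWithinAt
  have hderiv : ∀ t ∈ Ioi (0 : ℝ), HasDerivAt g ((√t)⁻¹ * ((√t + L) ^ (n + 1))⁻¹) t := by
    intro t ht
    have ht' : (0 : ℝ) < t := ht
    have hs0 : 0 < √t := Real.sqrt_pos.2 ht'
    have h1 := (((Real.hasDerivAt_sqrt ht'.ne').add_const L).fun_pow n).inv (by positivity)
    refine (h1.const_mul (-(2 / n : ℝ))).congr_deriv ?_
    obtain ⟨k, rfl⟩ : ∃ k, n = k + 1 := ⟨n - 1, by omega⟩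
    simp only [Nat.add_sub_cancel]
    have : (0 : ℝ) < √t + L := by positivity
    push_cast
    field_simp
    ring
  have hpos : ∀ t ∈ Ioi (0 : ℝ), 0 ≤ (√t)⁻¹ * ((√t + L) ^ (n + 1))⁻¹ := fun t _ => by positivity
  have hlim : Tendsto g atTop (𝓝 0) := by
    have h1 : Tendsto (fun t : ℝ => (√t + L) ^ n) atTop atTop :=
      (tendsto_pow_atTop hn.ne').comp (tendsto_atTop_add_const_right _ _ Real.tendsto_sqrt_atTop)
    have h2 := (tendsto_inv_atTop_zero.comp h1).const_mul (-(2 / n : ℝ))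
    rw [mul_zero] at h2
    exact h2
  refine ⟨integrableOn_Ioi_deriv_of_nonneg hcont hderiv hpos hlim, ?_⟩
  rw [integral_Ioi_of_hasDerivAt_of_nonneg hcont hderiv hpos hlim]
  simp [hg]

end Decay

/-! ### Critical decay of Fourier coefficients by subordination -/

section KernelDecay
variable {d m : ℕ}

/-- The entries of the semigroup generated by a symbol. -/
def heatEntry (S : EllipticSymbol d m) (a b : Fin m) (t : ℝ) (w : Fin d → ℂ) : ℂ :=
  semigroup (S.toFun w) t (EuclideanSpace.single b 1) a

lemma periodicEntire_heatEntry (S : EllipticSymbol d m) (a b : Fin m) (t : ℝ) :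
    PeriodicEntire (heatEntry S a b t) := by
  have h1 : PeriodicEntire fun w => (t : ℂ) • (-(S.toFun w)) := by
    have := S.entire.comp_clm ((t : ℂ) • (-(ContinuousLinearMap.id ℂ _)))
    simpa using this
  have h2 := h1.exp.comp_clm (ContinuousLinearMap.apply ℂ (CDisp m) (EuclideanSpace.single b 1))
  exact h2.comp_clm (EuclideanSpace.proj a : CDisp m →L[ℂ] ℂ)

lemma continuous_heatEntry (S : EllipticSymbol d m) (a b : Fin m) :
    Continuous fun p : (Fin d → ℝ) × ℝ => heatEntry S a b p.2 (ofReal p.1) := by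
  have hd : Continuous (NormedSpace.exp : (CDisp m →L[ℂ] CDisp m) → _) :=
    continuous_iff_continuousAt.2 fun x => (NormedSpace.exp_analytic (𝕂 := ℂ) x).continuousAt
  have h1 : Continuous fun p : (Fin d → ℝ) × ℝ =>
      NormedSpace.exp ((p.2 : ℂ) • (-(S.toFun (ofReal p.1)))) := by
    have h2 : Continuous fun p : (Fin d → ℝ) × ℝ => S.toFun (ofReal p.1) :=
      S.entire.continuous.comp (continuous_ofReal.comp continuous_fst)
    exact hd.comp ((Complex.continuous_ofReal.comp continuous_snd).smul h2.neg)
  exact (EuclideanSpace.proj a : CDisp m →L[ℂ] ℂ).continuous.comp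
    ((ContinuousLinearMap.apply ℂ (CDisp m) (EuclideanSpace.single b 1)).continuous.comp h1)

/-- A shift of at most the heat scale satisfies tη² ≤ 1, so the loss in the numerical range costs
only the constant factor exp(upper), uniformly in t. -/
lemma norm_heatEntry_imShift_le (S : EllipticSymbol d m) (a b : Fin m) {t : ℝ} (ht : 0 < t)
    {x : Fin d → ℝ} (hx : ∀ j, |x j| ≤ 1 / 2) (j : Fin d) {η : ℝ} (hη : |η| ≤ heatScale t) :
    ‖heatEntry S a b t (imShift x j η)‖ ≤
      Real.exp S.upper * Real.exp (-(S.lower * t * ∑ i, x i ^ 2)) := by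
  have h1 := norm_semigroup_apply_le (S.bound x hx j η (hη.trans (heatScale_le_one t))) ht.le
    (EuclideanSpace.single b 1)
  have h2 : ‖heatEntry S a b t (imShift x j η)‖ ≤
      ‖semigroup (S.toFun (imShift x j η)) t (EuclideanSpace.single b 1)‖ :=
    PiLp.norm_apply_le _ a
  refine h2.trans (h1.trans ?_)
  rw [PiLp.norm_single, norm_one, mul_one, ← Real.exp_add]
  apply Real.exp_le_exp.2
  have h3 : t * η ^ 2 ≤ 1 := by
    refine le_trans ?_ (mul_heatScale_sq_le ht)
    rw [← sq_abs η]; gcongr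
  nlinarith [mul_le_mul_of_nonneg_left h3 S.upper_nonneg]

lemma VanishingFactor.exists_norm_mul_heatEntry_le {q : (Fin d → ℂ) → ℂ} {α : ℕ}
    (hq : VanishingFactor q α) (S : EllipticSymbol d m) :
    ∃ C : ℝ, 0 ≤ C ∧ ∀ a b t, 0 < t → ∀ x : Fin d → ℝ, (∀ j, |x j| ≤ 1 / 2) → ∀ j η,
      |η| ≤ heatScale t →
      ‖q (imShift x j η) * heatEntry S a b t (imShift x j η)‖ ≤ C * majorant S.lower α t x := by
  obtain ⟨C, hC, h⟩ := hq.bound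
  refine ⟨C * Real.exp S.upper, by positivity, fun a b t ht x hx j η hη => ?_⟩
  have h1 := h x hx j η (hη.trans (heatScale_le_one t))
  have h2 := norm_heatEntry_imShift_le S a b ht hx j hη
  have h3 : C * (‖x‖ + |η|) ^ α ≤ C * (‖x‖ + heatScale t) ^ α := by gcongr
  have := heatScale_pos ht
  calc _ = ‖q (imShift x j η)‖ * ‖heatEntry S a b t (imShift x j η)‖ := norm_mul _ _
    _ ≤ (C * (‖x‖ + heatScale t) ^ α) *
        (Real.exp S.upper * Real.exp (-(S.lower * t * ∑ i, x i ^ 2))) :=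
      mul_le_mul (h1.trans h3) h2 (norm_nonneg _) (by positivity)
    _ = _ := by rw [majorant]; ring

lemma exists_abs_eq_norm [NeZero d] (z : Fin d → ℤ) : ∃ j, (|(z j : ℝ)|) = ‖z‖ := by
  obtain ⟨j, hj⟩ := Finite.exists_max fun j => |(z j : ℝ)|
  refine ⟨j, le_antisymm ?_ ?_⟩
  · have := norm_le_pi_norm z j
    rwa [Int.norm_eq_abs] at this
  · refine (pi_norm_le_iff_of_nonneg (abs_nonneg _)).2 fun i => ?_
    rw [Int.norm_eq_abs]; exact hj i

/-- Decay of the Fourier coefficients of a heat semigroup, uniformly in time. -/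
lemma VanishingFactor.exists_norm_heat_coeff_le [NeZero d] {q : (Fin d → ℂ) → ℂ} {α : ℕ}
    (hq : VanishingFactor q α) (hα : α ≤ 2) (S : EllipticSymbol d m) :
    ∃ C : ℝ, 0 ≤ C ∧ ∀ a b t, 0 < t → ∀ z : Fin d → ℤ,
      ‖∫ x, character z (ofReal x) * (q (ofReal x) * heatEntry S a b t (ofReal x)) ∂cube d‖ ≤
        C * (heatScale t ^ (d + α) * Real.exp (-(heatScale t * ‖z‖))) := by
  obtain ⟨C, hC, h⟩ := hq.exists_norm_mul_heatEntry_le S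
  obtain ⟨K, hK, hint⟩ := exists_integral_majorant_le (d := d) S.lower_pos hα
  refine ⟨C * K, by positivity, fun a b t ht z => ?_⟩
  obtain ⟨j, hj⟩ := exists_abs_eq_norm z
  -- The shift is taken in a direction j where |z_j| equals the sup norm, and its sign follows z_j,
  -- so that the character decays in terms of the full norm of z.
  obtain ⟨η, hη, hzη⟩ : ∃ η : ℝ, |η| ≤ heatScale t ∧ z j * η = heatScale t * ‖z‖ := by
    have hp := (heatScale_pos ht).le
    rcases le_total 0 (z j : ℝ) with h0 | h0
    · exact ⟨heatScale t, (abs_of_nonneg hp).le, by rw [← hj, abs_of_nonneg h0]; ring⟩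
    · exact ⟨-heatScale t, by rw [abs_neg, abs_of_nonneg hp],
        by rw [← hj, abs_of_nonpos h0]; ring⟩
  have hent : PeriodicEntire fun w => character z w * (q w * heatEntry S a b t w) :=
    (periodicEntire_character z).mul (hq.entire.mul (periodicEntire_heatEntry S a b t))
  rw [← hent.integral_imShift j η]
  have hle : Real.exp (-(2 * Real.pi * z j * η)) ≤ Real.exp (-(heatScale t * ‖z‖)) := by
    apply Real.exp_le_exp.2
    rw [mul_assoc (2 * Real.pi), hzη]
    have : 0 ≤ heatScale t * ‖z‖ := mul_nonneg (heatScale_pos ht).le (norm_nonneg _)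
    nlinarith [Real.pi_gt_three]
  calc _ ≤ ∫ x, Real.exp (-(heatScale t * ‖z‖)) * (C * majorant S.lower α t x) ∂cube d := by
        refine norm_integral_le_of_norm_le (((integrable_cube_of_continuous
          (continuous_majorant S.lower α t)).const_mul _).const_mul _) ?_
        filter_upwards [ae_cube_abs_le (d := d)] with x hx
        rw [norm_mul, norm_character_imShift]
        exact mul_le_mul hle (h a b t ht x hx j η hη) (norm_nonneg _) (Real.exp_pos _).le
    _ = Real.exp (-(heatScale t * ‖z‖)) * (C * ∫ x, majorant S.lower α t x ∂cube d) := by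
        rw [integral_const_mul, integral_const_mul]
    _ ≤ Real.exp (-(heatScale t * ‖z‖)) * (C * (K * heatScale t ^ (d + α))) := by
        gcongr; exact hint t ht
    _ = _ := by ring

/-- The product of the semigroup with a vanishing factor is integrable in time and space. -/
lemma VanishingFactor.integrable_prod [NeZero d] {q : (Fin d → ℂ) → ℂ} {α : ℕ}
    (hq : VanishingFactor q α) (hα : α ≤ 2) (S : EllipticSymbol d m) {β : ℝ}
    (hβ : ∃ C : ℝ, ∀ t, 0 < t →
      t ^ β * heatScale t ^ (d + α) ≤ C * ((√t)⁻¹ * ((√t + 1) ^ 2)⁻¹)) (a b : Fin m) :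
    Integrable (fun p : (Fin d → ℝ) × ℝ =>
      q (ofReal p.1) * (((p.2 ^ β : ℝ) : ℂ) * heatEntry S a b p.2 (ofReal p.1)))
      ((cube d).prod (volume.restrict (Ioi 0))) := by
  obtain ⟨C, hC, h⟩ := hq.exists_norm_mul_heatEntry_le S
  obtain ⟨K, hK, hint⟩ := exists_integral_majorant_le (d := d) S.lower_pos hα
  obtain ⟨B, hB⟩ := hβ
  have hmeas : AEStronglyMeasurable (fun p : (Fin d → ℝ) × ℝ =>
      q (ofReal p.1) * (((p.2 ^ β : ℝ) : ℂ) * heatEntry S a b p.2 (ofReal p.1)))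
      ((cube d).prod (volume.restrict (Ioi 0))) := by
    refine AEStronglyMeasurable.mul ?_ (AEStronglyMeasurable.mul ?_ ?_)
    · exact (hq.entire.continuous.comp
        (continuous_ofReal.comp continuous_fst)).aestronglyMeasurable
    · have : Measurable fun p : (Fin d → ℝ) × ℝ => ((p.2 ^ β : ℝ) : ℂ) :=
        Complex.measurable_ofReal.comp (measurable_snd.pow_const β)
      exact this.aestronglyMeasurable
    · exact (continuous_heatEntry S a b).aestronglyMeasurable
  rw [integrable_prod_iff' hmeas]
  have hcont : ∀ t : ℝ, Continuous fun x : Fin d → ℝ =>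
      q (ofReal x) * (((t ^ β : ℝ) : ℂ) * heatEntry S a b t (ofReal x)) := fun t =>
    (hq.entire.continuous.comp continuous_ofReal).mul (continuous_const.mul
      ((periodicEntire_heatEntry S a b t).continuous.comp continuous_ofReal))
  refine ⟨Eventually.of_forall fun t => integrable_cube_of_continuous (hcont t), ?_⟩
  have hbase := (integrableOn_sqrt_weight (n := 1) one_pos (L := 1) one_pos).1
  refine Integrable.mono' ((hbase.const_mul B).const_mul (C * K))
    hmeas.norm.prod_swap.integral_prod_right' ?_
  filter_upwards [ae_restrict_mem measurableSet_Ioi] with t ht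
  have ht : 0 < t := ht
  rw [Real.norm_of_nonneg (integral_nonneg fun x => norm_nonneg _)]
  have hb0 : 0 ≤ t ^ β := Real.rpow_nonneg ht.le β
  calc ∫ x, ‖q (ofReal x) * (((t ^ β : ℝ) : ℂ) * heatEntry S a b t (ofReal x))‖ ∂cube d
      ≤ ∫ x, t ^ β * (C * majorant S.lower α t x) ∂cube d := by
        refine integral_mono_ae (integrable_cube_of_continuous (hcont t).norm)
          (((integrable_cube_of_continuous
            (continuous_majorant S.lower α t)).const_mul _).const_mul _) ?_
        filter_upwards [ae_cube_abs_le (d := d)] with x hx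
        have := h a b t ht x hx 0 0 (by rw [abs_zero]; exact (heatScale_pos ht).le)
        rw [imShift_zero] at this
        calc ‖q (ofReal x) * (((t ^ β : ℝ) : ℂ) * heatEntry S a b t (ofReal x))‖
            = t ^ β * ‖q (ofReal x) * heatEntry S a b t (ofReal x)‖ := by
              rw [norm_mul, norm_mul, norm_mul, Complex.norm_real, Real.norm_of_nonneg hb0]; ring
          _ ≤ _ := by gcongr
    _ = (C * (∫ x, majorant S.lower α t x ∂cube d)) * t ^ β := by
        rw [integral_const_mul, integral_const_mul]; ring
    _ ≤ (C * (K * heatScale t ^ (d + α))) * t ^ β := by gcongr; exact hint t ht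
    _ = (C * K) * (t ^ β * heatScale t ^ (d + α)) := by ring
    _ ≤ _ := mul_le_mul_of_nonneg_left (hB t ht) (by positivity)

lemma heatScale_pow_weight_le {α : ℕ} (hα : α = 1 ∨ α = 2) [NeZero d] :
    ∃ C : ℝ, ∀ t, 0 < t → t ^ ((α : ℝ) / 2 - 1) * heatScale t ^ (d + α) ≤
      C * ((√t)⁻¹ * ((√t + 1) ^ 2)⁻¹) := by
  obtain ⟨C, hC, h⟩ := heatScale_weight_le hα 1
  refine ⟨C, fun t ht => ?_⟩
  have := h t 0 ht le_rfl
  simp only [mul_zero, neg_zero, Real.exp_zero, mul_one, add_zero] at this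
  refine le_trans ?_ this
  have h1 : 1 + α ≤ d + α := by have := NeZero.pos d; omega
  exact mul_le_mul_of_nonneg_left
    (pow_le_pow_of_le_one (heatScale_pos ht).le (heatScale_le_one t) h1) (Real.rpow_nonneg ht.le _)

/-- Without a vanishing factor one power of the heat scale is missing; d ≥ 2 makes up for it. -/
lemma heatScale_pow_weight_le' (hd : 2 ≤ d) :
    ∃ C : ℝ, ∀ t, 0 < t → t ^ ((1 : ℝ) / 2 - 1) * heatScale t ^ (d + 0) ≤
      C * ((√t)⁻¹ * ((√t + 1) ^ 2)⁻¹) := by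
  obtain ⟨C, hC, h⟩ := heatScale_weight_le (α := 1) (Or.inl rfl) 1
  refine ⟨C, fun t ht => ?_⟩
  have := h t 0 ht le_rfl
  simp only [mul_zero, neg_zero, Real.exp_zero, mul_one, add_zero, Nat.cast_one] at this
  refine le_trans ?_ this
  exact mul_le_mul_of_nonneg_left
    (pow_le_pow_of_le_one (heatScale_pos ht).le (heatScale_le_one t) (by omega))
    (Real.rpow_nonneg ht.le _)

/-- The matrix entries of `Γ(α/2)` times the power `-α/2` of the symbol. -/
def powerEntry (S : EllipticSymbol d m) (α : ℕ) (a b : Fin m) (x : Fin d → ℝ) : ℂ :=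
  ∫ t in Ioi (0 : ℝ), ((t ^ ((α : ℝ) / 2 - 1) : ℝ) : ℂ) * heatEntry S a b t (ofReal x)

/-- Critical decay of the Fourier coefficients of symbols of degree zero. -/
theorem VanishingFactor.exists_norm_power_coeff_le [NeZero d] {q : (Fin d → ℂ) → ℂ} {α : ℕ}
    (hq : VanishingFactor q α) (hα : α = 1 ∨ α = 2) (S : EllipticSymbol d m) :
    ∃ C : ℝ, 0 ≤ C ∧ ∀ a b, ∀ z : Fin d → ℤ,
      ‖∫ x, character z (ofReal x) * (q (ofReal x) * powerEntry S α a b x) ∂cube d‖ ≤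
        C * ((1 + ‖z‖) ^ d)⁻¹ := by
  have hα2 : α ≤ 2 := by omega
  obtain ⟨C, hC, h⟩ := hq.exists_norm_heat_coeff_le hα2 S
  obtain ⟨K, hK, hw⟩ := heatScale_weight_le hα d
  refine ⟨C * K * (2 / d), by positivity, fun a b z => ?_⟩
  have hint := hq.integrable_prod hα2 S (heatScale_pow_weight_le hα) a b
  have hint2 : Integrable (Function.uncurry fun (x : Fin d → ℝ) (t : ℝ) =>
      character z (ofReal x) * (q (ofReal x) *
        (((t ^ ((α : ℝ) / 2 - 1) : ℝ) : ℂ) * heatEntry S a b t (ofReal x))))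
      ((cube d).prod (volume.restrict (Ioi 0))) := by
    refine hint.bdd_mul (c := 1) ?_ (Eventually.of_forall fun p => ?_)
    · exact ((continuous_character z).comp
        (continuous_ofReal.comp continuous_fst)).aestronglyMeasurable
    · exact (norm_character_ofReal z p.1).le
  -- Subordination: Fubini turns the coefficient of the negative power into a time integral of heat
  -- coefficients.
  have hswap : ∫ x, character z (ofReal x) * (q (ofReal x) * powerEntry S α a b x) ∂cube d =
      ∫ t in Ioi (0 : ℝ), ((t ^ ((α : ℝ) / 2 - 1) : ℝ) : ℂ) *
        ∫ x, character z (ofReal x) * (q (ofReal x) * heatEntry S a b t (ofReal x)) ∂cube d := by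
    have h1 := integral_integral_swap hint2
    simp only [integral_const_mul] at h1
    rw [show (∫ x, character z (ofReal x) * (q (ofReal x) * powerEntry S α a b x) ∂cube d) = _
      from h1]
    refine integral_congr_ae (Eventually.of_forall fun t => ?_)
    simp only
    rw [← integral_const_mul]
    refine integral_congr_ae (Eventually.of_forall fun x => ?_)
    simp only
    ring
  -- With L = ‖z‖ + 1 the closed form of the time integral is the rate (1+‖z‖)^{-d} itself.
  obtain ⟨hI, hI2⟩ := integrableOn_sqrt_weight (n := d) (NeZero.pos d) (L := ‖z‖ + 1)
    (by positivity)
  rw [hswap]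
  calc _ ≤ ∫ t in Ioi (0 : ℝ), C * (K * ((√t)⁻¹ * ((√t + (‖z‖ + 1)) ^ (d + 1))⁻¹)) := by
        refine norm_integral_le_of_norm_le ((hI.const_mul _).const_mul _) ?_
        filter_upwards [ae_restrict_mem measurableSet_Ioi] with t ht
        have ht : 0 < t := ht
        have hb0 : 0 ≤ t ^ ((α : ℝ) / 2 - 1) := Real.rpow_nonneg ht.le _
        rw [norm_mul, Complex.norm_real, Real.norm_of_nonneg hb0]
        calc _ ≤ t ^ ((α : ℝ) / 2 - 1) *
              (C * (heatScale t ^ (d + α) * Real.exp (-(heatScale t * ‖z‖)))) := by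
              gcongr; exact h a b t ht z
          _ = C * (t ^ ((α : ℝ) / 2 - 1) *
              (heatScale t ^ (d + α) * Real.exp (-(heatScale t * ‖z‖)))) := by ring
          _ ≤ _ := by
              rw [← add_assoc]
              exact mul_le_mul_of_nonneg_left (hw t ‖z‖ ht (norm_nonneg _)) hC
    _ = _ := by
        rw [integral_const_mul, integral_const_mul, hI2, add_comm ‖z‖]; ring

/-- The symbol to the power `-1/2` is integrable. -/
lemma integrable_powerEntry_one (hd : 2 ≤ d) (S : EllipticSymbol d m) (a b : Fin m) :
    Integrable (powerEntry S 1 a b) (cube d) := by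
  have : NeZero d := ⟨by omega⟩
  have hq : VanishingFactor (fun _ : Fin d → ℂ => (1 : ℂ)) 0 :=
    ⟨PeriodicEntire.const 1, 1, zero_le_one, fun x _ j η _ => by simp⟩
  have := hq.integrable_prod (by norm_num) S (heatScale_pow_weight_le' hd) a b
  have h2 := this.integral_prod_left
  simp only [one_mul] at h2
  have e : powerEntry S 1 a b = fun x => ∫ t in Ioi (0 : ℝ),
      ((t ^ ((1 : ℝ) / 2 - 1) : ℝ) : ℂ) * heatEntry S a b t (ofReal x) := by
    funext x; simp only [powerEntry, Nat.cast_one]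
  rw [e]; exact h2

end KernelDecay

namespace DefectCrystal
variable {d m : ℕ} (X : DefectCrystal d m)

/-! ### Lattice coordinates -/

/-- The lattice point with integer coordinates `z`. -/
def lat (z : Fin d → ℤ) : Space d := WithLp.toLp 2 (X.A *ᵥ fun i => (z i : ℝ))

lemma lat_mem (z : Fin d → ℤ) : X.lat z ∈ bravais X.A := ⟨z, rfl⟩

lemma lat_add (z z' : Fin d → ℤ) : X.lat (z + z') = X.lat z + X.lat z' := by
  simp only [lat, ← WithLp.toLp_add, ← Matrix.mulVec_add]
  congr 2; ext i; simp

lemma lat_neg (z : Fin d → ℤ) : X.lat (-z) = -X.lat z := by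
  simp only [lat, ← WithLp.toLp_neg, ← Matrix.mulVec_neg]
  congr 2; ext i; simp

lemma lat_sub (z z' : Fin d → ℤ) : X.lat (z - z') = X.lat z - X.lat z' := by
  rw [sub_eq_add_neg, lat_add, lat_neg, sub_eq_add_neg]

lemma lat_zero : X.lat 0 = 0 := by simpa using X.lat_sub 0 0

lemma inv_mulVec_lat (z : Fin d → ℤ) : X.A⁻¹ *ᵥ (X.lat z).ofLp = fun i => (z i : ℝ) := by
  rw [lat, Matrix.mulVec_mulVec, Matrix.nonsing_inv_mul _ (Ne.isUnit X.det_ne_zero),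
    Matrix.one_mulVec]

lemma lat_injective : Function.Injective X.lat := by
  intro z z' h
  have h1 := X.inv_mulVec_lat z
  rw [h, X.inv_mulVec_lat] at h1
  ext i
  exact_mod_cast (congrFun h1 i).symm

/-- Integer coordinates of lattice points. -/
def coord (x : Space d) : Fin d → ℤ := Function.invFun X.lat x

lemma coord_lat (z : Fin d → ℤ) : X.coord (X.lat z) = z :=
  Function.leftInverse_invFun X.lat_injective z

lemma coord_zero : X.coord 0 = 0 := (congrArg X.coord X.lat_zero).symm.trans (X.coord_lat 0)

lemma lat_coord {x : Space d} (hx : x ∈ bravais X.A) : X.lat (X.coord x) = x := by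
  obtain ⟨z, rfl⟩ := hx
  exact congrArg X.lat (X.coord_lat z)

/-- The lattice is in bijection with `ℤ^d`. -/
def latEquiv : (Fin d → ℤ) ≃ bravais X.A where
  toFun z := ⟨X.lat z, X.lat_mem z⟩
  invFun x := X.coord x.1
  left_inv z := X.coord_lat z
  right_inv x := Subtype.ext (X.lat_coord x.2)

lemma stencil_subset {ρ : Space d} (hρ : ρ ∈ X.stencil) : ρ ∈ bravais X.A := by
  rw [← X.stencil_span]; exact Submodule.subset_span hρ

lemma lat_coord_stencil (ρ : X.stencil) : X.lat (X.coord ρ.1) = ρ.1 :=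
  X.lat_coord (X.stencil_subset ρ.2)

lemma bravais_add {x y : Space d} (hx : x ∈ bravais X.A) (hy : y ∈ bravais X.A) :
    x + y ∈ bravais X.A := by
  rw [← X.lat_coord hx, ← X.lat_coord hy, ← lat_add]; exact X.lat_mem _

lemma bravais_neg {x : Space d} (hx : x ∈ bravais X.A) : -x ∈ bravais X.A := by
  rw [← X.lat_coord hx, ← lat_neg]; exact X.lat_mem _

lemma coord_add {x y : Space d} (hx : x ∈ bravais X.A) (hy : y ∈ bravais X.A) :
    X.coord (x + y) = X.coord x + X.coord y := by
  apply X.lat_injective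
  rw [lat_add, X.lat_coord hx, X.lat_coord hy, X.lat_coord (X.bravais_add hx hy)]

lemma coord_neg {x : Space d} (hx : x ∈ bravais X.A) : X.coord (-x) = -X.coord x := by
  apply X.lat_injective
  rw [lat_neg, X.lat_coord hx, X.lat_coord (X.bravais_neg hx)]

/-! ### The second variation at the reference state -/

/-- The bilinear form `∇²V(0)`, extended sesquilinearly. -/
def homForm (a b : X.stencil → CDisp m) : ℂ :=
  ∑ ρ : X.stencil, ∑ i : Fin m, ∑ σ : X.stencil, ∑ j : Fin m,
    (partial₂ X.pot 0 ρ i σ j : ℂ) * (starRingEnd ℂ (a ρ i) * b σ j)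

end DefectCrystal

/-- A displacement stencil in terms of the standard basis. -/
lemma stencil_eq_sum {d m : ℕ} {R : Finset (Space d)} (g : R → Disp m) :
    g = ∑ ρ : R, ∑ i : Fin m, g ρ i • (Pi.single ρ (EuclideanSpace.single i 1) : R → Disp m) := by
  ext σ j
  simp only [Finset.sum_apply, Pi.smul_apply, WithLp.ofLp_sum, WithLp.ofLp_smul]
  rw [Finset.sum_eq_single σ]
  · simp
  · intro ρ _ hρ
    simp [Pi.single_eq_of_ne hρ.symm]
  · simp

lemma fderiv_fderiv_eq_sum {d m : ℕ} {R : Finset (Space d)} (V : (R → Disp m) → ℝ)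
    (g a b : R → Disp m) :
    fderiv ℝ (fderiv ℝ V) g a b =
      ∑ ρ : R, ∑ i : Fin m, ∑ σ : R, ∑ j : Fin m, partial₂ V g ρ i σ j * (a ρ i * b σ j) := by
  have h1 : fderiv ℝ (fderiv ℝ V) g a b = ∑ ρ : R, ∑ i : Fin m, a ρ i *
      fderiv ℝ (fderiv ℝ V) g (Pi.single ρ (EuclideanSpace.single i 1)) b := by
    conv_lhs => rw [stencil_eq_sum a]
    simp only [map_sum, map_smul, _root_.sum_apply, _root_.smul_apply, smul_eq_mul]
  rw [h1]
  refine Finset.sum_congr rfl fun ρ _ => Finset.sum_congr rfl fun i _ => ?_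
  conv_lhs => rw [stencil_eq_sum b]
  simp only [map_sum, map_smul, smul_eq_mul, Finset.mul_sum, partial₂]
  exact Finset.sum_congr rfl fun σ _ => Finset.sum_congr rfl fun j _ => by ring

namespace DefectCrystal
variable {d m : ℕ} (X : DefectCrystal d m)

/-- The real part of a complex displacement. -/
def rePart (v : CDisp m) : Disp m := WithLp.toLp 2 fun i => (v i).re

/-- The imaginary part of a complex displacement. -/
def imPart (v : CDisp m) : Disp m := WithLp.toLp 2 fun i => (v i).im

lemma norm_sq_rePart_add (v : CDisp m) : ‖rePart v‖ ^ 2 + ‖imPart v‖ ^ 2 = ‖v‖ ^ 2 := by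
  simp only [EuclideanSpace.norm_sq_eq, ← Finset.sum_add_distrib]
  refine Finset.sum_congr rfl fun i _ => ?_
  simp only [rePart, imPart, Real.norm_eq_abs, sq_abs]
  rw [← Complex.normSq_eq_norm_sq, Complex.normSq_apply]; ring

lemma rePart_sub (v w : CDisp m) : rePart (v - w) = rePart v - rePart w := by
  ext i; simp [rePart]

lemma imPart_sub (v w : CDisp m) : imPart (v - w) = imPart v - imPart w := by
  ext i; simp [imPart]

/-- The coefficients are real, and Re(conj(a) b) = Re a Re b + Im a Im b holds term by term, so no
symmetry of the form is involved. -/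
lemma homForm_self_re (a : X.stencil → CDisp m) :
    (X.homForm a a).re = fderiv ℝ (fderiv ℝ X.pot) 0 (fun ρ => rePart (a ρ)) (fun ρ => rePart (a ρ))
      + fderiv ℝ (fderiv ℝ X.pot) 0 (fun ρ => imPart (a ρ)) (fun ρ => imPart (a ρ)) := by
  simp only [fderiv_fderiv_eq_sum, homForm, Complex.re_sum, ← Finset.sum_add_distrib]
  refine Finset.sum_congr rfl fun ρ _ => Finset.sum_congr rfl fun i _ =>
    Finset.sum_congr rfl fun σ _ => Finset.sum_congr rfl fun j _ => ?_
  simp only [rePart, imPart, Complex.mul_re, Complex.conj_re, Complex.conj_im, Complex.ofReal_re,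
    Complex.ofReal_im]
  ring

/-- The difference stencil of a function on `ℤ^d`. -/
def homD (w : (Fin d → ℤ) → CDisp m) (z : Fin d → ℤ) (ρ : X.stencil) : CDisp m :=
  w (z + X.coord ρ.1) - w z

/-- Stability concerns real displacements; it is applied separately to the real and the imaginary
part, extended by zero off the lattice, and the two results are added. The set s carries all
differences, so that the infinite sums become finite. -/
lemma lattice_stable_complex {c₀ : ℝ} (h : ∀ v : Space d → Disp m, v.support.Finite →
    c₀ * ∑' ℓ : bravais X.A, ∑ ρ : X.stencil, ‖v (ℓ.1 + ρ.1) - v ℓ.1‖ ^ 2 ≤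
      ∑' ℓ : bravais X.A, fderiv ℝ (fderiv ℝ X.pot) 0
        (fun ρ => v (ℓ.1 + ρ.1) - v ℓ.1) (fun ρ => v (ℓ.1 + ρ.1) - v ℓ.1))
    {w : (Fin d → ℤ) → CDisp m} (hw : w.support.Finite) {s : Finset (Fin d → ℤ)}
    (hs : ∀ z, z ∉ s → X.homD w z = 0) :
    0 ≤ ∑ z ∈ s, ((X.homForm (X.homD w z) (X.homD w z)).re -
      c₀ * ∑ ρ, ‖X.homD w z ρ‖ ^ 2) := by
  classical
  have key : ∀ P : CDisp m → Disp m, P 0 = 0 → (∀ a b, P (a - b) = P a - P b) →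
      c₀ * ∑ z ∈ s, ∑ ρ, ‖P (X.homD w z ρ)‖ ^ 2 ≤ ∑ z ∈ s, fderiv ℝ (fderiv ℝ X.pot) 0
        (fun ρ => P (X.homD w z ρ)) (fun ρ => P (X.homD w z ρ)) := by
    intro P hP0 hPs
    set v : Space d → Disp m := fun x => if x ∈ bravais X.A then P (w (X.coord x)) else 0 with hv
    have hvfin : v.support.Finite := by
      refine (hw.image X.lat).subset fun x hx => ?_
      by_cases hxb : x ∈ bravais X.A
      · refine ⟨X.coord x, fun h0 => hx ?_, X.lat_coord hxb⟩
        simp [hv, hxb, h0, hP0]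
      · exact absurd (by simp [hv, hxb]) hx
    have hdiff : ∀ z (ρ : X.stencil), v (X.lat z + ρ.1) - v (X.lat z) = P (X.homD w z ρ) := by
      intro z ρ
      have h1 : X.lat z + ρ.1 ∈ bravais X.A := X.bravais_add (X.lat_mem z) (X.stencil_subset ρ.2)
      simp only [hv, h1, X.lat_mem z, if_true, X.coord_add (X.lat_mem z) (X.stencil_subset ρ.2),
        X.coord_lat, ← hPs]
      rfl
    have h1 := h v hvfin
    rw [← X.latEquiv.tsum_eq, ← X.latEquiv.tsum_eq] at h1
    simp only [latEquiv, Equiv.coe_fn_mk, hdiff] at h1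
    rwa [tsum_eq_sum (s := s), tsum_eq_sum (s := s)] at h1
    · intro z hz
      simp [hs z hz, hP0]
      exact map_zero _
    · intro z hz
      simp [hs z hz, hP0]
  have h1 := key rePart (by ext; simp [rePart]) rePart_sub
  have h2 := key imPart (by ext; simp [imPart]) imPart_sub
  have h3 : ∀ z, ∑ ρ, ‖X.homD w z ρ‖ ^ 2 =
      ∑ ρ, ‖rePart (X.homD w z ρ)‖ ^ 2 + ∑ ρ, ‖imPart (X.homD w z ρ)‖ ^ 2 := by
    intro z
    rw [← Finset.sum_add_distrib]
    exact Finset.sum_congr rfl fun ρ _ => (norm_sq_rePart_add _).symm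
  simp only [homForm_self_re, h3, Finset.sum_sub_distrib, Finset.sum_add_distrib, mul_add,
    ← Finset.mul_sum]
  linarith

end DefectCrystal

/-! ### Lattice stability tested with truncated plane waves -/

/-- The box `{z : |z_j| ≤ n}` in `ℤ^d`. -/
def latticeBox (d n : ℕ) : Finset (Fin d → ℤ) := Finset.Icc (fun _ => -(n : ℤ)) (fun _ => (n : ℤ))

lemma mem_latticeBox {d n : ℕ} {z : Fin d → ℤ} : z ∈ latticeBox d n ↔ ∀ j, |z j| ≤ n := by
  simp only [latticeBox, Finset.mem_Icc, Pi.le_def, abs_le, forall_and]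

lemma card_latticeBox (d n : ℕ) : (latticeBox d n).card = (2 * n + 1) ^ d := by
  rw [latticeBox, Pi.card_Icc]
  simp only [Int.card_Icc, Finset.prod_const, Finset.card_univ, Fintype.card_fin]
  congr 1
  omega

/-- If a bulk term and a boundary term of smaller order have non-negative sums over all boxes, then
the bulk term is non-negative. -/
lemma nonneg_of_box_estimate {d R : ℕ} {τ K : ℝ} (h : ∀ n : ℕ,
    0 ≤ τ * (2 * n + 1) ^ d + K * ((2 * (n + 2 * R) + 1) ^ d - (2 * n + 1) ^ d)) : 0 ≤ τ := by
  -- Divided by the volume of the inner box, the boundary term tends to zero.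
  have h1 : ∀ n : ℕ, 0 ≤ τ + K * ((1 + 4 * R / (2 * n + 1 : ℝ)) ^ d - 1) := by
    intro n
    have hp : (0 : ℝ) < (2 * n + 1) ^ d := by positivity
    have h2 : (1 + 4 * R / (2 * n + 1 : ℝ)) ^ d = (2 * (n + 2 * R) + 1) ^ d / (2 * n + 1) ^ d := by
      rw [← div_pow]; congr 1; field_simp; ring
    have h3 := div_nonneg (h n) hp.le
    have e : ∀ p q : ℝ, 0 < p → τ + K * (q / p - 1) = (τ * p + K * (q - p)) / p := by
      intro p q hp; field_simp
    rw [h2, e _ _ hp]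
    exact h3
  have h2 : Tendsto (fun n : ℕ => τ + K * ((1 + 4 * R / (2 * n + 1 : ℝ)) ^ d - 1)) atTop
      (𝓝 (τ + K * ((1 + 0) ^ d - 1))) := by
    have h4 : Tendsto (fun n : ℕ => (2 * n + 1 : ℝ)) atTop atTop :=
      tendsto_atTop_add_const_right _ _
        (tendsto_natCast_atTop_atTop.const_mul_atTop (by norm_num))
    have h3 : Tendsto (fun n : ℕ => 4 * R / (2 * n + 1 : ℝ)) atTop (𝓝 0) :=
      Tendsto.const_div_atTop h4 _
    exact tendsto_const_nhds.add (((((tendsto_const_nhds.add h3).pow d).sub_const 1)).const_mul K)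
  simpa using ge_of_tendsto' h2 h1

namespace DefectCrystal
variable {d m : ℕ} (X : DefectCrystal d m)

/-- The multiplier of the difference in the direction `r`. -/
def diffFactor (r : Fin d → ℤ) (w : Fin d → ℂ) : ℂ := character r w - 1

lemma homForm_smul (c : ℂ) (a b : X.stencil → CDisp m) :
    X.homForm (fun ρ => c • a ρ) (fun ρ => c • b ρ) = (‖c‖ ^ 2 : ℝ) * X.homForm a b := by
  simp only [homForm, Finset.mul_sum]
  refine Finset.sum_congr rfl fun ρ _ => Finset.sum_congr rfl fun i _ =>
    Finset.sum_congr rfl fun σ _ => Finset.sum_congr rfl fun j _ => ?_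
  simp only [PiLp.smul_apply, smul_eq_mul, map_mul]
  have : ((‖c‖ ^ 2 : ℝ) : ℂ) = starRingEnd ℂ c * c := by
    rw [← Complex.normSq_eq_norm_sq, Complex.normSq_eq_conj_mul_self]
  rw [this]; ring

/-- A bound for the bilinear form `∇²V(0)`. -/
def homBound : ℝ := ∑ ρ : X.stencil, ∑ i : Fin m, ∑ σ : X.stencil, ∑ j : Fin m,
  |partial₂ X.pot 0 ρ i σ j|

lemma norm_homForm_le {a b : X.stencil → CDisp m} {s t : ℝ} (hs : 0 ≤ s)
    (ha : ∀ ρ, ‖a ρ‖ ≤ s) (hb : ∀ ρ, ‖b ρ‖ ≤ t) : ‖X.homForm a b‖ ≤ X.homBound * (s * t) := by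
  simp only [homForm, homBound, Finset.sum_mul]
  refine (norm_sum_le _ _).trans (Finset.sum_le_sum fun ρ _ => ?_)
  refine (norm_sum_le _ _).trans (Finset.sum_le_sum fun i _ => ?_)
  refine (norm_sum_le _ _).trans (Finset.sum_le_sum fun σ _ => ?_)
  refine (norm_sum_le _ _).trans (Finset.sum_le_sum fun j _ => ?_)
  rw [norm_mul, Complex.norm_real, Real.norm_eq_abs, norm_mul, RCLike.norm_conj]
  gcongr
  · exact (PiLp.norm_apply_le _ i).trans (ha ρ)
  · exact (PiLp.norm_apply_le _ j).trans (hb σ)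

lemma exists_coord_bound : ∃ R : ℕ, ∀ (ρ : X.stencil) j, |X.coord ρ.1 j| ≤ R := by
  refine ⟨∑ ρ : X.stencil, ∑ j, (X.coord ρ.1 j).natAbs, fun ρ j => ?_⟩
  rw [Int.abs_eq_natAbs]
  exact_mod_cast (Finset.single_le_sum (f := fun j => (X.coord ρ.1 j).natAbs)
    (fun _ _ => Nat.zero_le _) (Finset.mem_univ j)).trans
    (Finset.single_le_sum (f := fun ρ : X.stencil => ∑ j, (X.coord ρ.1 j).natAbs)
      (fun _ _ => Nat.zero_le _) (Finset.mem_univ ρ))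

/-- Lattice stability implies a pointwise lower bound on the symbol. -/
theorem LatticeStable.exists_homForm_lower (hX : X.LatticeStable) :
    ∃ c₀ : ℝ, 0 < c₀ ∧ ∀ (x : Fin d → ℝ) (v : CDisp m),
      c₀ * ∑ ρ : X.stencil, ‖diffFactor (X.coord ρ.1) (ofReal x)‖ ^ 2 * ‖v‖ ^ 2 ≤
        (X.homForm (fun ρ => diffFactor (X.coord ρ.1) (ofReal x) • v)
          (fun ρ => diffFactor (X.coord ρ.1) (ofReal x) • v)).re := by
  classical
  obtain ⟨c₀, hc₀, h⟩ := hX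
  refine ⟨c₀, hc₀, fun x v => ?_⟩
  obtain ⟨R, hR⟩ := X.exists_coord_bound
  set e : X.stencil → ℂ := fun ρ => diffFactor (X.coord ρ.1) (ofReal x) with he
  -- τ is what one cell of a plane wave with amplitude v contributes to the form minus c₀ times the
  -- energy; K bounds the contribution of a cell in the boundary layer.
  set τ : ℝ := (X.homForm (fun ρ => e ρ • v) (fun ρ => e ρ • v)).re -
    c₀ * ∑ ρ, ‖e ρ • v‖ ^ 2 with hτ
  set K : ℝ := X.homBound * ((2 * ‖v‖) * (2 * ‖v‖)) with hK
  suffices hτ0 : 0 ≤ τ by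
    simp only [hτ, norm_smul, mul_pow] at hτ0
    linarith
  refine nonneg_of_box_estimate (d := d) (R := R) (K := K) fun n => ?_
  -- A plane wave cut off to a box. As R bounds the stencil, differences are those of the full wave
  -- on the box of size n and vanish off the box of size n + 2R, so that only the layer in between
  -- feels the cutoff.
  set w : (Fin d → ℤ) → CDisp m := fun z =>
    if z ∈ latticeBox d (n + R) then character z (ofReal x) • v else 0 with hw
  have hwfin : w.support.Finite := (latticeBox d (n + R)).finite_toSet.subset fun z hz => by
    by_contra h0
    have h0' : z ∉ latticeBox d (n + R) := h0
    exact hz (by simp [hw, h0'])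
  have hwnorm : ∀ z, ‖w z‖ ≤ ‖v‖ := by
    intro z
    simp only [hw]
    split_ifs
    · rw [norm_smul, norm_character_ofReal, one_mul]
    · simp
  have hsub : latticeBox d n ⊆ latticeBox d (n + 2 * R) := fun z hz =>
    mem_latticeBox.2 fun j => (mem_latticeBox.1 hz j).trans (by push_cast; linarith)
  have hout : ∀ z, z ∉ latticeBox d (n + 2 * R) → X.homD w z = 0 := by
    intro z hz
    funext ρ
    have h1 : z ∉ latticeBox d (n + R) := fun h1 => hz <| mem_latticeBox.2 fun j =>
      (mem_latticeBox.1 h1 j).trans (by push_cast; linarith)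
    have h2 : z + X.coord ρ.1 ∉ latticeBox d (n + R) := fun h2 => hz <| mem_latticeBox.2 fun j => by
      have h3 := mem_latticeBox.1 h2 j
      have h4 := hR ρ j
      rw [abs_le] at h3 h4 ⊢
      simp only [Pi.add_apply] at h3
      push_cast at h3 ⊢
      constructor <;> linarith [h3.1, h3.2, h4.1, h4.2]
    simp [homD, hw, h1, h2]
  have hin : ∀ z ∈ latticeBox d n, ∀ ρ, X.homD w z ρ = character z (ofReal x) • (e ρ • v) := by
    intro z hz ρ
    have h1 : z ∈ latticeBox d (n + R) := mem_latticeBox.2 fun j =>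
      (mem_latticeBox.1 hz j).trans (by push_cast; linarith)
    have h2 : z + X.coord ρ.1 ∈ latticeBox d (n + R) := mem_latticeBox.2 fun j => by
      refine (abs_add_le _ _).trans ?_
      have := mem_latticeBox.1 hz j
      have := hR ρ j
      push_cast; linarith
    simp only [homD, hw, h1, h2, if_true, character_add, he, diffFactor]
    rw [smul_smul, ← sub_smul]; congr 1; ring
  have hsum := X.lattice_stable_complex h hwfin hout
  rw [← Finset.sum_sdiff hsub] at hsum
  have hA : ∑ z ∈ latticeBox d n, ((X.homForm (X.homD w z) (X.homD w z)).re -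
      c₀ * ∑ ρ, ‖X.homD w z ρ‖ ^ 2) = τ * (2 * n + 1) ^ d := by
    have : ∀ z ∈ latticeBox d n, ((X.homForm (X.homD w z) (X.homD w z)).re -
        c₀ * ∑ ρ, ‖X.homD w z ρ‖ ^ 2) = τ := by
      intro z hz
      -- The phase at z is a common unimodular factor, to which the form is insensitive; hence every
      -- inner cell contributes the same τ.
      have h1 : X.homD w z = fun ρ => character z (ofReal x) • (e ρ • v) := funext (hin z hz)
      rw [h1, homForm_smul]
      simp only [norm_smul, norm_character_ofReal, hτ]
      simp
    rw [Finset.sum_congr rfl this, Finset.sum_const, card_latticeBox, nsmul_eq_mul]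
    push_cast; ring
  have hB : ∑ z ∈ latticeBox d (n + 2 * R) \ latticeBox d n,
      ((X.homForm (X.homD w z) (X.homD w z)).re - c₀ * ∑ ρ, ‖X.homD w z ρ‖ ^ 2) ≤
      K * ((2 * (n + 2 * R) + 1) ^ d - (2 * n + 1) ^ d) := by
    have : ∀ z ∈ latticeBox d (n + 2 * R) \ latticeBox d n,
        ((X.homForm (X.homD w z) (X.homD w z)).re - c₀ * ∑ ρ, ‖X.homD w z ρ‖ ^ 2) ≤ K := by
      intro z _
      have h1 : ∀ ρ, ‖X.homD w z ρ‖ ≤ 2 * ‖v‖ := fun ρ =>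
        (norm_sub_le _ _).trans (by linarith [hwnorm (z + X.coord ρ.1), hwnorm z])
      have h2 := X.norm_homForm_le (by positivity) h1 h1
      have h3 := (Complex.re_le_norm _).trans h2
      have h4 : 0 ≤ c₀ * ∑ ρ, ‖X.homD w z ρ‖ ^ 2 :=
        mul_nonneg hc₀.le (Finset.sum_nonneg fun _ _ => by positivity)
      linarith
    refine (Finset.sum_le_sum this).trans (le_of_eq ?_)
    rw [Finset.sum_const, Finset.card_sdiff_of_subset hsub, card_latticeBox, card_latticeBox,
      nsmul_eq_mul, Nat.cast_sub (by gcongr; omega)]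
    push_cast; ring
  linarith

/-! ### The symbol on the complexified torus -/

/-- The block `V_{,ρσ}(0)` as an operator. -/
def blockOp (ρ σ : X.stencil) : CDisp m →L[ℂ] CDisp m :=
  Matrix.toEuclideanCLM (𝕜 := ℂ) (Matrix.of fun i j => (partial₂ X.pot 0 ρ i σ j : ℂ))

/-- The symbol of `H^hom` in integer coordinates. -/
def torusOp (w : Fin d → ℂ) : CDisp m →L[ℂ] CDisp m :=
  ∑ ρ : X.stencil, ∑ σ : X.stencil,
    (diffFactor (-X.coord ρ.1) w * diffFactor (X.coord σ.1) w) • X.blockOp ρ σ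

lemma conj_diffFactor (r : Fin d → ℤ) (x : Fin d → ℝ) :
    starRingEnd ℂ (diffFactor r (ofReal x)) = diffFactor (-r) (ofReal x) := by
  rw [diffFactor, map_sub, conj_character_ofReal, map_one, diffFactor]

lemma inner_blockOp (ρ σ : X.stencil) (u v : CDisp m) :
    inner ℂ u (X.blockOp ρ σ v) =
      ∑ i, ∑ j, (partial₂ X.pot 0 ρ i σ j : ℂ) * (starRingEnd ℂ (u i) * v j) := by
  simp only [PiLp.inner_apply, blockOp]
  refine Finset.sum_congr rfl fun i _ => ?_
  simp only [Matrix.ofLp_toEuclideanCLM, Matrix.mulVec, dotProduct, Matrix.of_apply,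
    RCLike.inner_apply, Finset.sum_mul]
  exact Finset.sum_congr rfl fun j _ => by ring

/-- At real points the factor belonging to -ρ is the conjugate of the one belonging to ρ and moves
into the antilinear slot. -/
lemma inner_torusOp (x : Fin d → ℝ) (u v : CDisp m) :
    inner ℂ u (X.torusOp (ofReal x) v) =
      X.homForm (fun ρ => diffFactor (X.coord ρ.1) (ofReal x) • u)
        (fun ρ => diffFactor (X.coord ρ.1) (ofReal x) • v) := by
  simp only [torusOp, _root_.sum_apply, _root_.smul_apply, inner_sum, inner_smul_right,
    inner_blockOp, homForm]
  refine Finset.sum_congr rfl fun ρ _ => ?_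
  simp only [Finset.mul_sum]
  rw [Finset.sum_comm]
  refine Finset.sum_congr rfl fun i _ => Finset.sum_congr rfl fun σ _ =>
    Finset.sum_congr rfl fun j _ => ?_
  rw [← conj_diffFactor]
  simp only [PiLp.smul_apply, smul_eq_mul, map_mul]
  ring

lemma periodicEntire_diffFactor (r : Fin d → ℤ) : PeriodicEntire (diffFactor r) :=
  (periodicEntire_character r).sub (PeriodicEntire.const 1)

lemma periodicEntire_torusOp : PeriodicEntire X.torusOp := by
  refine PeriodicEntire.sum fun ρ _ => PeriodicEntire.sum fun σ _ => ?_
  exact ((periodicEntire_diffFactor _).mul (periodicEntire_diffFactor _)).comp_clm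
    ((ContinuousLinearMap.id ℂ ℂ).smulRight (X.blockOp ρ σ))

/-- Difference factors change by at most a multiple of `|η|` under imaginary shifts. -/
lemma exists_norm_diffFactor_imShift_sub_le (r : Fin d → ℤ) : ∃ C : ℝ, 0 ≤ C ∧
    ∀ (x : Fin d → ℝ) j η, |η| ≤ 1 →
      ‖diffFactor r (imShift x j η) - diffFactor r (ofReal x)‖ ≤ C * |η| := by
  set B : ℝ := 2 * Real.pi * ∑ j, |(r j : ℝ)| with hB
  have hB0 : 0 ≤ B := mul_nonneg (by positivity) (Finset.sum_nonneg fun _ _ => abs_nonneg _)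
  refine ⟨B * Real.exp B, by positivity, fun x j η hη => ?_⟩
  have h1 : diffFactor r (imShift x j η) - diffFactor r (ofReal x) =
      character r (ofReal x) * (Complex.exp ((-(2 * Real.pi * r j * η) : ℝ)) - 1) := by
    have : character r (imShift x j η) =
        character r (ofReal x) * Complex.exp ((-(2 * Real.pi * r j * η) : ℝ)) := by
      rw [character, character, ← Complex.exp_add]
      congr 1
      rw [← Finset.add_sum_erase _ _ (Finset.mem_univ j),
        ← Finset.add_sum_erase (a := j) (f := fun i => (r i : ℂ) * ofReal x i) _ (Finset.mem_univ j)]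
      have h2 : ∑ i ∈ Finset.univ.erase j, (r i : ℂ) * imShift x j η i =
          ∑ i ∈ Finset.univ.erase j, (r i : ℂ) * ofReal x i :=
        Finset.sum_congr rfl fun i hi => by
          rw [imShift, Function.update_of_ne (Finset.ne_of_mem_erase hi)]
      have hx : ofReal x j = (x j : ℂ) := rfl
      rw [h2, imShift, Function.update_self, hx]
      push_cast
      linear_combination (2 * Real.pi * r j * η : ℂ) * Complex.I_sq
    rw [diffFactor, diffFactor, this]; ring
  rw [h1, norm_mul, norm_character_ofReal, one_mul, ← Complex.ofReal_exp, ← Complex.ofReal_one,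
    ← Complex.ofReal_sub, Complex.norm_real, Real.norm_eq_abs]
  set y : ℝ := -(2 * Real.pi * r j * η) with hy
  have hyB : |y| ≤ B * |η| := by
    rw [hy, abs_neg, abs_mul, abs_mul, hB, abs_of_pos (by positivity : 0 < 2 * Real.pi)]
    gcongr
    exact Finset.single_le_sum (f := fun j => |(r j : ℝ)|) (fun _ _ => abs_nonneg _)
      (Finset.mem_univ j)
  have h2 : |Real.exp y - 1| ≤ |y| * Real.exp |y| := by
    have ha := Real.add_one_le_exp y
    have hb := Real.add_one_le_exp (-y)
    have hc : Real.exp y * Real.exp (-y) = 1 := by rw [← Real.exp_add]; simp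
    have hd := Real.exp_pos y
    rcases le_total 0 y with h0 | h0
    · rw [abs_of_nonneg h0, abs_of_nonneg (by linarith)]
      nlinarith [mul_le_mul_of_nonneg_left hb hd.le]
    · rw [abs_of_nonpos h0, abs_of_nonpos (by linarith [Real.exp_le_one_iff.2 h0])]
      have := Real.one_le_exp (neg_nonneg.2 h0)
      nlinarith
  have h3 : |y| ≤ B := hyB.trans (by nlinarith)
  calc _ ≤ |y| * Real.exp |y| := h2
    _ ≤ (B * |η|) * Real.exp B := by gcongr
    _ = _ := by ring

/-- Difference factors vanish linearly at the origin. -/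
lemma norm_diffFactor_ofReal_le (r : Fin d → ℤ) (x : Fin d → ℝ) :
    ‖diffFactor r (ofReal x)‖ ≤ (2 * Real.pi * ∑ j, |(r j : ℝ)|) * ‖x‖ := by
  rw [diffFactor, character_ofReal, mul_comm _ Complex.I]
  refine (Real.norm_exp_I_mul_ofReal_sub_one_le).trans ?_
  rw [Real.norm_eq_abs, abs_mul, abs_of_pos (by positivity : 0 < 2 * Real.pi),
    mul_assoc (2 * Real.pi) (∑ j, _), Finset.sum_mul]
  gcongr
  refine (Finset.abs_sum_le_sum_abs _ _).trans (Finset.sum_le_sum fun j _ => ?_)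
  rw [abs_mul]
  gcongr
  exact norm_le_pi_norm x j

lemma vanishingFactor_diffFactor (r : Fin d → ℤ) : VanishingFactor (diffFactor r) 1 := by
  obtain ⟨C, hC, h⟩ := exists_norm_diffFactor_imShift_sub_le r
  set B : ℝ := 2 * Real.pi * ∑ j, |(r j : ℝ)| with hB
  have hB0 : 0 ≤ B := mul_nonneg (by positivity) (Finset.sum_nonneg fun _ _ => abs_nonneg _)
  refine ⟨periodicEntire_diffFactor r, B + C, by positivity, fun x _ j η hη => ?_⟩
  have h1 := h x j η hη
  have h2 := norm_diffFactor_ofReal_le r x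
  have h3 := norm_add_le (diffFactor r (imShift x j η) - diffFactor r (ofReal x))
    (diffFactor r (ofReal x))
  rw [sub_add_cancel] at h3
  rw [pow_one]
  nlinarith [norm_nonneg x, abs_nonneg η, mul_nonneg hB0 (abs_nonneg η), mul_nonneg hC (norm_nonneg x)]

lemma _root_.SiteEntropy.VanishingFactor.mul {q q' : (Fin d → ℂ) → ℂ} {α α' : ℕ}
    (h : VanishingFactor q α) (h' : VanishingFactor q' α') :
    VanishingFactor (fun w => q w * q' w) (α + α') := by
  obtain ⟨C, hC, hb⟩ := h.bound
  obtain ⟨C', hC', hb'⟩ := h'.bound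
  refine ⟨h.entire.mul h'.entire, C * C', by positivity, fun x hx j η hη => ?_⟩
  rw [norm_mul, pow_add]
  calc _ ≤ (C * (‖x‖ + |η|) ^ α) * (C' * (‖x‖ + |η|) ^ α') :=
        mul_le_mul (hb x hx j η hη) (hb' x hx j η hη) (norm_nonneg _) (by positivity)
    _ = _ := by ring

/-- The squared size of all difference factors. -/
def diffEnergy (x : Fin d → ℝ) : ℝ :=
  ∑ ρ : X.stencil, ‖diffFactor (X.coord ρ.1) (ofReal x)‖ ^ 2

lemma diffEnergy_nonneg (x : Fin d → ℝ) : 0 ≤ X.diffEnergy x :=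
  Finset.sum_nonneg fun _ _ => by positivity

lemma norm_diffFactor_neg (r : Fin d → ℤ) (x : Fin d → ℝ) :
    ‖diffFactor (-r) (ofReal x)‖ = ‖diffFactor r (ofReal x)‖ := by
  rw [← conj_diffFactor, RCLike.norm_conj]

lemma norm_diffFactor_add_le (r r' : Fin d → ℤ) (x : Fin d → ℝ) :
    ‖diffFactor (r + r') (ofReal x)‖ ≤
      ‖diffFactor r (ofReal x)‖ + ‖diffFactor r' (ofReal x)‖ := by
  have : diffFactor (r + r') (ofReal x) =
      character r (ofReal x) * diffFactor r' (ofReal x) + diffFactor r (ofReal x) := by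
    simp only [diffFactor, character_add]; ring
  rw [this]
  refine (norm_add_le _ _).trans ?_
  rw [norm_mul, norm_character_ofReal, one_mul, add_comm]

lemma norm_diffFactor_sq_le_diffEnergy (ρ : X.stencil) (x : Fin d → ℝ) :
    ‖diffFactor (X.coord ρ.1) (ofReal x)‖ ^ 2 ≤ X.diffEnergy x := by
  have h := Finset.single_le_sum (N := ℝ) (s := (Finset.univ : Finset X.stencil))
    (f := fun ρ : X.stencil => ‖diffFactor (X.coord ρ.1) (ofReal x)‖ ^ 2)
    (fun i _ => by positivity) (Finset.mem_univ ρ)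
  exact h

/-- All difference factors are controlled by those of the stencil. -/
lemma exists_norm_diffFactor_le_sqrt (z : Fin d → ℤ) : ∃ C : ℝ, 0 ≤ C ∧ ∀ x : Fin d → ℝ,
    ‖diffFactor z (ofReal x)‖ ≤ C * √(X.diffEnergy x) := by
  have hz : X.lat z ∈ Submodule.span ℤ (X.stencil : Set (Space d)) := by
    have := X.lat_mem z
    rwa [← X.stencil_span] at this
  -- The stencil spans the lattice over ℤ, and the modulus of difference factors is even and
  -- subadditive in the shift, so the bound propagates through integer combinations.
  suffices H : ∀ y ∈ Submodule.span ℤ (X.stencil : Set (Space d)), y ∈ bravais X.A ∧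
      ∃ C : ℝ, 0 ≤ C ∧ ∀ x : Fin d → ℝ,
        ‖diffFactor (X.coord y) (ofReal x)‖ ≤ C * √(X.diffEnergy x) by
    simpa only [X.coord_lat] using (H _ hz).2
  intro y hy
  refine ⟨by rw [← X.stencil_span]; exact hy, ?_⟩
  induction hy using Submodule.span_induction with
  | mem y hy =>
    refine ⟨1, zero_le_one, fun x => ?_⟩
    rw [one_mul]
    exact Real.le_sqrt_of_sq_le (X.norm_diffFactor_sq_le_diffEnergy ⟨y, hy⟩ x)
  | zero =>
    refine ⟨0, le_rfl, fun x => ?_⟩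
    simp [X.coord_zero, diffFactor, character_zero]
  | add y y' hy hy' h h' =>
    have hb : y ∈ bravais X.A := by rw [← X.stencil_span]; exact hy
    have hb' : y' ∈ bravais X.A := by rw [← X.stencil_span]; exact hy'
    obtain ⟨C, hC, h⟩ := h
    obtain ⟨C', hC', h'⟩ := h'
    refine ⟨C + C', by positivity, fun x => ?_⟩
    rw [X.coord_add hb hb']
    refine (norm_diffFactor_add_le _ _ x).trans ?_
    linarith [h x, h' x]
  | smul n y hy h =>
    have hb : y ∈ bravais X.A := by rw [← X.stencil_span]; exact hy
    obtain ⟨C, hC, h⟩ := h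
    have hmem : ∀ k : ℕ, k • y ∈ bravais X.A := fun k => by
      rw [← X.stencil_span]; exact nsmul_mem hy k
    have hnat : ∀ k : ℕ, ∀ x : Fin d → ℝ,
        ‖diffFactor (X.coord (k • y)) (ofReal x)‖ ≤ k * C * √(X.diffEnergy x) := by
      intro k x
      induction k with
      | zero =>
        simp [X.coord_zero, diffFactor, character_zero]
      | succ k ih =>
        rw [succ_nsmul, X.coord_add (hmem k) hb]
        refine (norm_diffFactor_add_le _ _ x).trans ?_
        push_cast
        linarith [h x]
    refine ⟨n.natAbs * C, by positivity, fun x => ?_⟩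
    rcases Int.natAbs_eq n with hn | hn
    · have : n • y = n.natAbs • y := by conv_lhs => rw [hn, natCast_zsmul]
      rw [this]; exact hnat _ x
    · have : n • y = -(n.natAbs • y) := by conv_lhs => rw [hn, neg_smul, natCast_zsmul]
      rw [this, X.coord_neg (hmem _), norm_diffFactor_neg]; exact hnat _ x

/-- Jordan's inequality applied to |e^{iθ} - 1| = 2|sin(θ/2)|; the bound on x_j keeps θ/2 within
[-π/2, π/2]. -/
lemma abs_le_norm_diffFactor_single (x : Fin d → ℝ) (j : Fin d) (hx : |x j| ≤ 1 / 2) :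
    |x j| ≤ ‖diffFactor (Pi.single j 1) (ofReal x)‖ := by
  have h1 : ∑ i, ((Pi.single j (1 : ℤ) : Fin d → ℤ) i : ℝ) * x i = x j := by
    rw [Finset.sum_eq_single j (fun i _ hi => by simp [Pi.single_eq_of_ne hi]) (by simp)]
    simp
  rw [diffFactor, character_ofReal, h1, mul_comm _ Complex.I, Complex.norm_exp_I_mul_ofReal_sub_one,
    Real.norm_eq_abs, abs_mul, abs_of_pos (two_pos : (0 : ℝ) < 2)]
  have h2 : 2 * Real.pi * x j / 2 = Real.pi * x j := by ring
  rw [h2]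
  have h3 : Real.pi * |x j| ≤ Real.pi / 2 := by
    have := mul_le_mul_of_nonneg_left hx Real.pi_pos.le
    linarith
  have h4 := Real.mul_abs_le_abs_sin (x := Real.pi * x j)
    (by rw [abs_mul, abs_of_pos Real.pi_pos]; exact h3)
  rw [abs_mul, abs_of_pos Real.pi_pos, ← mul_assoc, div_mul_cancel₀ _ Real.pi_ne_zero] at h4
  linarith [abs_nonneg (x j)]

/-- The difference energy is coercive on the unit cube. -/
lemma exists_sum_sq_le_diffEnergy : ∃ c : ℝ, 0 < c ∧ ∀ x : Fin d → ℝ, (∀ j, |x j| ≤ 1 / 2) →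
    c * ∑ j, x j ^ 2 ≤ X.diffEnergy x := by
  -- The unit vectors of ℤ^d suffice: each coordinate of x is bounded by the difference factor in
  -- its own direction.
  choose C hC h using fun j : Fin d => X.exists_norm_diffFactor_le_sqrt (Pi.single j 1)
  have hS : 0 ≤ ∑ j, C j ^ 2 := Finset.sum_nonneg fun _ _ => by positivity
  refine ⟨(1 + ∑ j, C j ^ 2)⁻¹, by positivity, fun x hx => ?_⟩
  rw [inv_mul_le_iff₀ (by positivity)]
  have h1 : ∀ j, x j ^ 2 ≤ C j ^ 2 * X.diffEnergy x := by
    intro j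
    have := (abs_le_norm_diffFactor_single x j (hx j)).trans (h j x)
    calc x j ^ 2 = |x j| ^ 2 := (sq_abs _).symm
      _ ≤ (C j * √(X.diffEnergy x)) ^ 2 := by gcongr
      _ = _ := by rw [mul_pow, Real.sq_sqrt (X.diffEnergy_nonneg x)]
  refine (Finset.sum_le_sum fun j _ => h1 j).trans ?_
  rw [← Finset.sum_mul]
  nlinarith [X.diffEnergy_nonneg x]

end DefectCrystal

/-! ### Powers of Hermitian matrices as integrals of their semigroups -/

section Spectral
variable {m : ℕ}

/-- Multiplied by e^{sc}, the orbit has zero derivative and is therefore constant. -/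
lemma semigroup_apply_of_eigenvector {H : Type*} [NormedAddCommGroup H] [InnerProductSpace ℂ H]
    [CompleteSpace H] {B : H →L[ℂ] H} {v : H} {c : ℝ} (hv : B v = (c : ℂ) • v) (t : ℝ) :
    semigroup B t v = (Real.exp (-(t * c)) : ℂ) • v := by
  have h1 : ∀ s, HasDerivAt (fun s => semigroup B s v) (-((c : ℂ) • semigroup B s v)) s := by
    intro s
    have h := (hasDerivAt_exp_smul_const (𝕂 := ℂ) (-B) (s : ℂ)).scomp s
      Complex.ofRealCLM.hasDerivAt
    have h2 := ((ContinuousLinearMap.apply ℂ H v).restrictScalars ℝ).hasFDerivAt.comp_hasDerivAt s h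
    simpa [semigroup, Function.comp_def, hv] using h2
  have h2 : ∀ s : ℝ, HasDerivAt (fun s : ℝ => (Real.exp (s * c) : ℂ) • semigroup B s v) 0 s := by
    intro s
    have h3 : HasDerivAt (fun s : ℝ => (Real.exp (s * c) : ℂ))
        ((Real.exp (s * c) * c : ℝ) : ℂ) s := by
      have := ((hasDerivAt_id s).mul_const c).exp.ofReal_comp
      simpa using this
    refine (h3.smul (h1 s)).congr_deriv ?_
    rw [smul_neg, smul_smul]
    push_cast
    simp
  have h4 := is_const_of_deriv_eq_zero (fun s => (h2 s).differentiableAt)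
    (fun s => (h2 s).deriv) t 0
  have h0 : semigroup B 0 v = v := by simp [semigroup, NormedSpace.exp_zero]
  simp only [zero_mul, Real.exp_zero, Complex.ofReal_one, one_smul, h0] at h4
  have h5 : semigroup B t v =
      (Real.exp (-(t * c)) : ℂ) • ((Real.exp (t * c) : ℂ) • semigroup B t v) := by
    rw [smul_smul, ← Complex.ofReal_mul, ← Real.exp_add]
    simp
  exact h5.trans (by rw [h4])

/-- The entries of the functional calculus of a Hermitian matrix. -/
lemma cfc_apply_entry {M : Matrix (Fin m) (Fin m) ℂ} (hM : M.IsHermitian) (f : ℝ → ℝ)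
    (a b : Fin m) : (cfc f M) a b = ∑ l, (f (hM.eigenvalues l) : ℂ) *
      (hM.eigenvectorBasis l a * starRingEnd ℂ (hM.eigenvectorBasis l b)) := by
  rw [hM.cfc_eq, Matrix.IsHermitian.cfc, Unitary.conjStarAlgAut_apply, Matrix.mul_apply]
  refine Finset.sum_congr rfl fun l _ => ?_
  rw [Matrix.mul_diagonal, Matrix.star_apply]
  simp only [Matrix.IsHermitian.eigenvectorUnitary_apply, Function.comp_apply]
  simp only [RCLike.star_def]
  rw [mul_comm _ ((RCLike.ofReal (f (hM.eigenvalues l)) : ℂ)), mul_assoc]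
  rfl

/-- The entries of the semigroup of a Hermitian matrix. -/
lemma semigroup_apply_entry {M : Matrix (Fin m) (Fin m) ℂ} (hM : M.IsHermitian) (t : ℝ)
    (a b : Fin m) :
    semigroup (Matrix.toEuclideanCLM (𝕜 := ℂ) M) t (EuclideanSpace.single b 1) a =
      ∑ l, (Real.exp (-(t * hM.eigenvalues l)) : ℂ) *
        (hM.eigenvectorBasis l a * starRingEnd ℂ (hM.eigenvectorBasis l b)) := by
  have h1 : ∀ l, Matrix.toEuclideanCLM (𝕜 := ℂ) M (hM.eigenvectorBasis l) =
      (hM.eigenvalues l : ℂ) • hM.eigenvectorBasis l := by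
    intro l
    have := hM.mulVec_eigenvectorBasis l
    ext i
    simpa [Matrix.ofLp_toEuclideanCLM] using congrFun this i
  conv_lhs => rw [← hM.eigenvectorBasis.sum_repr' (EuclideanSpace.single b (1 : ℂ))]
  simp only [map_sum, map_smul, semigroup_apply_of_eigenvector (h1 _), WithLp.ofLp_sum,
    WithLp.ofLp_smul, Finset.sum_apply, Pi.smul_apply, smul_eq_mul]
  refine Finset.sum_congr rfl fun l _ => ?_
  rw [EuclideanSpace.inner_single_right]
  simp
  ring

lemma integral_rpow_mul_exp_eq {c a : ℝ} (hc : 0 < c) (ha : 0 < a) :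
    ∫ t in Ioi (0 : ℝ), t ^ (a - 1) * Real.exp (-(t * c)) = Real.Gamma a * c ^ (-a) := by
  have := Real.integral_rpow_mul_exp_neg_mul_Ioi ha hc
  simp only [mul_comm c] at this
  rw [this, Real.rpow_neg hc.le, one_div, Real.inv_rpow hc.le, mul_comm]

/-- Negative powers of a positive definite matrix as integrals of its semigroup. -/
lemma integral_semigroup_entry {M : Matrix (Fin m) (Fin m) ℂ} (hM : M.IsHermitian)
    (hpos : ∀ l, 0 < hM.eigenvalues l) {s : ℝ} (hs : 0 < s) (a b : Fin m) :
    ∫ t in Ioi (0 : ℝ), ((t ^ (s - 1) : ℝ) : ℂ) *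
      semigroup (Matrix.toEuclideanCLM (𝕜 := ℂ) M) t (EuclideanSpace.single b 1) a =
      (Real.Gamma s : ℂ) * (cfc (fun t : ℝ => t ^ (-s)) M) a b := by
  simp only [semigroup_apply_entry hM, cfc_apply_entry hM, Finset.mul_sum]
  rw [integral_finsetSum]
  · refine Finset.sum_congr rfl fun l _ => ?_
    simp only [← mul_assoc, ← Complex.ofReal_mul]
    rw [integral_mul_const, integral_mul_const, integral_complex_ofReal,
      integral_rpow_mul_exp_eq (hpos l) hs]
  · intro l _
    simp only [← mul_assoc, ← Complex.ofReal_mul]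
    refine (Integrable.mul_const (Integrable.mul_const ?_ _) _)
    have hI : Integrable (fun t : ℝ => t ^ (s - 1) * Real.exp (-(t * hM.eigenvalues l)))
        (volume.restrict (Ioi 0)) := by
      by_contra h
      have := integral_rpow_mul_exp_eq (hpos l) hs
      rw [integral_undef h] at this
      exact (mul_pos (Real.Gamma_pos_of_pos hs) (Real.rpow_pos_of_pos (hpos l) _)).ne this
    exact hI.ofReal

end Spectral

/-! ### Ellipticity of the symbol on shifted tori -/

namespace DefectCrystal
variable {d m : ℕ} (X : DefectCrystal d m)

/-- A small imaginary shift perturbs the symbol by cross terms of order |η| times the size s of the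
difference factors, plus terms of order η². Half of the stability bound c₀s² absorbs the cross
terms; the other half gives the quadratic growth. -/
lemma LatticeStable.exists_ellipticSymbol (hX : X.LatticeStable) :
    ∃ S : EllipticSymbol d m, S.toFun = X.torusOp := by
  obtain ⟨c₀, hc₀, hlow⟩ := hX.exists_homForm_lower
  obtain ⟨c, hc, hco⟩ := X.exists_sum_sq_le_diffEnergy
  choose C₁ hC₁ h₁ using fun ρ : X.stencil => exists_norm_diffFactor_imShift_sub_le (X.coord ρ.1)
  choose C₂ hC₂ h₂ using fun ρ : X.stencil => exists_norm_diffFactor_imShift_sub_le (-X.coord ρ.1)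
  set C : ℝ := ∑ ρ, C₁ ρ + ∑ ρ, C₂ ρ with hC
  have hle₁ : ∀ ρ, C₁ ρ ≤ C := fun ρ => by
    have := Finset.single_le_sum (N := ℝ) (s := Finset.univ) (f := C₁) (fun ρ _ => hC₁ ρ)
      (Finset.mem_univ ρ)
    have h0 : 0 ≤ ∑ ρ, C₂ ρ := Finset.sum_nonneg fun ρ _ => hC₂ ρ
    linarith
  have hle₂ : ∀ ρ, C₂ ρ ≤ C := fun ρ => by
    have := Finset.single_le_sum (N := ℝ) (s := Finset.univ) (f := C₂) (fun ρ _ => hC₂ ρ)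
      (Finset.mem_univ ρ)
    have h0 : 0 ≤ ∑ ρ, C₁ ρ := Finset.sum_nonneg fun ρ _ => hC₁ ρ
    linarith
  have hC0 : 0 ≤ C := add_nonneg (Finset.sum_nonneg fun ρ _ => hC₁ ρ)
    (Finset.sum_nonneg fun ρ _ => hC₂ ρ)
  set K : ℝ := ∑ ρ : X.stencil, ∑ σ : X.stencil, ‖X.blockOp ρ σ‖ with hK
  have hK0 : 0 ≤ K := Finset.sum_nonneg fun _ _ => Finset.sum_nonneg fun _ _ => norm_nonneg _
  -- The lower constant is half of c₀ times the coercivity constant of the difference energy. In the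
  -- upper one, 2K²C²/c₀ is the cost of completing the square and KC² comes from the term quadratic
  -- in η.
  refine ⟨⟨X.torusOp, X.periodicEntire_torusOp, c₀ / 2 * c, 2 * K ^ 2 * C ^ 2 / c₀ + K * C ^ 2,
    by positivity, by positivity, fun x hx j η hη v => ?_⟩, rfl⟩
  set s : ℝ := √(X.diffEnergy x) with hs
  have hs0 : 0 ≤ s := Real.sqrt_nonneg _
  have hs2 : s ^ 2 = X.diffEnergy x := Real.sq_sqrt (X.diffEnergy_nonneg x)
  have ha : ∀ ρ : X.stencil, ‖diffFactor (X.coord ρ.1) (ofReal x)‖ ≤ s := fun ρ =>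
    Real.le_sqrt_of_sq_le (X.norm_diffFactor_sq_le_diffEnergy ρ x)
  have hdiff : ‖X.torusOp (imShift x j η) - X.torusOp (ofReal x)‖ ≤
      K * (2 * s * (C * |η|) + (C * |η|) ^ 2) := by
    simp only [torusOp, ← Finset.sum_sub_distrib, hK, Finset.sum_mul]
    refine (norm_sum_le _ _).trans (Finset.sum_le_sum fun ρ _ => ?_)
    refine (norm_sum_le _ _).trans (Finset.sum_le_sum fun σ _ => ?_)
    refine (congrArg norm (sub_smul _ _ (X.blockOp ρ σ)).symm).trans_le ?_
    refine (norm_smul _ _).trans_le ?_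
    rw [mul_comm]
    refine mul_le_mul_of_nonneg_left ?_ (norm_nonneg _)
    set α := diffFactor (-X.coord ρ.1) (imShift x j η)
    set α' := diffFactor (X.coord σ.1) (imShift x j η)
    set b := diffFactor (-X.coord ρ.1) (ofReal x) with hb
    set b' := diffFactor (X.coord σ.1) (ofReal x)
    have e : α * α' - b * b' = b * (α' - b') + (α - b) * b' + (α - b) * (α' - b') := by ring
    have hη0 := abs_nonneg η
    have k1 : ‖α - b‖ ≤ C * |η| := (h₂ ρ x j η hη).trans (by gcongr; exact hle₂ ρ)
    have k2 : ‖α' - b'‖ ≤ C * |η| := (h₁ σ x j η hη).trans (by gcongr; exact hle₁ σ)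
    have k3 : ‖b‖ ≤ s := by rw [hb, norm_diffFactor_neg]; exact ha ρ
    have k4 : ‖b'‖ ≤ s := ha σ
    rw [e]
    calc _ ≤ ‖b‖ * ‖α' - b'‖ + ‖α - b‖ * ‖b'‖ + ‖α - b‖ * ‖α' - b'‖ := by
          refine (norm_add_le _ _).trans ?_
          rw [norm_mul (α - b) (α' - b')]
          gcongr
          refine (norm_add_le _ _).trans ?_
          rw [norm_mul, norm_mul]
      _ ≤ s * (C * |η|) + (C * |η|) * s + (C * |η|) * (C * |η|) := by gcongr
      _ = _ := by ring
  have h3 : (c₀ * s ^ 2) * ‖v‖ ^ 2 ≤ (inner ℂ v (X.torusOp (ofReal x) v)).re := by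
    rw [X.inner_torusOp, hs2]
    refine le_trans (le_of_eq ?_) (hlow x v)
    rw [diffEnergy, ← Finset.sum_mul]; ring
  have h4 : -(K * (2 * s * (C * |η|) + (C * |η|) ^ 2)) * ‖v‖ ^ 2 ≤
      (inner ℂ v ((X.torusOp (imShift x j η) - X.torusOp (ofReal x)) v)).re := by
    have k1 := (abs_le.1 ((Complex.abs_re_le_norm _).trans (norm_inner_le_norm (𝕜 := ℂ) v
      ((X.torusOp (imShift x j η) - X.torusOp (ofReal x)) v)))).1
    refine le_trans ?_ k1
    have k2 := (ContinuousLinearMap.le_opNorm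
      (X.torusOp (imShift x j η) - X.torusOp (ofReal x)) v).trans
      (mul_le_mul_of_nonneg_right hdiff (norm_nonneg v))
    have := mul_le_mul_of_nonneg_left k2 (norm_nonneg v)
    linarith
  have h5 : inner ℂ v (X.torusOp (imShift x j η) v) = inner ℂ v (X.torusOp (ofReal x) v) +
      inner ℂ v ((X.torusOp (imShift x j η) - X.torusOp (ofReal x)) v) := by
    rw [← inner_add_right]; simp
  have h6 : c₀ / 2 * c * ∑ i, x i ^ 2 - (2 * K ^ 2 * C ^ 2 / c₀ + K * C ^ 2) * η ^ 2 ≤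
      c₀ * s ^ 2 - K * (2 * s * (C * |η|) + (C * |η|) ^ 2) := by
    have k1 := hco x hx
    rw [← hs2] at k1
    have k2 : 0 ≤ (c₀ / 2) * (s - 2 * K * C * |η| / c₀) ^ 2 := by positivity
    have k3 : (c₀ / 2) * (s - 2 * K * C * |η| / c₀) ^ 2 =
        c₀ / 2 * s ^ 2 - 2 * K * C * |η| * s + 2 * K ^ 2 * C ^ 2 / c₀ * |η| ^ 2 := by
      field_simp
      ring
    rw [k3, sq_abs] at k2
    have k4 : (C * |η|) ^ 2 = C ^ 2 * η ^ 2 := by rw [mul_pow, sq_abs]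
    rw [k4]
    nlinarith [mul_le_mul_of_nonneg_left k1 (by positivity : 0 ≤ c₀ / 2)]
  rw [h5, Complex.add_re]
  nlinarith [mul_le_mul_of_nonneg_right h6 (sq_nonneg ‖v‖)]

end DefectCrystal

/-! ### Reciprocal space in the coordinates of the unit cube -/

/-- Averages are invariant under linear changes of variables. -/
lemma setAverage_linearEquiv {E F G : Type*} [NormedAddCommGroup E] [NormedSpace ℝ E]
    [FiniteDimensional ℝ E] [MeasurableSpace E] [BorelSpace E] [NormedAddCommGroup F]
    [NormedSpace ℝ F] [FiniteDimensional ℝ F] [MeasurableSpace F] [BorelSpace F]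
    [NormedAddCommGroup G] [NormedSpace ℝ G] (μ : Measure E) [μ.IsAddHaarMeasure] (ν : Measure F)
    [ν.IsAddHaarMeasure] (L : E ≃L[ℝ] F) (s : Set F) (f : F → G) :
    ⨍ k in s, f k ∂ν = ⨍ x in L ⁻¹' s, f (L x) ∂μ := by
  have hH : (Measure.map L μ).IsAddHaarMeasure := L.isAddHaarMeasure_map μ
  -- Haar measures agree up to a scalar, and a scalar cancels in an average, so no Jacobian has to
  -- be computed.
  have h := Measure.isAddLeftInvariant_eq_smul ν (Measure.map L μ)
  set c := Measure.addHaarScalarFactor ν (Measure.map L μ) with hc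
  have hc0 : (c : ℝ) ≠ 0 := by
    have := Measure.addHaarScalarFactor_pos_of_isAddHaarMeasure ν (Measure.map L μ)
    exact_mod_cast this.ne'
  have hm : MeasurableEmbedding L := L.toHomeomorph.measurableEmbedding
  rw [setAverage_eq, setAverage_eq, h]
  rw [Measure.restrict_smul, integral_smul_nnreal_measure, hm.setIntegral_map]
  have h2 : (c • Measure.map L μ).real s = c * μ.real (L ⁻¹' s) := by
    rw [measureReal_def, Measure.smul_apply, hm.map_apply, measureReal_def]
    simp [ENNReal.smul_def]
  rw [h2, NNReal.smul_def, smul_smul]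
  congr 1
  field_simp

namespace DefectCrystal
variable {d m : ℕ} (X : DefectCrystal d m)

/-- The reciprocal vector `2π A^{-T} x`, as a linear equivalence. -/
def kvec : (Fin d → ℝ) ≃L[ℝ] Space d :=
  ((LinearEquiv.smulOfNeZero ℝ (Fin d → ℝ) (2 * Real.pi) (by positivity)).trans
    ((Matrix.toLinearEquiv' (X.A⁻¹ᵀ) (Matrix.invertibleOfIsUnitDet _ (by
      rw [Matrix.det_transpose]
      exact (Matrix.isUnit_nonsing_inv_det_iff).2 (Ne.isUnit X.det_ne_zero)))).trans
    (WithLp.linearEquiv 2 ℝ (Fin d → ℝ)).symm)).toContinuousLinearEquiv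

lemma kvec_apply (x : Fin d → ℝ) :
    X.kvec x = WithLp.toLp 2 ((X.A⁻¹)ᵀ *ᵥ ((2 * Real.pi) • x)) := rfl

lemma transpose_mulVec_kvec (x : Fin d → ℝ) : X.Aᵀ *ᵥ (X.kvec x).ofLp = (2 * Real.pi) • x := by
  rw [kvec_apply, Matrix.mulVec_mulVec, ← Matrix.transpose_mul,
    Matrix.nonsing_inv_mul _ (Ne.isUnit X.det_ne_zero), Matrix.transpose_one, Matrix.one_mulVec]

lemma inner_kvec_lat (x : Fin d → ℝ) (z : Fin d → ℤ) :
    inner ℝ (X.kvec x) (X.lat z) = 2 * Real.pi * ∑ j, z j * x j := by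
  have h1 : inner ℝ (X.kvec x) (X.lat z) = (X.kvec x).ofLp ⬝ᵥ (X.A *ᵥ fun i => (z i : ℝ)) := by
    simp [PiLp.inner_apply, dotProduct, lat, mul_comm]
  rw [h1, Matrix.dotProduct_mulVec, ← Matrix.mulVec_transpose, transpose_mulVec_kvec]
  simp only [dotProduct, Pi.smul_apply, smul_eq_mul, Finset.mul_sum]
  exact Finset.sum_congr rfl fun j _ => by ring

lemma exp_inner_kvec (x : Fin d → ℝ) (z : Fin d → ℤ) :
    Complex.exp (Complex.I * (inner ℝ (X.kvec x) (X.lat z) : ℝ)) = character z (ofReal x) := by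
  rw [inner_kvec_lat, character_ofReal, mul_comm]

lemma exp_neg_inner_kvec (x : Fin d → ℝ) (z : Fin d → ℤ) :
    Complex.exp (-Complex.I * (inner ℝ (X.kvec x) (X.lat z) : ℝ)) =
      character (-z) (ofReal x) := by
  rw [← exp_inner_kvec, lat_neg, inner_neg_right]; congr 1; push_cast; ring

lemma symbol_kvec_apply (x : Fin d → ℝ) (i j : Fin m) :
    X.symbol (X.kvec x) i j = ∑ ρ : X.stencil, ∑ σ : X.stencil,
      (diffFactor (-X.coord ρ.1) (ofReal x) * diffFactor (X.coord σ.1) (ofReal x)) *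
        (partial₂ X.pot 0 ρ i σ j : ℂ) := by
  simp only [symbol, Matrix.of_apply, diffFactor]
  refine Finset.sum_congr rfl fun ρ _ => Finset.sum_congr rfl fun σ _ => ?_
  rw [← X.exp_neg_inner_kvec, ← X.exp_inner_kvec, lat_coord_stencil, lat_coord_stencil]

lemma toEuclideanCLM_symbol (x : Fin d → ℝ) :
    Matrix.toEuclideanCLM (𝕜 := ℂ) (X.symbol (X.kvec x)) = X.torusOp (ofReal x) := by
  simp only [torusOp, blockOp, ← map_smul, ← map_sum]
  congr 1
  ext i j
  simp only [symbol_kvec_apply, Matrix.sum_apply, Matrix.smul_apply, Matrix.of_apply, smul_eq_mul]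

lemma partial₂_symm (g : X.stencil → Disp m) (ρ : X.stencil) (i : Fin m) (σ : X.stencil)
    (j : Fin m) : partial₂ X.pot g ρ i σ j = partial₂ X.pot g σ j ρ i :=
  (X.pot_contDiff.contDiffAt.isSymmSndFDerivAt (by simp; norm_num)) _ _

/-- The reflection `g ↦ (-g_{-ρ})_ρ` of stencils. -/
def reflect : (X.stencil → Disp m) →L[ℝ] (X.stencil → Disp m) :=
  ContinuousLinearMap.pi fun ρ => -ContinuousLinearMap.proj (⟨-ρ.1, X.stencil_neg ρ.1 ρ.2⟩ : X.stencil)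

lemma reflect_single (ρ : X.stencil) (v : Disp m) :
    X.reflect (Pi.single ρ v) = -Pi.single (⟨-ρ.1, X.stencil_neg ρ.1 ρ.2⟩ : X.stencil) v := by
  funext σ
  simp only [reflect, ContinuousLinearMap.coe_pi', Pi.neg_apply]
  by_cases h : σ = ⟨-ρ.1, X.stencil_neg ρ.1 ρ.2⟩
  · subst h
    simp
  · have h2 : (⟨-σ.1, X.stencil_neg σ.1 σ.2⟩ : X.stencil) ≠ ρ := by
      intro h3
      apply h
      ext1
      simp [← h3]
    simp [h, h2]

/-- The invariance of V under reflection is differentiated twice at 0, a fixed point of the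
reflection; the two minus signs cancel. -/
lemma partial₂_reflect (ρ : X.stencil) (i : Fin m) (σ : X.stencil) (j : Fin m) :
    partial₂ X.pot 0 ⟨-ρ.1, X.stencil_neg ρ.1 ρ.2⟩ i ⟨-σ.1, X.stencil_neg σ.1 σ.2⟩ j =
      partial₂ X.pot 0 ρ i σ j := by
  have hpot : X.pot ∘ X.reflect = X.pot := funext fun g => X.pot_symm g
  have hd : Differentiable ℝ X.pot := X.pot_contDiff.differentiable (by norm_num)
  have hd2 : Differentiable ℝ (fderiv ℝ X.pot) :=
    (X.pot_contDiff.fderiv_right (m := 2) (by norm_num)).differentiable (by norm_num)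
  have h1 : ∀ g, fderiv ℝ X.pot g = (fderiv ℝ X.pot (X.reflect g)).comp X.reflect := by
    intro g
    conv_lhs => rw [← hpot]
    rw [fderiv_comp g (hd _) X.reflect.differentiableAt, X.reflect.fderiv]
  have h2 : ∀ a b, fderiv ℝ (fderiv ℝ X.pot) 0 a b =
      fderiv ℝ (fderiv ℝ X.pot) 0 (X.reflect a) (X.reflect b) := by
    intro a b
    have h3 : fderiv ℝ X.pot = fun g => (fderiv ℝ X.pot (X.reflect g)).comp X.reflect := funext h1
    have h4 : HasFDerivAt (fun g => (fderiv ℝ X.pot (X.reflect g)).comp X.reflect)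
        (((ContinuousLinearMap.compL ℝ _ _ ℝ).flip X.reflect).comp
          ((fderiv ℝ (fderiv ℝ X.pot) (X.reflect 0)).comp X.reflect)) 0 := by
      have h5 := ((hd2 (X.reflect 0)).hasFDerivAt.comp (0 : X.stencil → Disp m)
        X.reflect.hasFDerivAt)
      exact ((ContinuousLinearMap.compL ℝ _ _ ℝ).flip X.reflect).hasFDerivAt.comp _ h5
    conv_lhs => rw [h3]
    rw [h4.fderiv, map_zero]
    rfl
  unfold partial₂
  conv_rhs => rw [h2, reflect_single, reflect_single]
  simp

/-- The symbol is even. -/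
lemma symbol_kvec_apply' (x : Fin d → ℝ) (i j : Fin m) :
    X.symbol (X.kvec x) i j = ∑ ρ : X.stencil, ∑ σ : X.stencil,
      (diffFactor (X.coord ρ.1) (ofReal x) * diffFactor (-X.coord σ.1) (ofReal x)) *
        (partial₂ X.pot 0 ρ i σ j : ℂ) := by
  let e : X.stencil ≃ X.stencil :=
    { toFun := fun ρ => ⟨-ρ.1, X.stencil_neg ρ.1 ρ.2⟩
      invFun := fun ρ => ⟨-ρ.1, X.stencil_neg ρ.1 ρ.2⟩
      left_inv := fun ρ => by simp
      right_inv := fun ρ => by simp }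
  rw [symbol_kvec_apply, ← e.sum_comp]
  refine Finset.sum_congr rfl fun ρ _ => ?_
  rw [← e.sum_comp]
  refine Finset.sum_congr rfl fun σ _ => ?_
  simp only [e, Equiv.coe_fn_mk, X.coord_neg (X.stencil_subset ρ.2),
    X.coord_neg (X.stencil_subset σ.2), neg_neg, partial₂_reflect]

lemma isHermitian_symbol (x : Fin d → ℝ) : (X.symbol (X.kvec x)).IsHermitian := by
  ext i j
  rw [Matrix.conjTranspose_apply, symbol_kvec_apply, symbol_kvec_apply, star_sum, Finset.sum_comm]
  refine (Finset.sum_congr rfl fun ρ _ => star_sum _ _).trans ?_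
  rw [Finset.sum_comm]
  rw [Finset.sum_comm]
  refine Finset.sum_congr rfl fun ρ _ => Finset.sum_congr rfl fun σ _ => ?_
  simp only [star_mul', RCLike.star_def, Complex.conj_ofReal, conj_diffFactor, neg_neg]
  rw [X.partial₂_symm 0 σ i ρ j]
  ring

lemma eigenvalues_symbol_pos [NeZero d] (S : EllipticSymbol d m) (hS : S.toFun = X.torusOp)
    {x : Fin d → ℝ} (hx : ∀ j, |x j| ≤ 1 / 2) (hx0 : x ≠ 0) (l : Fin m) :
    0 < (X.isHermitian_symbol x).eigenvalues l := by
  set hM := X.isHermitian_symbol x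
  have h1 : X.torusOp (ofReal x) (hM.eigenvectorBasis l) =
      (hM.eigenvalues l : ℂ) • hM.eigenvectorBasis l := by
    rw [← toEuclideanCLM_symbol]
    have := hM.mulVec_eigenvectorBasis l
    ext i
    simpa [Matrix.ofLp_toEuclideanCLM] using congrFun this i
  have h2 := S.bound x hx 0 0 (by simp) (hM.eigenvectorBasis l)
  rw [hS, imShift_zero, h1, inner_smul_right, inner_self_eq_norm_sq_to_K,
    hM.eigenvectorBasis.norm_eq_one] at h2
  simp only [Complex.coe_algebraMap, Complex.ofReal_one, one_pow, mul_one, Complex.ofReal_re] at h2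
  refine lt_of_lt_of_le ?_ h2
  have h3 : 0 < ∑ i, x i ^ 2 := by
    obtain ⟨i, hi⟩ := Function.ne_iff.1 hx0
    exact Finset.sum_pos' (fun i _ => sq_nonneg _) ⟨i, Finset.mem_univ _, by
      have : x i ≠ 0 := hi
      positivity⟩
  have := mul_pos S.lower_pos h3
  simpa using this

/-- The inverse square root of the symbol. -/
def invSqrtSymbol (x : Fin d → ℝ) : Matrix (Fin m) (Fin m) ℂ :=
  cfc (fun t : ℝ => t ^ (-(1 / 2) : ℝ)) (X.symbol (X.kvec x))

lemma isHermitian_invSqrtSymbol (x : Fin d → ℝ) : (X.invSqrtSymbol x).IsHermitian :=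
  cfc_predicate (R := ℝ) (p := IsSelfAdjoint) _ _

/-- Functional calculus on a spectrum that is finite and, away from the origin, positive: every
function is continuous on it, and the laws of real powers apply. -/
lemma invSqrtSymbol_mul [NeZero d] (S : EllipticSymbol d m) (hS : S.toFun = X.torusOp)
    {x : Fin d → ℝ} (hx : ∀ j, |x j| ≤ 1 / 2) (hx0 : x ≠ 0) :
    X.invSqrtSymbol x * X.symbol (X.kvec x) * X.invSqrtSymbol x = 1 ∧
    X.invSqrtSymbol x * X.invSqrtSymbol x =
      cfc (fun t : ℝ => t ^ (-1 : ℝ)) (X.symbol (X.kvec x)) := by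
  have hM : IsSelfAdjoint (X.symbol (X.kvec x)) := X.isHermitian_symbol x
  have hfin : (spectrum ℝ (X.symbol (X.kvec x))).Finite := by
    rw [(X.isHermitian_symbol x).spectrum_real_eq_range_eigenvalues]
    exact Set.finite_range _
  have hc : ∀ f : ℝ → ℝ, ContinuousOn f (spectrum ℝ (X.symbol (X.kvec x))) := fun f =>
    hfin.continuousOn f
  have hpos : ∀ t ∈ spectrum ℝ (X.symbol (X.kvec x)), 0 < t := by
    rw [(X.isHermitian_symbol x).spectrum_real_eq_range_eigenvalues]
    rintro _ ⟨l, rfl⟩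
    exact X.eigenvalues_symbol_pos S hS hx hx0 l
  constructor
  · have hid : X.symbol (X.kvec x) = cfc (fun t : ℝ => t) (X.symbol (X.kvec x)) :=
      (cfc_id' ℝ _ hM).symm
    unfold invSqrtSymbol
    conv_lhs => enter [1, 2]; rw [hid]
    rw [← cfc_mul _ _ _ (hc _) (hc _), ← cfc_mul _ _ _ (hc _) (hc _), ← cfc_one ℝ _ hM]
    refine cfc_congr fun t ht => ?_
    have h0 := hpos t ht
    simp only [Pi.one_apply]
    rw [mul_right_comm, ← Real.rpow_add h0]
    norm_num
    rw [Real.rpow_neg h0.le, Real.rpow_one, inv_mul_cancel₀ h0.ne']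
  · unfold invSqrtSymbol
    rw [← cfc_mul _ _ _ (hc _) (hc _)]
    refine cfc_congr fun t ht => ?_
    rw [← Real.rpow_add (hpos t ht)]
    norm_num

/-- The kernel at lattice points as a Fourier coefficient over the unit cube. -/
theorem kernel_lat (z : Fin d → ℤ) (i j : Fin m) :
    X.kernel (X.lat z) i j = cubeCoeff (fun x => X.invSqrtSymbol x i j) z := by
  rw [kernel, Matrix.of_apply, setAverage_linearEquiv volume volume X.kvec]
  -- The map 2πA^{-T} carries the open unit cube onto 𝓑; open and half-open cubes differ by a null
  -- set.
  have hpre : X.kvec ⁻¹' X.brillouin = {x : Fin d → ℝ | ∀ j, x j ∈ Ioo (-1 / 2 : ℝ) (-1 / 2 + 1)} := by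
    ext x
    simp only [brillouin, mem_preimage, Set.mem_ofPred_eq]
    refine forall_congr' fun j => ?_
    have h1 := congrFun (X.transpose_mulVec_kvec x) j
    simp only [Matrix.mulVec, dotProduct, Matrix.transpose_apply, Pi.smul_apply, smul_eq_mul] at h1
    rw [h1, abs_lt, mem_Ioo]
    constructor <;> rintro ⟨h2, h3⟩ <;> constructor <;> nlinarith [Real.pi_pos]
  have hvol : (volume : Measure (Fin d → ℝ)).restrict (X.kvec ⁻¹' X.brillouin) = cube d := by
    rw [hpre, cube]
    have : {x : Fin d → ℝ | ∀ j, x j ∈ Ioo (-1 / 2 : ℝ) (-1 / 2 + 1)} =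
        Set.univ.pi fun _ => Ioo (-1 / 2 : ℝ) (-1 / 2 + 1) := by ext; simp
    rw [this, volume_pi, Measure.restrict_pi_pi]
    congr 1
    funext j
    exact Measure.restrict_congr_set Ioo_ae_eq_Ioc
  rw [hvol, average_eq]
  simp only [probReal_univ, inv_one, one_smul, cubeCoeff, exp_neg_inner_kvec, invSqrtSymbol]

end DefectCrystal

/-! ### Bessel families and the operators they define -/

section Bessel
variable {H ι : Type*} [NormedAddCommGroup H] [InnerProductSpace ℂ H]

/-- Bessel families with bound `C`. -/
def IsBessel (v : ι → H) (C : ℝ) : Prop :=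
  ∀ (f : H) (s : Finset ι), ∑ a ∈ s, ‖inner ℂ (v a) f‖ ^ 2 ≤ C * ‖f‖ ^ 2

/-- Both sides of each finite inequality are continuous in f, so a convergent approximation is
enough, for example by truncations. -/
lemma IsBessel.of_tendsto {v : ι → H} {C : ℝ} {κ : Type*} {l : Filter κ} [l.NeBot]
    {t : κ → H → H} (ht : ∀ f, Tendsto (fun k => t k f) l (𝓝 f))
    (h : ∀ k f (s : Finset ι), ∑ a ∈ s, ‖inner ℂ (v a) (t k f)‖ ^ 2 ≤ C * ‖t k f‖ ^ 2) :
    IsBessel v C := by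
  intro f s
  refine le_of_tendsto_of_tendsto' (tendsto_finsetSum s fun a _ => ?_)
    (((ht f).norm.pow 2).const_mul C) fun k => h k f s
  exact ((tendsto_const_nhds.inner (ht f)).norm).pow 2

lemma IsBessel.summable {v : ι → H} {C : ℝ} (h : IsBessel v C) (f : H) :
    Summable fun a => ‖inner ℂ (v a) f‖ ^ 2 :=
  summable_of_sum_le (fun _ => sq_nonneg _) (h f)

lemma IsBessel.tsum_le {v : ι → H} {C : ℝ} (h : IsBessel v C) (f : H) :
    ∑' a, ‖inner ℂ (v a) f‖ ^ 2 ≤ C * ‖f‖ ^ 2 :=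
  (h.summable f).tsum_le_of_sum_le (h f)

lemma IsBessel.smul {v : ι → H} {C B : ℝ} (h : IsBessel v C) {c : ι → ℂ}
    (hc : ∀ a, ‖c a‖ ≤ B) : IsBessel (fun a => c a • v a) (B ^ 2 * C) := by
  intro f s
  calc ∑ a ∈ s, ‖inner ℂ (c a • v a) f‖ ^ 2 ≤ ∑ a ∈ s, B ^ 2 * ‖inner ℂ (v a) f‖ ^ 2 := by
        refine Finset.sum_le_sum fun a _ => ?_
        rw [inner_smul_left, norm_mul, RCLike.norm_conj, mul_pow]
        gcongr
        exact hc a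
    _ = B ^ 2 * ∑ a ∈ s, ‖inner ℂ (v a) f‖ ^ 2 := by rw [Finset.mul_sum]
    _ ≤ B ^ 2 * (C * ‖f‖ ^ 2) := by gcongr; exact h f s
    _ = _ := by ring

/-- The analysis operator of a Bessel family. -/
lemma IsBessel.exists_analysis {v : ι → H} {C : ℝ} (h : IsBessel v C) :
    ∃ L : H →L[ℂ] lp (fun _ : ι => ℂ) 2, ∀ f a, L f a = inner ℂ (v a) f := by
  have hmem : ∀ f, Memℓp (fun a => inner ℂ (v a) f) 2 := fun f => by
    rw [memℓp_gen_iff (by norm_num)]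
    simpa using h.summable f
  let L₀ : H →ₗ[ℂ] lp (fun _ : ι => ℂ) 2 :=
    { toFun := fun f => ⟨fun a => inner ℂ (v a) f, hmem f⟩
      map_add' := fun f g => by ext a; exact inner_add_right _ _ _
      map_smul' := fun c f => by ext a; exact inner_smul_right _ _ _ }
  -- The sign of C is not part of the definition, hence the maximum with 0.
  refine ⟨L₀.mkContinuous (√(max C 0)) fun f => ?_, fun f a => rfl⟩
  refine abs_le_of_sq_le_sq' ?_ (by positivity) |>.2
  rw [mul_pow, Real.sq_sqrt (le_max_right _ _)]
  have h1 := lp.norm_rpow_eq_tsum (p := 2) (by norm_num) (L₀ f)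
  simp only [ENNReal.toReal_ofNat, Real.rpow_two] at h1
  rw [h1]
  refine (h.tsum_le f).trans ?_
  gcongr
  exact le_max_left _ _

/-- Bounded operators built from Bessel families. -/
theorem IsBessel.exists_operator [CompleteSpace H] {v w : ι → H} {C C' B : ℝ} (hv : IsBessel v C)
    (hw : IsBessel w C') {N : ι → ℂ} (hN : ∀ a, ‖N a‖ ≤ B) :
    ∃ T : H →L[ℂ] H, ∀ f g, HasSum
      (fun a => N a * (starRingEnd ℂ (inner ℂ (v a) g) * inner ℂ (w a) f)) (inner ℂ g (T f)) := by
  obtain ⟨L, hL⟩ := hv.exists_analysis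
  -- The multiplier is conjugated and absorbed into the second family, so that the operator is
  -- simply the product of one analysis operator with the adjoint of the other.
  obtain ⟨L', hL'⟩ := (hw.smul (c := fun a => starRingEnd ℂ (N a))
    (fun a => by rw [RCLike.norm_conj]; exact hN a)).exists_analysis
  refine ⟨(ContinuousLinearMap.adjoint L).comp L', fun f g => ?_⟩
  rw [ContinuousLinearMap.comp_apply, ContinuousLinearMap.adjoint_inner_right]
  refine (lp.hasSum_inner (L g) (L' f)).congr_fun fun a => ?_
  rw [hL, hL', inner_smul_left, RCLike.inner_apply, RCLike.conj_conj]
  ring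

end Bessel

/-! ### Truncation in ℓ² -/

section Truncation
variable {I : Type*} {E : Type*} [NormedAddCommGroup E]

open Classical in
/-- Truncation of a square-summable family to a finite set. -/
def truncate (s : Finset I) (f : lp (fun _ : I => E) 2) : lp (fun _ : I => E) 2 :=
  ∑ n ∈ s, lp.single 2 n (f n)

lemma tendsto_truncate (f : lp (fun _ : I => E) 2) :
    Tendsto (fun s => truncate s f) atTop (𝓝 f) := by
  classical
  have h := lp.hasSum_single (p := 2) (by norm_num) f
  rw [HasSum, SummationFilter.unconditional_filter] at h
  exact h

variable [InnerProductSpace ℂ E]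

open Classical in
lemma inner_truncate_right (s : Finset I) (g f : lp (fun _ : I => E) 2) :
    inner ℂ g (truncate s f) = ∑ n ∈ s, inner ℂ (g n) (f n) := by
  rw [truncate, inner_sum]
  refine Finset.sum_congr rfl fun n _ => ?_
  rw [lp.inner_single_right]

open Classical in
lemma inner_truncate_truncate (s : Finset I) (g f : lp (fun _ : I => E) 2) :
    inner ℂ (truncate s g) (truncate s f) = ∑ n ∈ s, inner ℂ (g n) (f n) := by
  rw [inner_truncate_right]
  refine Finset.sum_congr rfl fun n hn => ?_
  congr 1
  rw [truncate, lp.coeFn_sum, Finset.sum_apply]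
  rw [Finset.sum_eq_single n]
  · simp
  · intro k _ hk
    exact lp.single_apply_ne 2 k _ hk.symm
  · exact fun h => absurd hn h

lemma norm_sq_truncate (s : Finset I) (f : lp (fun _ : I => E) 2) :
    ‖truncate s f‖ ^ 2 = ∑ n ∈ s, ‖f n‖ ^ 2 := by
  have h := inner_truncate_truncate s f f
  rw [inner_self_eq_norm_sq_to_K] at h
  simp only [inner_self_eq_norm_sq_to_K] at h
  exact_mod_cast h

/-- Continuous sesquilinear identities may be checked on truncations. -/
lemma operator_eq_one_of_truncate {T : lp (fun _ : I => E) 2 →L[ℂ] lp (fun _ : I => E) 2}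
    (h : ∀ (s : Finset I) f g, inner ℂ (truncate s g) (T (truncate s f)) =
      inner ℂ (truncate s g) (truncate s f)) (f g : lp (fun _ : I => E) 2) :
    inner ℂ g (T f) = inner ℂ g f := by
  refine tendsto_nhds_unique_of_eventuallyEq
    ((tendsto_truncate g).inner (T.continuous.continuousAt.tendsto.comp (tendsto_truncate f)))
    ((tendsto_truncate g).inner (tendsto_truncate f)) (Eventually.of_forall fun s => h s f g)

end Truncation

/-! ### Trigonometric polynomials -/

section Trigonometric
variable {d m : ℕ}

/-- Orthogonality read off from Parseval for the constant function 1: its coefficient at 0 already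
exhausts the norm, so all the others vanish. -/
lemma integral_character (z : Fin d → ℤ) :
    ∫ x, character z (ofReal x) ∂cube d = if z = 0 then 1 else 0 := by
  have h1 : MemLp (fun _ : Fin d → ℝ => (1 : ℂ)) 2 (cube d) := memLp_const 1
  have h2 := hasSum_conj_cubeCoeff_mul h1 h1
  simp only [map_one, mul_one, integral_const, probReal_univ, one_smul] at h2
  have h3 : HasSum (fun z => ‖cubeCoeff (fun _ : Fin d → ℝ => (1 : ℂ)) z‖ ^ 2) 1 := by
    rw [← Complex.hasSum_ofReal]
    refine (h2.congr_fun fun z => ?_)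
    rw [← Complex.normSq_eq_norm_sq, Complex.normSq_eq_conj_mul_self]
  have h4 : cubeCoeff (fun _ : Fin d → ℝ => (1 : ℂ)) 0 = 1 := by
    simp [cubeCoeff, character_zero]
  split_ifs with hz
  · simp [hz, character_zero]
  · have h5 := sum_le_hasSum {0, -z} (fun _ _ => sq_nonneg _) h3
    rw [Finset.sum_pair (by simpa using hz), h4, norm_one] at h5
    have h6 : ‖cubeCoeff (fun _ : Fin d → ℝ => (1 : ℂ)) (-z)‖ ^ 2 = 0 :=
      le_antisymm (by linarith) (sq_nonneg _)
    simpa [cubeCoeff] using h6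

/-- The trigonometric polynomial with the coefficients `f n`, `n ∈ s`. -/
def trigPoly (s : Finset (Fin d → ℤ)) (f : (Fin d → ℤ) → CDisp m) (x : Fin d → ℝ) : CDisp m :=
  ∑ n ∈ s, character n (ofReal x) • f n

lemma continuous_trigPoly (s : Finset (Fin d → ℤ)) (f : (Fin d → ℤ) → CDisp m) :
    Continuous (trigPoly s f) :=
  continuous_finsetSum _ fun n _ =>
    (((continuous_character n).comp continuous_ofReal).smul continuous_const)

lemma integrable_character (z : Fin d → ℤ) :
    Integrable (fun x => character z (ofReal x)) (cube d) :=
  integrable_cube_of_continuous ((continuous_character z).comp continuous_ofReal)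

/-- Plancherel's identity for trigonometric polynomials. -/
lemma integral_inner_trigPoly (s : Finset (Fin d → ℤ)) (f g : (Fin d → ℤ) → CDisp m) :
    ∫ x, inner ℂ (trigPoly s g x) (trigPoly s f x) ∂cube d = ∑ n ∈ s, inner ℂ (g n) (f n) := by
  have h1 : ∀ x, inner ℂ (trigPoly s g x) (trigPoly s f x) =
      ∑ n ∈ s, ∑ k ∈ s, character (k - n) (ofReal x) * inner ℂ (g n) (f k) := by
    intro x
    simp only [trigPoly, sum_inner, inner_sum, inner_smul_left, inner_smul_right,
      conj_character_ofReal, sub_eq_neg_add, character_add, mul_assoc, Finset.mul_sum]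
    rw [Finset.sum_comm]
    exact Finset.sum_congr rfl fun _ _ => Finset.sum_congr rfl fun _ _ => mul_left_comm _ _ _
  simp only [h1]
  rw [integral_finsetSum _ fun n _ => integrable_finsetSum _ fun k _ =>
    (integrable_character _).mul_const _]
  refine Finset.sum_congr rfl fun n hn => ?_
  rw [integral_finsetSum _ fun k _ => (integrable_character _).mul_const _]
  simp only [integral_mul_const, integral_character, sub_eq_zero]
  simp [hn]

lemma cubeCoeff_shift (f : (Fin d → ℝ) → ℂ) (z n : Fin d → ℤ) :
    cubeCoeff f (z - n) = cubeCoeff (fun x => character n (ofReal x) * f x) z := by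
  unfold cubeCoeff
  refine integral_congr_ae (Eventually.of_forall fun x => ?_)
  simp only [neg_sub, sub_eq_neg_add n z, character_add]
  ring

end Trigonometric

/-! ### Difference symbols and differences of the kernel -/

namespace DefectCrystal
variable {d m : ℕ} (X : DefectCrystal d m)

/-- The operator with the matrix `ĥ^{-1/2}`. -/
def invSqrtOp (x : Fin d → ℝ) : CDisp m →L[ℂ] CDisp m :=
  Matrix.toEuclideanCLM (𝕜 := ℂ) (X.invSqrtSymbol x)

lemma invSqrtOp_apply (x : Fin d → ℝ) (v : CDisp m) (i : Fin m) :
    X.invSqrtOp x v i = ∑ j, X.invSqrtSymbol x i j * v j := by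
  simp [invSqrtOp, Matrix.ofLp_toEuclideanCLM, Matrix.mulVec, dotProduct]

lemma inner_invSqrtOp_left (x : Fin d → ℝ) (u v : CDisp m) :
    inner ℂ (X.invSqrtOp x u) v = inner ℂ u (X.invSqrtOp x v) := by
  have h : IsSelfAdjoint (X.invSqrtOp x) := by
    have := X.isHermitian_invSqrtSymbol x
    exact (show IsSelfAdjoint (X.invSqrtSymbol x) from this).map
      (Matrix.toEuclideanCLM (𝕜 := ℂ) (n := Fin m))
  rw [← ContinuousLinearMap.adjoint_inner_left, h.adjoint_eq]

variable {X}

lemma inner_invSqrtOp_torusOp [NeZero d] (hX : X.LatticeStable) {x : Fin d → ℝ}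
    (hx : ∀ j, |x j| ≤ 1 / 2) (hx0 : x ≠ 0) (u v : CDisp m) :
    inner ℂ (X.invSqrtOp x u) (X.torusOp (ofReal x) (X.invSqrtOp x v)) = inner ℂ u v := by
  obtain ⟨S, hS⟩ := hX.exists_ellipticSymbol
  rw [inner_invSqrtOp_left]
  congr 1
  have h := congrArg (Matrix.toEuclideanCLM (𝕜 := ℂ) (n := Fin m))
    (X.invSqrtSymbol_mul S hS hx hx0).1
  rw [map_mul, map_mul, map_one, toEuclideanCLM_symbol] at h
  exact congrArg (fun L : CDisp m →L[ℂ] CDisp m => L v) h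

/-- Stability evaluated at ĥ^{-1/2}v: the form becomes ‖v‖², so the difference energy times
‖ĥ^{-1/2}v‖² is at most ‖v‖²/c₀. The singularity of ĥ^{-1/2} is thus cancelled by one difference
factor. -/
lemma exists_norm_diffFactor_mul_le [NeZero d] (hX : X.LatticeStable) (r : Fin d → ℤ) :
    ∃ C : ℝ, 0 ≤ C ∧ ∀ x : Fin d → ℝ, (∀ j, |x j| ≤ 1 / 2) → x ≠ 0 → ∀ v,
      ‖diffFactor r (ofReal x)‖ * ‖X.invSqrtOp x v‖ ≤ C * ‖v‖ := by
  obtain ⟨c₀, hc₀, h⟩ := hX.exists_homForm_lower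
  obtain ⟨C, hC, hb⟩ := X.exists_norm_diffFactor_le_sqrt r
  refine ⟨C * (√c₀)⁻¹, by positivity, fun x hx hx0 v => ?_⟩
  have h1 := h x (X.invSqrtOp x v)
  rw [← inner_torusOp, inner_invSqrtOp_torusOp hX hx hx0, inner_self_eq_norm_sq_to_K,
    ← Finset.sum_mul] at h1
  have h2 : c₀ * (X.diffEnergy x * ‖X.invSqrtOp x v‖ ^ 2) ≤ ‖v‖ ^ 2 := by
    refine h1.trans_eq ?_
    norm_cast
  have h3 : √(X.diffEnergy x) * ‖X.invSqrtOp x v‖ ≤ (√c₀)⁻¹ * ‖v‖ := by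
    refine abs_le_of_sq_le_sq' ?_ (by positivity) |>.2
    rw [mul_pow, mul_pow, inv_pow, Real.sq_sqrt (X.diffEnergy_nonneg x), Real.sq_sqrt hc₀.le,
      inv_mul_eq_div, le_div_iff₀ hc₀]
    linarith
  calc _ ≤ C * √(X.diffEnergy x) * ‖X.invSqrtOp x v‖ := by gcongr; exact hb x
    _ = C * (√(X.diffEnergy x) * ‖X.invSqrtOp x v‖) := by ring
    _ ≤ C * ((√c₀)⁻¹ * ‖v‖) := by gcongr
    _ = _ := by ring

/-- The origin, where the inverse square root degenerates, is a null set in positive dimension. -/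
lemma ae_cube_regular [NeZero d] :
    ∀ᵐ x : Fin d → ℝ ∂cube d, (∀ j, |x j| ≤ 1 / 2) ∧ x ≠ 0 := by
  have h : ∀ᵐ x : Fin d → ℝ ∂cube d, x ≠ 0 := by
    rw [cube_eq]
    have : Nonempty (Fin d) := ⟨0⟩
    exact ae_restrict_of_ae (Measure.ae_ne volume 0)
  filter_upwards [ae_cube_abs_le, h] with x h1 h2 using ⟨h1, h2⟩

/-- Subordination with exponent 1/2 identifies the abstract time integral with the functional
calculus; its companion with exponent 1 gives the inverse of the symbol. -/
lemma powerEntry_one_eq [NeZero d] (S : EllipticSymbol d m) (hS : S.toFun = X.torusOp)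
    {x : Fin d → ℝ} (hx : ∀ j, |x j| ≤ 1 / 2) (hx0 : x ≠ 0) (i j : Fin m) :
    X.invSqrtSymbol x i j = (Real.Gamma (1 / 2) : ℂ)⁻¹ * powerEntry S 1 i j x := by
  have h := integral_semigroup_entry (X.isHermitian_symbol x)
    (X.eigenvalues_symbol_pos S hS hx hx0) (s := 1 / 2) (by norm_num) i j
  have hG : (Real.Gamma (1 / 2) : ℂ) ≠ 0 := by
    exact_mod_cast (Real.Gamma_pos_of_pos (by norm_num : (0 : ℝ) < 1 / 2)).ne'
  rw [toEuclideanCLM_symbol] at h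
  rw [powerEntry, Nat.cast_one]
  simp only [heatEntry, hS]
  rw [h, invSqrtSymbol, ← mul_assoc, inv_mul_cancel₀ hG, one_mul]

lemma powerEntry_two_eq [NeZero d] (S : EllipticSymbol d m) (hS : S.toFun = X.torusOp)
    {x : Fin d → ℝ} (hx : ∀ j, |x j| ≤ 1 / 2) (hx0 : x ≠ 0) (i j : Fin m) :
    ∑ k, X.invSqrtSymbol x i k * X.invSqrtSymbol x k j = powerEntry S 2 i j x := by
  have h := integral_semigroup_entry (X.isHermitian_symbol x)
    (X.eigenvalues_symbol_pos S hS hx hx0) (s := 1) (by norm_num) i j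
  rw [toEuclideanCLM_symbol] at h
  have h2 := congrFun (congrFun (X.invSqrtSymbol_mul S hS hx hx0).2 i) j
  rw [Matrix.mul_apply] at h2
  rw [powerEntry, Nat.cast_ofNat, div_self two_ne_zero]
  simp only [heatEntry, hS]
  rw [h, h2, Real.Gamma_one, Complex.ofReal_one, one_mul]

/-- The entries may blow up like |x|^{-1} at the origin, which is integrable as d ≥ 2. This makes
single kernel values meaningful, not only their differences. -/
lemma integrable_invSqrtSymbol (hd : 2 ≤ d) (hX : X.LatticeStable) (i j : Fin m) :
    Integrable (fun x => X.invSqrtSymbol x i j) (cube d) := by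
  have : NeZero d := ⟨by omega⟩
  obtain ⟨S, hS⟩ := hX.exists_ellipticSymbol
  refine ((integrable_powerEntry_one hd S i j).const_mul
    (Real.Gamma (1 / 2) : ℂ)⁻¹).congr ?_
  filter_upwards [ae_cube_regular] with x hx
  exact (powerEntry_one_eq S hS hx.1 hx.2 i j).symm

variable (X) in
/-- The symbol of a difference of `(H^hom)^{-1/2}`. -/
def diffSymbol (r : Fin d → ℤ) (i j : Fin m) (x : Fin d → ℝ) : ℂ :=
  diffFactor (-r) (ofReal x) * X.invSqrtSymbol x i j

lemma aestronglyMeasurable_diffSymbol (hd : 2 ≤ d) (hX : X.LatticeStable) (r : Fin d → ℤ)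
    (i j : Fin m) : AEStronglyMeasurable (X.diffSymbol r i j) (cube d) :=
  ((periodicEntire_diffFactor (-r)).continuous.comp continuous_ofReal).aestronglyMeasurable.mul
    (integrable_invSqrtSymbol hd hX i j).aestronglyMeasurable

lemma exists_ae_norm_diffSymbol_le [NeZero d] (hX : X.LatticeStable) (r : Fin d → ℤ) :
    ∃ C : ℝ, 0 ≤ C ∧ ∀ i j, ∀ᵐ x ∂cube d, ‖X.diffSymbol r i j x‖ ≤ C := by
  obtain ⟨C, hC, h⟩ := exists_norm_diffFactor_mul_le hX (-r)
  refine ⟨C, hC, fun i j => ?_⟩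
  filter_upwards [ae_cube_regular] with x hx
  have h1 := h x hx.1 hx.2 (EuclideanSpace.single j 1)
  rw [PiLp.norm_single, norm_one, mul_one] at h1
  refine le_trans ?_ h1
  rw [diffSymbol, norm_mul]
  gcongr
  refine le_trans (le_of_eq ?_) (PiLp.norm_apply_le _ i)
  rw [invSqrtOp_apply]
  simp

lemma memLp_diffSymbol (hd : 2 ≤ d) (hX : X.LatticeStable) (r : Fin d → ℤ) (i j : Fin m) :
    MemLp (X.diffSymbol r i j) 2 (cube d) := by
  have : NeZero d := ⟨by omega⟩
  obtain ⟨C, hC, h⟩ := exists_ae_norm_diffSymbol_le hX r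
  exact MemLp.of_bound (aestronglyMeasurable_diffSymbol hd hX r i j) C (h i j)

variable (X) in
/-- Differences of the kernel. -/
def kernelDiff (r z : Fin d → ℤ) (i j : Fin m) : ℂ :=
  X.kernel (X.lat (z + r)) i j - X.kernel (X.lat z) i j

lemma kernelDiff_eq (hd : 2 ≤ d) (hX : X.LatticeStable) (r z : Fin d → ℤ) (i j : Fin m) :
    X.kernelDiff r z i j = cubeCoeff (X.diffSymbol r i j) z := by
  have hi : ∀ z, Integrable (fun x => character (-z) (ofReal x) * X.invSqrtSymbol x i j)
      (cube d) := fun z => (integrable_invSqrtSymbol hd hX i j).bdd_mul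
    (((continuous_character _).comp continuous_ofReal).aestronglyMeasurable) (c := 1)
    (Eventually.of_forall fun x => (norm_character_ofReal _ x).le)
  rw [kernelDiff, kernel_lat, kernel_lat, cubeCoeff, cubeCoeff, cubeCoeff,
    ← integral_sub (hi _) (hi _)]
  refine integral_congr_ae (Eventually.of_forall fun x => ?_)
  simp only [diffSymbol, diffFactor, neg_add, character_add]
  ring

/-- One difference factor against the power -1/2 is the case α = 1 of the critical decay estimate.
-/
lemma exists_norm_kernelDiff_le (hd : 2 ≤ d) (hX : X.LatticeStable) (r : Fin d → ℤ) :
    ∃ C : ℝ, 0 ≤ C ∧ ∀ z i j, ‖X.kernelDiff r z i j‖ ≤ C * ((1 + ‖z‖) ^ d)⁻¹ := by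
  have : NeZero d := ⟨by omega⟩
  obtain ⟨S, hS⟩ := hX.exists_ellipticSymbol
  obtain ⟨C, hC, h⟩ := (vanishingFactor_diffFactor (-r)).exists_norm_power_coeff_le
    (Or.inl rfl) S
  refine ⟨‖(Real.Gamma (1 / 2) : ℂ)⁻¹‖ * C, by positivity, fun z i j => ?_⟩
  have h1 := h i j (-z)
  rw [norm_neg] at h1
  have h2 : X.kernelDiff r z i j = (Real.Gamma (1 / 2) : ℂ)⁻¹ *
      ∫ x, character (-z) (ofReal x) *
        (diffFactor (-r) (ofReal x) * powerEntry S 1 i j x) ∂cube d := by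
    rw [kernelDiff_eq hd hX, cubeCoeff, ← integral_const_mul]
    refine integral_congr_ae ?_
    filter_upwards [ae_cube_regular] with x hx
    rw [diffSymbol, powerEntry_one_eq S hS hx.1 hx.2]
    ring
  rw [h2, norm_mul, mul_assoc]
  gcongr

end DefectCrystal

/-! ### The difference functionals on the homogeneous lattice -/

/-- The Hilbert space `ℓ²(ℤ^d; ℂ^m)`. -/
abbrev LatL2 (d m : ℕ) : Type := lp (fun _ : Fin d → ℤ => CDisp m) 2

namespace DefectCrystal
variable {d m : ℕ} {X : DefectCrystal d m}

lemma summable_norm_sq_kernelDiff (hd : 2 ≤ d) (hX : X.LatticeStable) (r : Fin d → ℤ)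
    (i j : Fin m) : Summable fun z => ‖X.kernelDiff r z i j‖ ^ 2 := by
  have h := (hasSum_conj_cubeCoeff_mul (memLp_diffSymbol hd hX r i j)
    (memLp_diffSymbol hd hX r i j)).summable.norm
  refine h.congr fun z => ?_
  rw [norm_mul, RCLike.norm_conj, ← sq, kernelDiff_eq hd hX]

variable (X) in
/-- The coefficients of the vector representing `f ↦ (𝐅f(ξ + r) - 𝐅f(ξ))_i`. -/
def diffKernelFun (ξ r : Fin d → ℤ) (i : Fin m) (n : Fin d → ℤ) : CDisp m :=
  WithLp.toLp 2 fun j => starRingEnd ℂ (X.kernelDiff r (ξ - n) i j)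

lemma memℓp_diffKernelFun (hd : 2 ≤ d) (hX : X.LatticeStable) (ξ r : Fin d → ℤ) (i : Fin m) :
    Memℓp (X.diffKernelFun ξ r i) 2 := by
  rw [memℓp_gen_iff (by norm_num)]
  simp only [ENNReal.toReal_ofNat, Real.rpow_two, EuclideanSpace.norm_sq_eq, diffKernelFun,
    RCLike.norm_conj]
  exact summable_sum fun j _ =>
    (Equiv.subLeft ξ).summable_iff.2 (summable_norm_sq_kernelDiff hd hX r i j)

open Classical in
variable (X) in
/-- The vector representing `f ↦ (𝐅f(ξ + r) - 𝐅f(ξ))_i` on the homogeneous lattice. -/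
def diffKernel (ξ r : Fin d → ℤ) (i : Fin m) : LatL2 d m :=
  if h : Memℓp (X.diffKernelFun ξ r i) 2 then ⟨_, h⟩ else 0

lemma diffKernel_apply (hd : 2 ≤ d) (hX : X.LatticeStable) (ξ r : Fin d → ℤ) (i : Fin m)
    (n : Fin d → ℤ) : X.diffKernel ξ r i n = X.diffKernelFun ξ r i n := by
  rw [diffKernel, dif_pos (memℓp_diffKernelFun hd hX ξ r i)]

variable (X) in
/-- The Fourier transform of differences of `𝐅f`. -/
def diffTransform (s : Finset (Fin d → ℤ)) (f : (Fin d → ℤ) → CDisp m) (r : Fin d → ℤ)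
    (i : Fin m) (x : Fin d → ℝ) : ℂ :=
  diffFactor (-r) (ofReal x) * X.invSqrtOp x (trigPoly s f x) i

lemma diffTransform_eq (s : Finset (Fin d → ℤ)) (f : (Fin d → ℤ) → CDisp m) (r : Fin d → ℤ)
    (i : Fin m) (x : Fin d → ℝ) :
    X.diffTransform s f r i x = ∑ j, X.diffSymbol r i j x * trigPoly s f x j := by
  simp only [diffTransform, invSqrtOp_apply, diffSymbol, Finset.mul_sum, mul_assoc]

lemma exists_norm_diffTransform_le [NeZero d] (hX : X.LatticeStable) (r : Fin d → ℤ) :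
    ∃ C : ℝ, 0 ≤ C ∧ ∀ s f i, ∀ᵐ x ∂cube d, ‖X.diffTransform s f r i x‖ ≤ C * ‖trigPoly s f x‖ := by
  obtain ⟨C, hC, h⟩ := exists_norm_diffFactor_mul_le hX (-r)
  refine ⟨C, hC, fun s f i => ?_⟩
  filter_upwards [ae_cube_regular] with x hx
  refine le_trans ?_ (h x hx.1 hx.2 (trigPoly s f x))
  rw [diffTransform, norm_mul]
  gcongr
  exact PiLp.norm_apply_le _ i

lemma aestronglyMeasurable_diffTransform (hd : 2 ≤ d) (hX : X.LatticeStable)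
    (s : Finset (Fin d → ℤ)) (f : (Fin d → ℤ) → CDisp m) (r : Fin d → ℤ) (i : Fin m) :
    AEStronglyMeasurable (X.diffTransform s f r i) (cube d) := by
  have : X.diffTransform s f r i = fun x => ∑ j, X.diffSymbol r i j x * trigPoly s f x j :=
    funext fun x => diffTransform_eq s f r i x
  rw [this]
  refine Finset.aestronglyMeasurable_fun_sum _ fun j _ => ?_
  refine (aestronglyMeasurable_diffSymbol hd hX r i j).mul ?_
  have := continuous_trigPoly s f
  exact (by fun_prop : Continuous fun x => trigPoly s f x j).aestronglyMeasurable

lemma norm_trigPoly_le (s : Finset (Fin d → ℤ)) (f : (Fin d → ℤ) → CDisp m) (x : Fin d → ℝ) :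
    ‖trigPoly s f x‖ ≤ ∑ n ∈ s, ‖f n‖ := by
  refine (norm_sum_le _ _).trans (Finset.sum_le_sum fun n _ => ?_)
  rw [norm_smul, norm_character_ofReal, one_mul]

lemma memLp_diffTransform (hd : 2 ≤ d) (hX : X.LatticeStable)
    (s : Finset (Fin d → ℤ)) (f : (Fin d → ℤ) → CDisp m) (r : Fin d → ℤ) (i : Fin m) :
    MemLp (X.diffTransform s f r i) 2 (cube d) := by
  have : NeZero d := ⟨by omega⟩
  obtain ⟨C, hC, h⟩ := exists_norm_diffTransform_le hX r
  refine MemLp.of_bound (aestronglyMeasurable_diffTransform hd hX s f r i)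
    (C * ∑ n ∈ s, ‖f n‖) ?_
  filter_upwards [h s f i] with x hx
  exact hx.trans (by gcongr; exact norm_trigPoly_le s f x)

/-- A finitely supported f has a trigonometric polynomial as its transform, on which the convolution
with the kernel acts as multiplication by ĥ^{-1/2}. -/
lemma inner_diffKernel_truncate (hd : 2 ≤ d) (hX : X.LatticeStable) (ξ r : Fin d → ℤ)
    (i : Fin m) (s : Finset (Fin d → ℤ)) (f : LatL2 d m) :
    inner ℂ (X.diffKernel ξ r i) (truncate s f) = cubeCoeff (X.diffTransform s f r i) ξ := by
  have hi : ∀ n j, Integrable (fun x => character (-ξ) (ofReal x) *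
      (character n (ofReal x) * X.diffSymbol r i j x) * f n j) (cube d) := fun n j => by
    refine Integrable.mul_const ?_ _
    have h1 : Integrable (X.diffSymbol r i j) (cube d) :=
      (memLp_diffSymbol hd hX r i j).integrable (by norm_num)
    refine (h1.bdd_mul (f := fun x => character n (ofReal x)) ?_ (c := 1) ?_).bdd_mul
      (f := fun x => character (-ξ) (ofReal x)) ?_ (c := 1) ?_
    · exact (((continuous_character _).comp continuous_ofReal).aestronglyMeasurable)
    · exact Eventually.of_forall fun x => (norm_character_ofReal _ x).le
    · exact (((continuous_character _).comp continuous_ofReal).aestronglyMeasurable)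
    · exact Eventually.of_forall fun x => (norm_character_ofReal _ x).le
  rw [inner_truncate_right, cubeCoeff]
  have h1 : ∀ x, character (-ξ) (ofReal x) * X.diffTransform s f r i x = ∑ n ∈ s, ∑ j,
      character (-ξ) (ofReal x) * (character n (ofReal x) * X.diffSymbol r i j x) * f n j := by
    intro x
    simp only [diffTransform_eq, trigPoly, WithLp.ofLp_sum, Finset.sum_apply, PiLp.smul_apply,
      smul_eq_mul, Finset.mul_sum]
    rw [Finset.sum_comm]
    exact Finset.sum_congr rfl fun _ _ => Finset.sum_congr rfl fun _ _ => by ring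
  simp only [h1]
  rw [integral_finsetSum _ fun n _ => integrable_finsetSum _ fun j _ => hi n j]
  refine Finset.sum_congr rfl fun n _ => ?_
  rw [integral_finsetSum _ fun j _ => hi n j, PiLp.inner_apply]
  refine Finset.sum_congr rfl fun j _ => ?_
  rw [RCLike.inner_apply, diffKernel_apply hd hX, diffKernelFun, integral_mul_const]
  simp only [RCLike.conj_conj]
  rw [kernelDiff_eq hd hX, cubeCoeff_shift, cubeCoeff, mul_comm]

lemma hasSum_inner_diffKernel_truncate (hd : 2 ≤ d) (hX : X.LatticeStable)
    (r r' : Fin d → ℤ) (i j : Fin m) (s : Finset (Fin d → ℤ)) (f g : LatL2 d m) :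
    HasSum (fun ξ => starRingEnd ℂ (inner ℂ (X.diffKernel ξ r i) (truncate s g)) *
      inner ℂ (X.diffKernel ξ r' j) (truncate s f))
      (∫ x, starRingEnd ℂ (X.diffTransform s g r i x) * X.diffTransform s f r' j x ∂cube d) := by
  simp only [inner_diffKernel_truncate hd hX]
  exact hasSum_conj_cubeCoeff_mul (memLp_diffTransform hd hX s g r i)
    (memLp_diffTransform hd hX s f r' j)

/-- The difference functionals at all lattice sites form a Bessel family. -/
theorem exists_isBessel_diffKernel (hd : 2 ≤ d) (hX : X.LatticeStable) (r : Fin d → ℤ) :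
    ∃ C : ℝ, 0 ≤ C ∧ ∀ i, IsBessel (fun ξ => X.diffKernel ξ r i) C := by
  have : NeZero d := ⟨by omega⟩
  obtain ⟨C, hC, hb⟩ := exists_norm_diffTransform_le hX r
  -- Parseval and the pointwise bound on the difference factor times ĥ^{-1/2}, tested on
  -- truncations.
  refine ⟨C ^ 2, by positivity, fun i => IsBessel.of_tendsto tendsto_truncate fun s f t => ?_⟩
  have h1 := hasSum_inner_diffKernel_truncate hd hX r r i i s f f
  have hI : Integrable (fun x => ‖X.diffTransform s f r i x‖ ^ 2) (cube d) :=
    (memLp_diffTransform hd hX s f r i).integrable_norm_pow (by norm_num)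
  have h2 : ∀ w : ℂ, starRingEnd ℂ w * w = ((‖w‖ ^ 2 : ℝ) : ℂ) := fun w => by
    rw [← Complex.normSq_eq_norm_sq, Complex.normSq_eq_conj_mul_self]
  have h1' : HasSum (fun ξ => ‖inner ℂ (X.diffKernel ξ r i) (truncate s f)‖ ^ 2)
      (∫ x, ‖X.diffTransform s f r i x‖ ^ 2 ∂cube d) := by
    rw [← Complex.hasSum_ofReal, ← integral_complex_ofReal]
    simpa only [h2] using h1
  refine (sum_le_hasSum t (fun _ _ => sq_nonneg _) h1').trans ?_
  have h3 : ∫ x, ‖trigPoly s f x‖ ^ 2 ∂cube d = ‖truncate s f‖ ^ 2 := by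
    have h4 := integral_inner_trigPoly s f f
    simp only [inner_self_eq_norm_sq_to_K] at h4
    rw [norm_sq_truncate]
    rw [← Complex.ofReal_inj, ← integral_complex_ofReal]
    push_cast
    exact h4
  rw [← h3, ← integral_const_mul]
  refine integral_mono_ae hI ?_ ?_
  · exact (integrable_cube_of_continuous ((continuous_trigPoly s f).norm.pow 2)).const_mul _
  · filter_upwards [hb s f i] with x hx
    calc _ ≤ (C * ‖trigPoly s f x‖) ^ 2 := by gcongr
      _ = _ := by ring

variable (X) in
/-- The stencil `D𝐅f(ξ)` on the homogeneous lattice. -/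
def latDiff (f : LatL2 d m) (ξ : Fin d → ℤ) (ρ : X.stencil) : CDisp m :=
  WithLp.toLp 2 fun i => inner ℂ (X.diffKernel ξ (X.coord ρ.1) i) f

/-- `𝐅* H^hom 𝐅 = 1` on the homogeneous lattice. -/
theorem hasSum_homForm_latDiff (hd : 2 ≤ d) (hX : X.LatticeStable) (f g : LatL2 d m) :
    HasSum (fun ξ => X.homForm (X.latDiff g ξ) (X.latDiff f ξ)) (inner ℂ g f) := by
  have : NeZero d := ⟨by omega⟩
  have hop : ∀ (ρ : X.stencil) (i : Fin m) (σ : X.stencil) (j : Fin m),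
      ∃ T : LatL2 d m →L[ℂ] LatL2 d m, ∀ f g, HasSum (fun ξ =>
        (partial₂ X.pot 0 ρ i σ j : ℂ) *
          (starRingEnd ℂ (inner ℂ (X.diffKernel ξ (X.coord ρ.1) i) g) *
            inner ℂ (X.diffKernel ξ (X.coord σ.1) j) f)) (inner ℂ g (T f)) := by
    intro ρ i σ j
    obtain ⟨C, -, h1⟩ := exists_isBessel_diffKernel hd hX (X.coord ρ.1)
    obtain ⟨C', -, h2⟩ := exists_isBessel_diffKernel hd hX (X.coord σ.1)
    exact (h1 i).exists_operator (h2 j) (N := fun _ => (partial₂ X.pot 0 ρ i σ j : ℂ))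
      (fun _ => le_rfl)
  choose T hT using hop
  have hsum : ∀ f g : LatL2 d m, HasSum (fun ξ => X.homForm (X.latDiff g ξ) (X.latDiff f ξ))
      (inner ℂ g ((∑ ρ, ∑ i, ∑ σ, ∑ j, T ρ i σ j) f)) := by
    intro f g
    simp only [_root_.sum_apply, inner_sum]
    exact hasSum_sum fun ρ _ => hasSum_sum fun i _ => hasSum_sum fun σ _ => hasSum_sum fun j _ =>
      hT ρ i σ j f g
  -- The form is that of a bounded operator, so the identity only has to be checked on finitely
  -- supported sequences, where all transforms are bounded functions.
  have key := operator_eq_one_of_truncate (T := ∑ ρ, ∑ i, ∑ σ, ∑ j, T ρ i σ j) ?_ f g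
  · have := hsum f g
    rwa [key] at this
  intro s f g
  have h1 := hsum (truncate s f) (truncate s g)
  have h2 : HasSum (fun ξ => X.homForm (X.latDiff (truncate s g) ξ) (X.latDiff (truncate s f) ξ))
      (∑ ρ : X.stencil, ∑ i, ∑ σ : X.stencil, ∑ j, (partial₂ X.pot 0 ρ i σ j : ℂ) *
        ∫ x, starRingEnd ℂ (X.diffTransform s g (X.coord ρ.1) i x) *
          X.diffTransform s f (X.coord σ.1) j x ∂cube d) :=
    hasSum_sum fun ρ _ => hasSum_sum fun i _ => hasSum_sum fun σ _ => hasSum_sum fun j _ =>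
      (hasSum_inner_diffKernel_truncate hd hX _ _ i j s f g).mul_left _
  rw [h1.unique h2, inner_truncate_truncate, ← integral_inner_trigPoly]
  have hint : ∀ (r r' : Fin d → ℤ) (i j : Fin m), Integrable (fun x =>
      starRingEnd ℂ (X.diffTransform s g r i x) * X.diffTransform s f r' j x) (cube d) :=
    fun r r' i j => ((memLp_diffTransform hd hX s f r' j).integrable_mul
      (memLp_diffTransform hd hX s g r i).star).congr
      (Eventually.of_forall fun x => mul_comm _ _)
  simp only [← integral_const_mul]
  rw [integral_congr_ae (g := fun x => ∑ ρ : X.stencil, ∑ i, ∑ σ : X.stencil, ∑ j,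
    (partial₂ X.pot 0 ρ i σ j : ℂ) * (starRingEnd ℂ (X.diffTransform s g (X.coord ρ.1) i x) *
          X.diffTransform s f (X.coord σ.1) j x))]
  · rw [integral_finsetSum _ fun ρ _ => integrable_finsetSum _ fun i _ => integrable_finsetSum _
      fun σ _ => integrable_finsetSum _ fun j _ => (hint _ _ i j).const_mul _]
    refine Finset.sum_congr rfl fun ρ _ => ?_
    rw [integral_finsetSum _ fun i _ => integrable_finsetSum _
      fun σ _ => integrable_finsetSum _ fun j _ => (hint _ _ i j).const_mul _]
    refine Finset.sum_congr rfl fun i _ => ?_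
    rw [integral_finsetSum _ fun σ _ => integrable_finsetSum _ fun j _ => (hint _ _ i j).const_mul _]
    refine Finset.sum_congr rfl fun σ _ => ?_
    rw [integral_finsetSum _ fun j _ => (hint _ _ i j).const_mul _]
  · filter_upwards [ae_cube_regular] with x hx
    -- Pointwise the integrand is ⟨ĥ^{-1/2}g, ĥ ĥ^{-1/2}f⟩ = ⟨g, f⟩. The transforms carry the
    -- opposite sign of the shifts compared with ĥ, so the evenness of ĥ (`symbol_kvec_apply'`), and
    -- with it the reflection symmetry of V, is needed here.
    rw [← inner_invSqrtOp_torusOp hX hx.1 hx.2, ← toEuclideanCLM_symbol]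
    set u := X.invSqrtOp x (trigPoly s g x) with hu
    set v := X.invSqrtOp x (trigPoly s f x) with hv
    simp only [diffTransform, ← hu, ← hv, PiLp.inner_apply, Matrix.ofLp_toEuclideanCLM,
      Matrix.mulVec, dotProduct, RCLike.inner_apply, symbol_kvec_apply', Finset.sum_mul, map_mul,
      conj_diffFactor, neg_neg]
    rw [Finset.sum_comm (s := (Finset.univ : Finset X.stencil))]
    refine Finset.sum_congr rfl fun i _ => ?_
    rw [Finset.sum_comm (s := (Finset.univ : Finset (Fin m)))]
    refine Finset.sum_congr rfl fun ρ _ => ?_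
    rw [Finset.sum_comm (s := (Finset.univ : Finset (Fin m)))]
    refine Finset.sum_congr rfl fun σ _ => ?_
    refine Finset.sum_congr rfl fun j _ => ?_
    ring

/-- Parseval in the summation variable: the two factors ĥ^{-1/2} multiply to ĥ^{-1}, and translation
leaves only the character of η - ξ. Two difference factors against the power -1 are critical again,
with α = 2. -/
lemma inner_diffKernel_diffKernel (hd : 2 ≤ d) (hX : X.LatticeStable) (ξ η r r' : Fin d → ℤ)
    (i j : Fin m) :
    inner ℂ (X.diffKernel ξ r i) (X.diffKernel η r' j) =
      ∫ x, character (η - ξ) (ofReal x) * (diffFactor r' (ofReal x) * diffFactor (-r) (ofReal x) *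
        ∑ k, X.invSqrtSymbol x i k * X.invSqrtSymbol x k j) ∂cube d := by
  have h1 : HasSum (fun n => inner ℂ (X.diffKernel ξ r i n) (X.diffKernel η r' j n))
      (inner ℂ (X.diffKernel ξ r i) (X.diffKernel η r' j)) := lp.hasSum_inner _ _
  have hm : ∀ k, MemLp (fun x => character (ξ - η) (ofReal x) * X.diffSymbol r' j k x) 2
      (cube d) := by
    intro k
    refine (memLp_diffSymbol hd hX r' j k).of_le_mul (c := 1) ?_
      (Eventually.of_forall fun x => ?_)
    · exact (((continuous_character _).comp continuous_ofReal).aestronglyMeasurable).mul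
        (aestronglyMeasurable_diffSymbol hd hX r' j k)
    · rw [norm_mul, norm_character_ofReal]
  have h2 : HasSum (fun z : Fin d → ℤ => ∑ k : Fin m,
      starRingEnd ℂ (X.kernelDiff r' (z - (ξ - η)) j k) * X.kernelDiff r z i k)
      (∑ k, ∫ x, starRingEnd ℂ (character (ξ - η) (ofReal x) * X.diffSymbol r' j k x) *
        X.diffSymbol r i k x ∂cube d) := by
    refine hasSum_sum fun k _ => ?_
    simp only [kernelDiff_eq hd hX, cubeCoeff_shift]
    exact hasSum_conj_cubeCoeff_mul (hm k) (memLp_diffSymbol hd hX r i k)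
  rw [← (Equiv.subLeft ξ).hasSum_iff] at h2
  have h3 := h1.unique (h2.congr_fun fun n => ?_)
  · rw [h3, ← integral_finsetSum]
    · refine integral_congr_ae (Eventually.of_forall fun x => ?_)
      simp only [Finset.mul_sum, diffSymbol, map_mul, conj_character_ofReal, conj_diffFactor,
        neg_neg, neg_sub]
      refine Finset.sum_congr rfl fun k _ => ?_
      have h4 : starRingEnd ℂ (X.invSqrtSymbol x j k) = X.invSqrtSymbol x k j :=
        (X.isHermitian_invSqrtSymbol x).apply k j
      rw [h4]; ring
    · intro k _
      exact ((memLp_diffSymbol hd hX r i k).integrable_mul (hm k).star).congr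
        (Eventually.of_forall fun x => mul_comm _ _)
  · simp only [Function.comp_apply, Equiv.subLeft_apply, PiLp.inner_apply, RCLike.inner_apply,
      diffKernel_apply hd hX, diffKernelFun, RCLike.conj_conj]
    refine Finset.sum_congr rfl fun k _ => ?_
    rw [show ξ - n - (ξ - η) = η - n by abel]

/-- Almost orthogonality of the difference functionals. -/
theorem exists_norm_inner_diffKernel_le (hd : 2 ≤ d) (hX : X.LatticeStable) (r r' : Fin d → ℤ) :
    ∃ C : ℝ, 0 ≤ C ∧ ∀ ξ η i j, ‖inner ℂ (X.diffKernel ξ r i) (X.diffKernel η r' j)‖ ≤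
      C * ((1 + ‖ξ - η‖) ^ d)⁻¹ := by
  have : NeZero d := ⟨by omega⟩
  obtain ⟨S, hS⟩ := hX.exists_ellipticSymbol
  obtain ⟨C, hC, h⟩ := ((vanishingFactor_diffFactor r').mul
    (vanishingFactor_diffFactor (-r))).exists_norm_power_coeff_le (Or.inr rfl) S
  refine ⟨C, hC, fun ξ η i j => ?_⟩
  have h1 := h i j (η - ξ)
  rw [norm_sub_rev] at h1
  rw [inner_diffKernel_diffKernel hd hX]
  refine le_trans (le_of_eq ?_) h1
  congr 1
  refine integral_congr_ae ?_
  filter_upwards [ae_cube_regular] with x hx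
  rw [powerEntry_two_eq S hS hx.1 hx.2]

lemma exists_norm_diffKernel_apply_le (hd : 2 ≤ d) (hX : X.LatticeStable) (r : Fin d → ℤ) :
    ∃ C : ℝ, 0 ≤ C ∧ ∀ ξ i n, ‖X.diffKernel ξ r i n‖ ≤ C * ((1 + ‖ξ - n‖) ^ d)⁻¹ := by
  obtain ⟨C, hC, h⟩ := exists_norm_kernelDiff_le hd hX r
  refine ⟨m * C, by positivity, fun ξ i n => ?_⟩
  rw [diffKernel_apply hd hX, diffKernelFun, mul_assoc]
  have h1 : ‖(WithLp.toLp 2 fun j => starRingEnd ℂ (X.kernelDiff r (ξ - n) i j) : CDisp m)‖ ≤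
      ∑ j, ‖X.kernelDiff r (ξ - n) i j‖ := by
    rw [EuclideanSpace.norm_eq]
    refine Real.sqrt_le_iff.2 ⟨by positivity, ?_⟩
    simp only [RCLike.norm_conj]
    exact Finset.sum_sq_le_sq_sum_of_nonneg fun _ _ => norm_nonneg _
  refine h1.trans ((Finset.sum_le_card_nsmul _ _ _ fun j _ => h (ξ - n) i j).trans_eq ?_)
  simp

end DefectCrystal

/-! ### The critical weight -/

section DecayWeight
variable {d : ℕ}

/-- The weight `(1 + |x - y|)^{-d}`. -/
def decay (x y : Fin d → ℤ) : ℝ := ((1 + ‖x - y‖) ^ d)⁻¹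

lemma decay_pos (x y : Fin d → ℤ) : 0 < decay x y := by unfold decay; positivity

lemma decay_nonneg (x y : Fin d → ℤ) : 0 ≤ decay x y := (decay_pos x y).le

lemma decay_self (x : Fin d → ℤ) : decay x x = 1 := by simp [decay]

lemma decay_comm (x y : Fin d → ℤ) : decay x y = decay y x := by rw [decay, norm_sub_rev, decay]

/-- The weight varies slowly: moving an argument by a bounded distance costs a constant factor, by
(1+a+b) ≤ (1+a)(1+b). -/
lemma decay_le_mul (x y y' : Fin d → ℤ) : decay x y ≤ (1 + ‖y - y'‖) ^ d * decay x y' := by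
  unfold decay
  rw [← div_eq_mul_inv, inv_eq_one_div, div_le_div_iff₀ (by positivity) (by positivity), one_mul,
    ← mul_pow]
  gcongr
  have h : ‖x - y'‖ ≤ ‖x - y‖ + ‖y - y'‖ := by
    rw [show x - y' = (x - y) + (y - y') by abel]; exact norm_add_le _ _
  nlinarith [mul_nonneg (norm_nonneg (x - y)) (norm_nonneg (y - y'))]

/-- By the triangle inequality the larger of the two distances is at least about half of |x-y|. The
point is the sum left on the right: summed over p against an ℓ² sequence it stays bounded, although
the weight itself is not summable. -/
lemma decay_mul_decay_le (x p y : Fin d → ℤ) :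
    decay x p * decay p y ≤ 2 ^ d * (decay x y * (decay x p + decay p y)) := by
  have hA : (0 : ℝ) < 1 + ‖x - p‖ := by positivity
  have hB : (0 : ℝ) < 1 + ‖p - y‖ := by positivity
  have hD : (0 : ℝ) < 1 + ‖x - y‖ := by positivity
  have h : 1 + ‖x - y‖ ≤ (1 + ‖x - p‖) + (1 + ‖p - y‖) := by
    have : ‖x - y‖ ≤ ‖x - p‖ + ‖p - y‖ := by
      rw [show x - y = (x - p) + (p - y) by abel]; exact norm_add_le _ _
    linarith
  unfold decay
  generalize 1 + ‖x - p‖ = A at *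
  generalize 1 + ‖p - y‖ = B at *
  generalize 1 + ‖x - y‖ = D at *
  have h1 : D ^ d ≤ 2 ^ d * (A ^ d + B ^ d) := by
    calc D ^ d ≤ (2 * max A B) ^ d := by
          gcongr
          linarith [le_max_left A B, le_max_right A B]
      _ = 2 ^ d * max A B ^ d := mul_pow _ _ _
      _ ≤ _ := by
          gcongr
          rcases max_choice A B with h | h <;> rw [h] <;> simp [hA.le, hB.le]
  rw [← mul_inv]
  have h2 : 2 ^ d * ((D ^ d)⁻¹ * ((A ^ d)⁻¹ + (B ^ d)⁻¹)) =
      2 ^ d * (A ^ d + B ^ d) / (D ^ d * (A ^ d * B ^ d)) := by field_simp; ring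
  rw [h2, inv_eq_one_div, div_le_div_iff₀ (by positivity) (by positivity), one_mul]
  gcongr

end DecayWeight

/-! ### A discrete integral inequality with critical kernel -/

section DecaySequence
variable {d : ℕ} {α : Type*} {p : α → Fin d → ℤ}

/-- Cauchy-Schwarz: the square of the critical weight is summable, so square summable coefficients
compensate for the failing summability. -/
lemma sum_mul_decay_le {n : α → ℝ} {E M : ℝ} {t : Finset α} (hn : ∑ a ∈ t, n a ^ 2 ≤ E)
    (hM : ∀ x, ∀ t : Finset α, ∑ a ∈ t, decay x (p a) ^ 2 ≤ M) (x : Fin d → ℤ) :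
    ∑ a ∈ t, n a * decay x (p a) ≤ √E * √M :=
  (Real.sum_mul_le_sqrt_mul_sqrt t _ _).trans
    (mul_le_mul (Real.sqrt_le_sqrt hn) (Real.sqrt_le_sqrt (hM x t)) (Real.sqrt_nonneg _)
      (Real.sqrt_nonneg _))

/-- Bounded solutions of discrete integral inequalities with critically decaying kernels decay as
the data do. -/
theorem decay_of_inequality {y n : α → ℝ} {δ C B E M Y₀ : ℝ} {q : Fin d → ℤ} {S : Finset α}
    (hn : ∀ a, 0 ≤ n a) (hy : ∀ a, 0 ≤ y a) (hY : ∀ a, y a ≤ Y₀) (hδ : 0 < δ) (hC : 0 ≤ C)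
    (hB : 0 ≤ B)
    (hineq : ∀ a c, (∀ t : Finset α, ∑ a' ∈ t, n a' * (C * decay (p a) (p a') * y a') ≤ c) →
      δ * y a ≤ B * decay (p a) q + c)
    (hS : ∀ t : Finset α, Disjoint t S → ∑ a ∈ t, n a ^ 2 ≤ E)
    (hM : ∀ x, ∀ t : Finset α, ∑ a ∈ t, decay x (p a) ^ 2 ≤ M)
    (hsmall : C * (√E * √M) * (2 ^ d * 2 + 1) ≤ δ / 2)
    (hyS : ∀ a ∈ S, y a ≤ B * decay (p a) q) (a : α) :
    y a ≤ 2 / δ * ((1 + C * (2 ^ d * 2) * ∑ a ∈ S, n a) * B) * decay (p a) q := by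
  classical
  set K := (1 + C * (2 ^ d * 2) * ∑ a ∈ S, n a) * B with hK
  have hn2 : 0 ≤ ∑ a ∈ S, n a := Finset.sum_nonneg fun a _ => hn a
  have hY0 : 0 ≤ Y₀ := (hy a).trans (hY a)
  have hdec1 : ∀ x y : Fin d → ℤ, decay x y ≤ 1 := fun x y => by
    unfold decay
    exact inv_le_one_of_one_le₀ (one_le_pow₀ (by simp))
  -- Adding θ > 0 to the weight makes the quotients bounded a priori, so that their supremum is
  -- finite; afterwards θ tends to 0.
  suffices H : ∀ θ > 0, ∀ a, y a ≤ 2 / δ * K * (decay (p a) q + θ) by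
    have h1 : Tendsto (fun θ : ℝ => 2 / δ * K * (decay (p a) q + θ)) (𝓝[>] 0)
        (𝓝 (2 / δ * K * (decay (p a) q + 0))) :=
      ((tendsto_const_nhds.add tendsto_id).const_mul _).mono_left nhdsWithin_le_nhds
    rw [add_zero] at h1
    refine ge_of_tendsto h1 ?_
    filter_upwards [self_mem_nhdsWithin] with θ hθ using H θ hθ a
  intro θ hθ
  have hpos : ∀ a, 0 < decay (p a) q + θ := fun a => by have := decay_pos (p a) q; positivity
  -- one step of the iteration
  have step : ∀ Y, 0 ≤ Y → (∀ a, y a ≤ Y * (decay (p a) q + θ)) →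
      ∀ a, y a ≤ (K / δ + Y / 2) * (decay (p a) q + θ) := by
    intro Y hY' hyY a
    -- The bound for the sum has two parts: on S the decay is known and only the finite sum of
    -- coefficients enters; off S the provisional constant Y is used, with a factor made at most δ/2
    -- by the smallness of the tail.
    have hb := hineq a (C * (2 ^ d * 2) * (∑ a ∈ S, n a) * B * decay (p a) q +
      C * (√E * √M) * (2 ^ d * 2 + 1) * (Y * (decay (p a) q + θ))) ?_
    · have h2 : C * (√E * √M) * (2 ^ d * 2 + 1) * (Y * (decay (p a) q + θ)) ≤
          δ / 2 * (Y * (decay (p a) q + θ)) :=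
        mul_le_mul_of_nonneg_right hsmall (mul_nonneg hY' (hpos a).le)
      have h3 : δ * y a ≤ K * decay (p a) q + δ / 2 * (Y * (decay (p a) q + θ)) := by
        rw [hK]; linarith
      have hK0 : 0 ≤ K := by positivity
      have h4 : K * decay (p a) q ≤ K * (decay (p a) q + θ) := by gcongr; linarith
      have h5 : y a ≤ (K * (decay (p a) q + θ) + δ / 2 * (Y * (decay (p a) q + θ))) / δ := by
        rw [le_div_iff₀ hδ]; linarith
      refine h5.trans_eq ?_
      field_simp
    · intro t
      rw [← Finset.sum_inter_add_sum_sdiff t S]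
      refine add_le_add ?_ ?_
      · calc _ ≤ ∑ a' ∈ t ∩ S, n a' * (C * (2 ^ d * 2) * B * decay (p a) q) := by
              refine Finset.sum_le_sum fun a' ha' => ?_
              refine mul_le_mul_of_nonneg_left ?_ (hn a')
              have h1 := hyS a' (Finset.mem_inter.1 ha').2
              have h2 := decay_mul_decay_le (p a) (p a') q
              have h3 : decay (p a) (p a') * decay (p a') q ≤ 2 ^ d * (decay (p a) q * 2) := by
                refine h2.trans ?_
                have := decay_nonneg (p a) q
                gcongr
                linarith [hdec1 (p a) (p a'), hdec1 (p a') q]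
              calc C * decay (p a) (p a') * y a'
                  ≤ C * decay (p a) (p a') * (B * decay (p a') q) := by
                    have := decay_nonneg (p a) (p a')
                    gcongr
                _ = C * B * (decay (p a) (p a') * decay (p a') q) := by ring
                _ ≤ C * B * (2 ^ d * (decay (p a) q * 2)) := by gcongr
                _ = _ := by ring
          _ ≤ ∑ a' ∈ S, n a' * (C * (2 ^ d * 2) * B * decay (p a) q) := by
              refine Finset.sum_le_sum_of_subset_of_nonneg Finset.inter_subset_right
                fun a' _ _ => mul_nonneg (hn a') ?_
              have := decay_nonneg (p a) q
              positivity
          _ = _ := by rw [← Finset.sum_mul]; ring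
      · have hE := hS (t \ S) Finset.sdiff_disjoint
        have s1 := sum_mul_decay_le hE hM (p a)
        have s2 := sum_mul_decay_le hE hM q
        calc _ ≤ ∑ a' ∈ t \ S, (C * Y * (2 ^ d * decay (p a) q + θ) * (n a' * decay (p a) (p a')) +
                C * Y * (2 ^ d * decay (p a) q) * (n a' * decay q (p a'))) := by
              refine Finset.sum_le_sum fun a' _ => ?_
              have h2 := decay_mul_decay_le (p a) (p a') q
              have h3 := decay_nonneg (p a) (p a')
              rw [decay_comm q (p a')]
              calc n a' * (C * decay (p a) (p a') * y a')
                  ≤ n a' * (C * decay (p a) (p a') * (Y * (decay (p a') q + θ))) := by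
                    have := hn a'
                    gcongr
                    exact hyY a'
                _ = n a' * C * Y * (decay (p a) (p a') * decay (p a') q) +
                    n a' * C * Y * θ * decay (p a) (p a') := by ring
                _ ≤ n a' * C * Y * (2 ^ d * (decay (p a) q *
                      (decay (p a) (p a') + decay (p a') q))) +
                    n a' * C * Y * θ * decay (p a) (p a') := by
                    have := hn a'
                    gcongr
                _ = _ := by ring
          _ = C * Y * (2 ^ d * decay (p a) q + θ) * ∑ a' ∈ t \ S, n a' * decay (p a) (p a') +
                C * Y * (2 ^ d * decay (p a) q) * ∑ a' ∈ t \ S, n a' * decay q (p a') := by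
              rw [Finset.sum_add_distrib, Finset.mul_sum, Finset.mul_sum]
          _ ≤ C * Y * (2 ^ d * decay (p a) q + θ) * (√E * √M) +
                C * Y * (2 ^ d * decay (p a) q) * (√E * √M) := by
              have := decay_nonneg (p a) q
              gcongr
          _ = C * (√E * √M) * (Y * (2 ^ d * 2 * decay (p a) q + θ)) := by ring
          _ ≤ C * (√E * √M) * ((2 ^ d * 2 + 1) * (Y * (decay (p a) q + θ))) := by
              have := decay_nonneg (p a) q
              refine mul_le_mul_of_nonneg_left ?_ (by positivity)
              have h6 : 0 ≤ Y * decay (p a) q := by positivity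
              have h7 : 0 ≤ Y * θ * (2 ^ d * 2) := by positivity
              nlinarith
          _ = _ := by ring
  -- the smallest constant
  intro a
  have hne : (Set.range fun a => y a / (decay (p a) q + θ)).Nonempty := ⟨_, a, rfl⟩
  have hbdd : BddAbove (Set.range fun a => y a / (decay (p a) q + θ)) := by
    refine ⟨Y₀ / θ, ?_⟩
    rintro _ ⟨a, rfl⟩
    have := decay_pos (p a) q
    exact div_le_div₀ hY0 (hY a) hθ (by linarith)
  set Y := sSup (Set.range fun a => y a / (decay (p a) q + θ)) with hYdef
  have hyY : ∀ a, y a ≤ Y * (decay (p a) q + θ) := fun a => by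
    rw [← div_le_iff₀ (hpos a)]
    exact le_csSup hbdd ⟨a, rfl⟩
  have hY' : 0 ≤ Y := (div_nonneg (hy a) (hpos a).le).trans (le_csSup hbdd ⟨a, rfl⟩)
  have hstep := step Y hY' hyY
  -- The best constant reproduces itself up to one half, which forces Y ≤ 2K/δ.
  have hYle : Y ≤ K / δ + Y / 2 := by
    refine csSup_le hne ?_
    rintro _ ⟨a, rfl⟩
    rw [div_le_iff₀ (hpos a)]
    exact hstep a
  refine (hyY a).trans ?_
  have : Y ≤ 2 / δ * K := by
    have : 2 / δ * K = 2 * (K / δ) := by ring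
    linarith
  exact mul_le_mul_of_nonneg_right this (hpos a).le

end DecaySequence

/-! ### Resolvents of localized perturbations of the identity -/

section Resolvent
variable {d : ℕ} {α : Type*} {H : Type*} [NormedAddCommGroup H] [InnerProductSpace ℂ H]

/-- The operator `T` is `1 + ∑ₐ N_a |ψ_a⟩⟨χ_a|` with square summable coefficients and almost
orthogonal, localized vectors `ψ_a`, `χ_a` with centres `p a`. -/
structure IsLocalizedPerturbation (T : H →L[ℂ] H) (p : α → Fin d → ℤ) (N : α → ℂ)
    (ψ χ : α → H) (C M : ℝ) : Prop where
  nonneg : 0 ≤ C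
  hasSum : ∀ f g, HasSum (fun a => N a * (inner ℂ g (ψ a) * inner ℂ (χ a) f))
    (inner ℂ g (T f) - inner ℂ g f)
  summable : Summable fun a => ‖N a‖ ^ 2
  sum_decay : ∀ x, ∀ t : Finset α, ∑ a ∈ t, decay x (p a) ^ 2 ≤ M
  gram : ∀ a a', ‖inner ℂ (χ a) (ψ a')‖ ≤ C * decay (p a) (p a')
  gram_left : ∀ a a', ‖inner ℂ (χ a) (χ a')‖ ≤ C * decay (p a) (p a')

variable {T : H →L[ℂ] H} {p : α → Fin d → ℤ} {N : α → ℂ} {ψ χ : α → H} {C M : ℝ}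

/-- Square summability leaves arbitrarily small ℓ² mass outside a finite set; E is the square of the
size that the smallness condition permits. -/
lemma IsLocalizedPerturbation.exists_tail (h : IsLocalizedPerturbation T p N ψ χ C M) {δ : ℝ}
    (hδ : 0 < δ) : ∃ (E : ℝ) (S : Finset α),
      (∀ t : Finset α, Disjoint t S → ∑ a ∈ t, ‖N a‖ ^ 2 ≤ E) ∧
      C * (√E * √M) * (2 ^ d * 2 + 1) ≤ δ / 2 := by
  have hC := h.nonneg
  set G := C * √M * (2 ^ d * 2 + 1) + 1 with hG
  have hG0 : 0 < G := by positivity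
  have hE : 0 < (δ / 2 / G) ^ 2 := by positivity
  obtain ⟨S, hS⟩ := summable_iff_vanishing_norm.1 h.summable _ hE
  refine ⟨_, S, fun t ht => (le_abs_self _).trans (hS t ht).le, ?_⟩
  rw [Real.sqrt_sq (by positivity)]
  have : C * (δ / 2 / G * √M) * (2 ^ d * 2 + 1) = δ / 2 * ((C * √M * (2 ^ d * 2 + 1)) / G) := by
    field_simp
  rw [this]
  refine mul_le_of_le_one_right (by positivity) ?_
  rw [div_le_one hG0, hG]
  linarith

/-- Bounds on all finite partial sums pass to the limit, so absolute convergence never has to be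
established separately. -/
lemma IsLocalizedPerturbation.norm_inner_sub_le (h : IsLocalizedPerturbation T p N ψ χ C M)
    (f g : H) {c : ℝ}
    (hc : ∀ t : Finset α, ∑ a ∈ t, ‖N a‖ * (‖inner ℂ g (ψ a)‖ * ‖inner ℂ (χ a) f‖) ≤ c) :
    ‖inner ℂ g (T f) - inner ℂ g f‖ ≤ c := by
  refine le_of_tendsto' (h.hasSum f g).norm fun t => ?_
  refine le_trans ?_ (hc t)
  refine (norm_sum_le _ _).trans_eq (Finset.sum_congr rfl fun a _ => ?_)
  rw [norm_mul, norm_mul]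

lemma IsLocalizedPerturbation.norm_left_le (h : IsLocalizedPerturbation T p N ψ χ C M) (a : α) :
    ‖χ a‖ ≤ √C := by
  have h1 := h.gram_left a a
  rw [decay_self, mul_one, inner_self_eq_norm_sq_to_K] at h1
  have h2 : ‖χ a‖ ^ 2 ≤ C := by simpa using h1
  exact Real.le_sqrt_of_sq_le h2

/-- Decay of a solution `w` of `(z - T) w = v`, given decay on a finite set. -/
lemma IsLocalizedPerturbation.norm_inner_le_of_finite (h : IsLocalizedPerturbation T p N ψ χ C M)
    {δ E B : ℝ} {S : Finset α} (hδ : 0 < δ)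
    (hS : ∀ t : Finset α, Disjoint t S → ∑ a ∈ t, ‖N a‖ ^ 2 ≤ E)
    (hsmall : C * (√E * √M) * (2 ^ d * 2 + 1) ≤ δ / 2) {z : ℂ} (hz : δ ≤ ‖z - 1‖) {v w : H}
    (hw : z • w - T w = v) {q : Fin d → ℤ} (hB : 0 ≤ B)
    (hv : ∀ a, ‖inner ℂ (χ a) v‖ ≤ B * decay (p a) q)
    (hwS : ∀ a ∈ S, ‖inner ℂ (χ a) w‖ ≤ B * decay (p a) q) (a : α) :
    ‖inner ℂ (χ a) w‖ ≤ 2 / δ * ((1 + C * (2 ^ d * 2) * ∑ a ∈ S, ‖N a‖) * B) *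
      decay (p a) q := by
  refine decay_of_inequality (y := fun a => ‖inner ℂ (χ a) w‖) (n := fun a => ‖N a‖)
    (Y₀ := √C * ‖w‖) (fun _ => norm_nonneg _) (fun _ => norm_nonneg _) (fun a => ?_) hδ h.nonneg hB
    (fun a c hc => ?_) hS h.sum_decay hsmall hwS a
  · exact (norm_inner_le_norm _ _).trans (by gcongr; exact h.norm_left_le a)
  · have h1 : (z - 1) * inner ℂ (χ a) w = inner ℂ (χ a) v +
        (inner ℂ (χ a) (T w) - inner ℂ (χ a) w) := by
      rw [← hw, inner_sub_right, inner_smul_right]; ring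
    have h2 := h.norm_inner_sub_le w (χ a) (c := c) fun t => by
      refine le_trans (Finset.sum_le_sum fun a' _ => ?_) (hc t)
      gcongr
      exact h.gram a a'
    calc δ * ‖inner ℂ (χ a) w‖ ≤ ‖z - 1‖ * ‖inner ℂ (χ a) w‖ := by gcongr
      _ = ‖inner ℂ (χ a) v + (inner ℂ (χ a) (T w) - inner ℂ (χ a) w)‖ := by rw [← h1, norm_mul]
      _ ≤ _ := (norm_add_le _ _).trans (add_le_add (hv a) h2)

/-- Decay of resolvents, uniformly in the spectral parameter. -/
theorem IsLocalizedPerturbation.exists_resolvent_decay [CompleteSpace H]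
    (h : IsLocalizedPerturbation T p N ψ χ C M) (hT : IsSelfAdjoint T) {δ K : ℝ} (hδ : 0 < δ) :
    ∃ C' : ℝ, 0 ≤ C' ∧ ∀ z : ℂ, z ∈ resolventSet ℂ T → starRingEnd ℂ z ∈ resolventSet ℂ T →
      δ ≤ ‖z - 1‖ → ‖resolvent T (starRingEnd ℂ z)‖ ≤ K →
      ∀ (v : H) (q : Fin d → ℤ) (B : ℝ), 0 ≤ B →
        (∀ a, ‖inner ℂ (χ a) v‖ ≤ B * decay (p a) q) →
        (∀ a, ‖inner ℂ (ψ a) v‖ ≤ B * decay (p a) q) →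
        ∀ a, ‖inner ℂ (χ a) (resolvent T z v)‖ ≤ C' * B * decay (p a) q := by
  classical
  have hC := h.nonneg
  have hM : 0 ≤ M := by simpa using h.sum_decay 0 ∅
  obtain ⟨E, S, hS, hsmall⟩ := h.exists_tail hδ
  have hres : ∀ z ∈ resolventSet ℂ T, ∀ v, z • resolvent T z v - T (resolvent T z v) = v := by
    intro z hz v
    have h1 : (algebraMap ℂ (H →L[ℂ] H) z - T) * resolvent T z = 1 :=
      Ring.mul_inverse_cancel _ hz
    have := congrArg (fun L : H →L[ℂ] H => L v) h1
    simpa [Algebra.algebraMap_eq_smul_one] using this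
  have hsumsq : ∀ t : Finset α, ∑ a ∈ t, ‖N a‖ ^ 2 ≤ ∑' a, ‖N a‖ ^ 2 := fun t =>
    h.summable.sum_le_tsum t fun _ _ => sq_nonneg _
  set G := 2 / δ * (1 + C * (2 ^ d * 2) * ∑ a ∈ S, ‖N a‖) with hG
  have hG0 : 0 ≤ G := by
    have : 0 ≤ ∑ a ∈ S, ‖N a‖ := Finset.sum_nonneg fun _ _ => norm_nonneg _
    positivity
  -- first, the resolvent applied to one of the vectors
  set W := ∑ a ∈ S, ∑ a' ∈ S, (1 + ‖p a - p a'‖) ^ d with hW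
  have hW0 : 0 ≤ W := Finset.sum_nonneg fun _ _ => Finset.sum_nonneg fun _ _ => by positivity
  have stage1 : ∀ z : ℂ, z ∈ resolventSet ℂ T → δ ≤ ‖z - 1‖ → ‖resolvent T z‖ ≤ K →
      ∀ a₀ ∈ S, ∀ a, ‖inner ℂ (χ a) (resolvent T z (χ a₀))‖ ≤
        G * (C + C * |K| * W) * decay (p a) (p a₀) := by
    intro z hz hzδ hK a₀ ha₀ a
    have h1 := h.norm_inner_le_of_finite hδ hS hsmall hzδ (hres z hz (χ a₀)) (q := p a₀)
      (B := C + C * |K| * W) (by positivity) (fun a => ?_) (fun a ha => ?_) a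
    · refine h1.trans_eq ?_
      rw [hG]; ring
    · refine (h.gram_left a a₀).trans ?_
      have := decay_nonneg (p a) (p a₀)
      gcongr
      have : 0 ≤ C * |K| * W := by positivity
      linarith
    -- For a and a₀ both in S, Cauchy-Schwarz with the bounds √C on the vectors and K on the
    -- resolvent suffices.
    · have h2 : ‖inner ℂ (χ a) (resolvent T z (χ a₀))‖ ≤ √C * (|K| * √C) := by
        refine (norm_inner_le_norm _ _).trans ?_
        refine mul_le_mul (h.norm_left_le a) ?_ (norm_nonneg _) (Real.sqrt_nonneg _)
        refine ((resolvent T z).le_opNorm _).trans ?_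
        exact mul_le_mul (hK.trans (le_abs_self K)) (h.norm_left_le a₀) (norm_nonneg _)
          (abs_nonneg _)
      have h3 : √C * (|K| * √C) = C * |K| := by
        rw [mul_comm |K|, ← mul_assoc, Real.mul_self_sqrt hC]
      rw [h3] at h2
      have h4 : (1 + ‖p a - p a₀‖) ^ d ≤ W := by
        have h5 := Finset.single_le_sum (N := ℝ) (s := S) (f := fun a' => (1 + ‖p a - p a'‖) ^ d)
          (fun _ _ => by positivity) ha₀
        have h6 := Finset.single_le_sum (N := ℝ) (s := S)
          (f := fun a => ∑ a' ∈ S, (1 + ‖p a - p a'‖) ^ d)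
          (fun _ _ => Finset.sum_nonneg fun _ _ => by positivity) ha
        exact h5.trans h6
      have h7 : 1 ≤ W * decay (p a) (p a₀) := by
        unfold decay
        rw [← div_eq_mul_inv, le_div_iff₀ (by positivity), one_mul]
        exact h4
      calc _ ≤ C * |K| * 1 := by rw [mul_one]; exact h2
        _ ≤ C * |K| * (W * decay (p a) (p a₀)) := by gcongr
        _ ≤ C * decay (p a) (p a₀) + C * |K| * (W * decay (p a) (p a₀)) := by
            have := decay_nonneg (p a) (p a₀)
            have : 0 ≤ C * decay (p a) (p a₀) := by positivity
            linarith
        _ = _ := by ring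
  set G₁ := G * (C + C * |K| * W) with hG₁
  have hG₁0 : 0 ≤ G₁ := by positivity
  set Q := √(∑' a, ‖N a‖ ^ 2) * √M with hQ
  have hQ0 : 0 ≤ Q := by positivity
  set G₂ := δ⁻¹ * (1 + G₁ * (2 ^ d * 2) * Q) with hG₂
  have hG₂0 : 0 ≤ G₂ := by positivity
  refine ⟨G * (1 + G₂), by positivity, fun z hz hz' hzδ hK v q B hB hvχ hvψ a => ?_⟩
  have hzδ' : δ ≤ ‖starRingEnd ℂ z - 1‖ := by
    rwa [show starRingEnd ℂ z - 1 = starRingEnd ℂ (z - 1) by simp, RCLike.norm_conj]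
  have hadj : ∀ x y : H, inner ℂ x (T y) = inner ℂ (T x) y := fun x y => by
    rw [← ContinuousLinearMap.adjoint_inner_left, hT.adjoint_eq]
  -- For a general right-hand side v, the plain norm bound would give a constant independent of q.
  -- Duality helps: the matrix element equals ⟨w, v⟩ with w the conjugate resolvent applied to
  -- χ_{a₀}, which is localized near p a₀ by the first stage.
  have stage2 : ∀ a ∈ S, ‖inner ℂ (χ a) (resolvent T z v)‖ ≤ G₂ * B * decay (p a) q := by
    intro a₀ ha₀
    set w := resolvent T (starRingEnd ℂ z) (χ a₀) with hw
    have hw1 : starRingEnd ℂ z • w - T w = χ a₀ := hres _ hz' _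
    have h1 : inner ℂ (χ a₀) (resolvent T z v) = inner ℂ w v := by
      rw [← hw1, inner_sub_left, inner_smul_left, RCLike.conj_conj, ← hadj, ← inner_smul_right,
        ← inner_sub_right, hres z hz]
    -- The resolvent equation for w, paired with v. The first term has the required decay by
    -- hypothesis; the perturbation term pairs the decay of w with that of v against the ψ_a.
    have h2 : (z - 1) * inner ℂ w v = inner ℂ (χ a₀) v +
        starRingEnd ℂ (inner ℂ v (T w) - inner ℂ v w) := by
      rw [← hw1, inner_sub_left, inner_smul_left, RCLike.conj_conj, map_sub, inner_conj_symm,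
        inner_conj_symm]
      ring
    have h3 : ‖inner ℂ v (T w) - inner ℂ v w‖ ≤
        G₁ * B * (2 ^ d * 2) * Q * decay (p a₀) q := by
      refine h.norm_inner_sub_le w v fun t => ?_
      calc _ ≤ ∑ a ∈ t, (G₁ * B * 2 ^ d * decay (p a₀) q) *
            (‖N a‖ * decay (p a₀) (p a) + ‖N a‖ * decay q (p a)) := by
            refine Finset.sum_le_sum fun a _ => ?_
            have e1 := stage1 _ hz' hzδ' hK a₀ ha₀ a
            have e2 := hvψ a
            rw [norm_inner_symm] at e2
            have e3 := decay_mul_decay_le (p a₀) (p a) q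
            have e4 := decay_nonneg (p a) (p a₀)
            have e5 := decay_nonneg (p a) q
            calc _ ≤ ‖N a‖ * ((B * decay (p a) q) * (G₁ * decay (p a) (p a₀))) := by
                  gcongr
              _ = ‖N a‖ * (G₁ * B) * (decay (p a₀) (p a) * decay (p a) q) := by
                  rw [decay_comm (p a) (p a₀)]; ring
              _ ≤ ‖N a‖ * (G₁ * B) *
                  (2 ^ d * (decay (p a₀) q * (decay (p a₀) (p a) + decay (p a) q))) := by
                  gcongr
              _ = _ := by rw [decay_comm q (p a)]; ring
        _ = (G₁ * B * 2 ^ d * decay (p a₀) q) * (∑ a ∈ t, ‖N a‖ * decay (p a₀) (p a) +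
            ∑ a ∈ t, ‖N a‖ * decay q (p a)) := by
            rw [← Finset.mul_sum, Finset.sum_add_distrib]
        _ ≤ (G₁ * B * 2 ^ d * decay (p a₀) q) * (Q + Q) := by
            have := decay_nonneg (p a₀) q
            gcongr
            · exact sum_mul_decay_le (hsumsq t) h.sum_decay _
            · exact sum_mul_decay_le (hsumsq t) h.sum_decay _
        _ = _ := by ring
    have h4 : δ * ‖inner ℂ w v‖ ≤ (1 + G₁ * (2 ^ d * 2) * Q) * (B * decay (p a₀) q) := by
      calc δ * ‖inner ℂ w v‖ ≤ ‖z - 1‖ * ‖inner ℂ w v‖ := by gcongr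
        _ ≤ B * decay (p a₀) q + G₁ * B * (2 ^ d * 2) * Q * decay (p a₀) q := by
            rw [← norm_mul, h2]
            refine (norm_add_le _ _).trans (add_le_add (hvχ a₀) ?_)
            rw [RCLike.norm_conj]
            exact h3
        _ = _ := by ring
    rw [h1, hG₂, mul_assoc, mul_assoc, inv_mul_eq_div, le_div_iff₀ hδ]
    linarith
  have h1 := h.norm_inner_le_of_finite hδ hS hsmall hzδ (hres z hz v) (q := q)
    (B := (1 + G₂) * B) (by positivity) (fun a => ?_) (fun a ha => ?_) a
  · refine h1.trans_eq ?_
    rw [hG]; ring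
  · refine (hvχ a).trans ?_
    have := decay_nonneg (p a) q
    gcongr
    exact le_mul_of_one_le_left hB (by linarith)
  · refine (stage2 a ha).trans ?_
    have := decay_nonneg (p a) q
    gcongr
    linarith

end Resolvent

/-! ### Differentiating the holomorphic functional calculus -/

section ResolventCalculus
variable {𝔸 : Type*} [NormedRing 𝔸] [NormedAlgebra ℂ 𝔸]

lemma resolvent_mul_sub {a : 𝔸} {z : ℂ} (hz : z ∈ resolventSet ℂ a) :
    resolvent a z * (algebraMap ℂ 𝔸 z - a) = 1 := Ring.inverse_mul_cancel _ hz

lemma sub_mul_resolvent {a : 𝔸} {z : ℂ} (hz : z ∈ resolventSet ℂ a) :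
    (algebraMap ℂ 𝔸 z - a) * resolvent a z = 1 := Ring.mul_inverse_cancel _ hz

variable [CompleteSpace 𝔸]

lemma continuousOn_resolvent (a : 𝔸) : ContinuousOn (resolvent (R := ℂ) a) (resolventSet ℂ a) :=
  fun _ hz => (spectrum.hasDerivAt_resolvent_const_left hz).continuousAt.continuousWithinAt

/-- The second order remainder of the resolvent. -/
lemma norm_resolvent_add_sub_le {a e : 𝔸} {z : ℂ} {K : ℝ} (hz : z ∈ resolventSet ℂ a)
    (hK : ‖resolvent a z‖ ≤ K) (he : K * ‖e‖ ≤ 1 / 2) :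
    ‖resolvent (a + e) z - resolvent a z - resolvent a z * e * resolvent a z‖ ≤
      2 * K ^ 3 * ‖e‖ ^ 2 := by
  set R := resolvent a z with hR
  have hK0 : 0 ≤ K := (norm_nonneg _).trans hK
  have hsmall : ‖R * e‖ < 1 := by
    calc ‖R * e‖ ≤ ‖R‖ * ‖e‖ := norm_mul_le _ _
      _ ≤ K * ‖e‖ := by gcongr
      _ < 1 := by linarith
  have hz' : z ∈ resolventSet ℂ (a + e) := by
    have h1 : algebraMap ℂ 𝔸 z - (a + e) = (algebraMap ℂ 𝔸 z - a) * (1 - R * e) := by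
      rw [mul_sub, mul_one, ← mul_assoc, hR, sub_mul_resolvent hz, one_mul, sub_sub]
    rw [spectrum.mem_resolventSet_iff, h1]
    exact IsUnit.mul hz (isUnit_one_sub_of_norm_lt_one hsmall)
  set R' := resolvent (a + e) z with hR'
  have h1 : R' - R = R * e * R' := by
    calc R' - R = R * (algebraMap ℂ 𝔸 z - a) * R' - R * ((algebraMap ℂ 𝔸 z - (a + e)) * R') := by
          rw [hR, hR', resolvent_mul_sub hz, sub_mul_resolvent hz', one_mul, mul_one]
      _ = R * e * R' := by noncomm_ring
  have h2 : ‖R'‖ ≤ 2 * K := by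
    have h3 : ‖R'‖ ≤ K + 1 / 2 * ‖R'‖ := by
      calc ‖R'‖ = ‖R + R * e * R'‖ := by rw [← h1]; congr 1; abel
        _ ≤ ‖R‖ + ‖R‖ * ‖e‖ * ‖R'‖ := (norm_add_le _ _).trans (by
            gcongr
            exact (norm_mul_le _ _).trans (by gcongr; exact norm_mul_le _ _))
        _ ≤ K + K * ‖e‖ * ‖R'‖ := by gcongr
        _ ≤ _ := by gcongr
    linarith
  -- The resolvent identity inserted into itself exhibits the remainder as quadratic in e.
  have h4 : R' - R - R * e * R = R * e * (R * e * R') := by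
    rw [← h1, mul_sub, ← h1]
  rw [h4]
  calc _ ≤ ‖R‖ * ‖e‖ * (‖R‖ * ‖e‖ * ‖R'‖) := by
        refine (norm_mul_le _ _).trans ?_
        gcongr
        · exact norm_mul_le _ _
        · exact (norm_mul_le _ _).trans (by gcongr; exact norm_mul_le _ _)
    _ ≤ K * ‖e‖ * (K * ‖e‖ * (2 * K)) := by gcongr
    _ = _ := by ring

/-- The derivative of the holomorphic functional calculus with respect to the operator. -/
theorem hasFDerivAt_circleIntegral_resolvent {a : 𝔸} {f : ℂ → ℂ} {c : ℂ} {r : ℝ} (hr : 0 ≤ r)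
    (hf : ContinuousOn f (Metric.sphere c r)) (ha : Metric.sphere c r ⊆ resolventSet ℂ a) :
    ∃ L : 𝔸 →L[ℂ] 𝔸, (∀ e, L e = ∮ z in C(c, r), f z • (resolvent a z * e * resolvent a z)) ∧
      HasFDerivAt (fun b => ∮ z in C(c, r), f z • resolvent b z) L a := by
  have hRc : ContinuousOn (resolvent (R := ℂ) a) (Metric.sphere c r) :=
    (continuousOn_resolvent a).mono ha
  have hcomp := isCompact_sphere c r
  obtain ⟨K₀, hK₀⟩ := hcomp.exists_bound_of_continuousOn hRc
  obtain ⟨F₀, hF₀⟩ := hcomp.exists_bound_of_continuousOn hf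
  set K := max K₀ 1 with hKdef
  set F := max F₀ 0 with hFdef
  have hK : ∀ z ∈ Metric.sphere c r, ‖resolvent a z‖ ≤ K := fun z hz =>
    (hK₀ z hz).trans (le_max_left _ _)
  have hF : ∀ z ∈ Metric.sphere c r, ‖f z‖ ≤ F := fun z hz => (hF₀ z hz).trans (le_max_left _ _)
  have hKpos : 0 < K := lt_of_lt_of_le one_pos (le_max_right _ _)
  have hF0 : 0 ≤ F := le_max_right _ _
  have hcont : ∀ e, ContinuousOn (fun z => f z • (resolvent a z * e * resolvent a z))
      (Metric.sphere c r) := fun e => hf.smul ((hRc.mul continuousOn_const).mul hRc)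
  have hint := fun e => (hcont e).circleIntegrable hr
  let L₀ : 𝔸 →ₗ[ℂ] 𝔸 :=
    { toFun := fun e => ∮ z in C(c, r), f z • (resolvent a z * e * resolvent a z)
      map_add' := fun e e' => by
        rw [← circleIntegral.integral_add (hint e) (hint e')]
        congr 1
        funext z
        rw [mul_add, add_mul, smul_add]
      map_smul' := fun k e => by
        rw [RingHom.id_apply, ← circleIntegral.integral_smul]
        congr 1
        funext z
        rw [mul_smul_comm, smul_mul_assoc, smul_comm] }
  let L : 𝔸 →L[ℂ] 𝔸 := L₀.mkContinuous (2 * Real.pi * r * (F * (K * K))) fun e => by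
    rw [show 2 * Real.pi * r * (F * (K * K)) * ‖e‖ = 2 * Real.pi * r * (F * (K * ‖e‖ * K)) by ring]
    refine circleIntegral.norm_integral_le_of_norm_le_const
      (f := fun z => f z • (resolvent a z * e * resolvent a z)) hr fun z hz => ?_
    rw [norm_smul]
    have h1 : ‖resolvent a z * e * resolvent a z‖ ≤ ‖resolvent a z‖ * ‖e‖ * ‖resolvent a z‖ :=
      (norm_mul_le _ _).trans (by gcongr; exact norm_mul_le _ _)
    have := hK z hz
    have := hF z hz
    refine (mul_le_mul_of_nonneg_left h1 (norm_nonneg _)).trans ?_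
    gcongr
  refine ⟨L, fun e => rfl, ?_⟩
  rw [hasFDerivAt_iff_isLittleO_nhds_zero]
  refine (Asymptotics.IsBigO.of_bound (2 * Real.pi * r * (F * (2 * K ^ 3))) ?_).trans_isLittleO
    (Asymptotics.isLittleO_norm_pow_id one_lt_two)
  have hball : Metric.ball (0 : 𝔸) (1 / (2 * K)) ∈ 𝓝 0 := Metric.ball_mem_nhds _ (by positivity)
  filter_upwards [hball] with e he
  have he' : K * ‖e‖ ≤ 1 / 2 := by
    rw [mem_ball_zero_iff, lt_div_iff₀ (by positivity)] at he
    linarith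
  have hsub : ∀ z ∈ Metric.sphere c r,
      f z • resolvent (a + e) z - f z • resolvent a z - f z • (resolvent a z * e * resolvent a z) =
      f z • (resolvent (a + e) z - resolvent a z - resolvent a z * e * resolvent a z) := fun z _ => by
    rw [smul_sub, smul_sub]
  have hmem : Metric.sphere c r ⊆ resolventSet ℂ (a + e) := fun z hz => by
    have h1 : algebraMap ℂ 𝔸 z - (a + e) = (algebraMap ℂ 𝔸 z - a) * (1 - resolvent a z * e) := by
      rw [mul_sub, mul_one, ← mul_assoc, sub_mul_resolvent (ha hz), one_mul, sub_sub]
    rw [spectrum.mem_resolventSet_iff, h1]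
    refine IsUnit.mul (ha hz) (isUnit_one_sub_of_norm_lt_one ?_)
    calc _ ≤ ‖resolvent a z‖ * ‖e‖ := norm_mul_le _ _
      _ ≤ K * ‖e‖ := by gcongr; exact hK z hz
      _ < 1 := by linarith
  have hi1 : CircleIntegrable (fun z => f z • resolvent (a + e) z) c r :=
    (hf.smul ((continuousOn_resolvent _).mono hmem)).circleIntegrable hr
  have hi2 : CircleIntegrable (fun z => f z • resolvent a z) c r :=
    (hf.smul hRc).circleIntegrable hr
  have hLe : L e = ∮ z in C(c, r), f z • (resolvent a z * e * resolvent a z) := rfl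
  rw [hLe, ← circleIntegral.integral_sub hi1 hi2, ← circleIntegral.integral_sub
    (f := fun z => f z • resolvent (a + e) z - f z • resolvent a z)
    (hi1.sub hi2) (hint e)]
  refine (circleIntegral.norm_integral_le_of_norm_le_const (C := F * (2 * K ^ 3 * ‖e‖ ^ 2)) hr
    fun z hz => ?_).trans_eq ?_
  · rw [hsub z hz, norm_smul]
    exact mul_le_mul (hF z hz) (norm_resolvent_add_sub_le (ha hz) (hK z hz) he') (norm_nonneg _) hF0
  · rw [Real.norm_eq_abs, abs_of_nonneg (by positivity)]; ring

end ResolventCalculus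

/-! ### Resolvents of self-adjoint operators -/

section HilbertResolvent
variable {H : Type*} [NormedAddCommGroup H] [InnerProductSpace ℂ H] [CompleteSpace H]

lemma adjoint_resolvent {T : H →L[ℂ] H} (hT : IsSelfAdjoint T) {z : ℂ}
    (hz : z ∈ resolventSet ℂ T) (hz' : starRingEnd ℂ z ∈ resolventSet ℂ T) (u v : H) :
    inner ℂ u (resolvent T z v) = inner ℂ (resolvent T (starRingEnd ℂ z) u) v := by
  have h1 : ∀ w ∈ resolventSet ℂ T, ∀ x, w • resolvent T w x - T (resolvent T w x) = x := by
    intro w hw x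
    have := congrArg (fun L : H →L[ℂ] H => L x) (sub_mul_resolvent hw)
    simpa [Algebra.algebraMap_eq_smul_one] using this
  have hadj : ∀ x y : H, inner ℂ x (T y) = inner ℂ (T x) y := fun x y => by
    rw [← ContinuousLinearMap.adjoint_inner_left, hT.adjoint_eq]
  set a := resolvent T (starRingEnd ℂ z) u with ha
  set b := resolvent T z v with hb
  rw [← h1 _ hz' u, ← h1 _ hz v, ← ha, ← hb, inner_sub_left, inner_sub_right, inner_smul_left,
    inner_smul_right, RCLike.conj_conj, hadj]

/-- The spectrum is real, so only real points have to be excluded. -/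
lemma IsSelfAdjoint.mem_resolventSet_of_forall {T : H →L[ℂ] H} (hT : IsSelfAdjoint T) {z : ℂ}
    (h : z = (z.re : ℂ) → ((z.re : ℝ) : ℂ) ∉ spectrum ℂ T) : z ∈ resolventSet ℂ T := by
  by_contra hz
  have hz' : z ∈ spectrum ℂ T := hz
  have h1 : z = (z.re : ℂ) := IsSelfAdjoint.mem_spectrum_eq_re hT hz'
  exact h h1 (h1 ▸ hz')

/-- Singular Weyl sequences belong to the spectrum. -/
lemma mem_spectrum_of_forall_exists {T : H →L[ℂ] H} {z : ℂ}
    (h : ∀ ε > 0, ∃ e : H, ‖e‖ = 1 ∧ ‖z • e - T e‖ ≤ ε) : z ∈ spectrum ℂ T := by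
  intro hz
  have hz' : z ∈ resolventSet ℂ T := hz
  obtain ⟨e, he, hle⟩ := h (1 / (2 * (‖resolvent T z‖ + 1))) (by positivity)
  have h1 : resolvent T z (z • e - T e) = e := by
    have := congrArg (fun L : H →L[ℂ] H => L e) (resolvent_mul_sub hz')
    simpa [Algebra.algebraMap_eq_smul_one] using this
  have h2 := (resolvent T z).le_opNorm (z • e - T e)
  rw [h1, he] at h2
  have h3 : ‖resolvent T z‖ * (1 / (2 * (‖resolvent T z‖ + 1))) ≤ 1 / 2 := by
    rw [mul_one_div, div_le_div_iff₀ (by positivity) (by positivity)]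
    nlinarith [norm_nonneg (resolvent T z)]
  have h4 := h2.trans (mul_le_mul_of_nonneg_left hle (norm_nonneg _))
  linarith

lemma inner_circleIntegral {f : ℂ → H →L[ℂ] H} {c : ℂ} {r : ℝ} (hf : CircleIntegrable f c r)
    (u v : H) : inner ℂ u ((∮ z in C(c, r), f z) v) = ∮ z in C(c, r), inner ℂ u (f z v) := by
  let Φ : (H →L[ℂ] H) →L[ℂ] ℂ := (innerSL ℂ u).comp (ContinuousLinearMap.apply ℂ H v)
  have h := Φ.intervalIntegral_comp_comm hf.out
  simp only [circleIntegral]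
  have h2 : ∀ x : H →L[ℂ] H, Φ x = inner ℂ u (x v) := fun x => rfl
  rw [← h2, ← h]
  refine intervalIntegral.integral_congr fun θ _ => ?_
  rw [map_smul, h2]

end HilbertResolvent

/-! ### Weyl sequences for localized perturbations -/

section Weyl
variable {d : ℕ} {α : Type*} {H : Type*} [NormedAddCommGroup H] [InnerProductSpace ℂ H]
  [CompleteSpace H] {T : H →L[ℂ] H} {p : α → Fin d → ℤ} {N : α → ℂ} {ψ χ : α → H} {C M : ℝ}

lemma tendsto_decay [NeZero d] (x : Fin d → ℤ) : Tendsto (fun q => decay x q) cofinite (𝓝 0) := by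
  have h1 : Tendsto (fun q : Fin d → ℤ => ‖q‖) cofinite atTop := by
    have := tendsto_norm_cocompact_atTop (E := Fin d → ℤ)
    rwa [cocompact_eq_cofinite] at this
  have h2 : Tendsto (fun q : Fin d → ℤ => 1 + ‖x - q‖) cofinite atTop := by
    refine tendsto_atTop_mono (fun q => ?_) (tendsto_atTop_add_const_right _ (1 - ‖x‖) h1)
    have : ‖q‖ ≤ ‖x‖ + ‖x - q‖ := by
      calc ‖q‖ = ‖x - (x - q)‖ := by congr 1; abel
        _ ≤ _ := norm_sub_le _ _
    linarith
  unfold decay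
  exact ((tendsto_pow_atTop (NeZero.ne d)).comp h2).inv_tendsto_atTop

/-- Perturbations with square summable coefficients do not move the essential spectrum. -/
theorem IsLocalizedPerturbation.one_mem_spectrum [NeZero d]
    (h : IsLocalizedPerturbation T p N ψ χ C M) {B : ℝ} (hB : 0 ≤ B)
    (hψ : ∀ a, ‖ψ a‖ ≤ B)
    (he : ∃ᶠ q in cofinite, ∃ e : H, ‖e‖ = 1 ∧ ∀ a, ‖inner ℂ (χ a) e‖ ≤ B * decay (p a) q) :
    (1 : ℂ) ∈ spectrum ℂ T := by
  have hC := h.nonneg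
  have hM : 0 ≤ M := by simpa using h.sum_decay 0 ∅
  refine mem_spectrum_of_forall_exists fun ε hε => ?_
  set G := (‖T‖ + 1) * B * B with hG
  have hG0 : 0 ≤ G := by positivity
  have hE : 0 < (ε ^ 2 / 2 / (G * √M + 1)) ^ 2 := by positivity
  -- S carries all but little of the ℓ² mass. Its part of the sum vanishes as the centre q goes to
  -- infinity, while the rest is small uniformly in q by Cauchy-Schwarz.
  obtain ⟨S, hS⟩ := summable_iff_vanishing_norm.1 h.summable _ hE
  have hlim : Tendsto (fun q => G * ∑ a ∈ S, ‖N a‖ * decay (p a) q) cofinite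
      (𝓝 (G * ∑ a ∈ S, ‖N a‖ * 0)) :=
    (tendsto_finsetSum _ fun a _ => (tendsto_decay (p a)).const_mul _).const_mul _
  simp only [mul_zero, Finset.sum_const_zero] at hlim
  obtain ⟨q, ⟨e, he1, he2⟩, hq⟩ := (he.and_eventually
    (hlim.eventually (gt_mem_nhds (by positivity : 0 < ε ^ 2 / 2)))).exists
  refine ⟨e, he1, ?_⟩
  set g := T e - e with hg
  have hg1 : ‖g‖ ≤ ‖T‖ + 1 := by
    refine (norm_sub_le _ _).trans ?_
    have := T.le_opNorm e
    rw [he1, mul_one] at this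
    rw [he1]; linarith
  rw [one_smul, ← norm_neg, neg_sub, ← hg]
  refine abs_le_of_sq_le_sq' ?_ hε.le |>.2
  classical
  -- Testing with g = Te - e itself turns the bound on the form into one on ‖Te - e‖².
  have key := h.norm_inner_sub_le e g (c := ε ^ 2) fun t => ?_
  · rw [← inner_sub_right, ← hg, inner_self_eq_norm_sq_to_K] at key
    simpa using key
  · have hb : ∀ a, ‖N a‖ * (‖inner ℂ g (ψ a)‖ * ‖inner ℂ (χ a) e‖) ≤
        G * (‖N a‖ * decay (p a) q) := by
      intro a
      have h1 : ‖inner ℂ g (ψ a)‖ ≤ (‖T‖ + 1) * B :=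
        (norm_inner_le_norm _ _).trans (mul_le_mul hg1 (hψ a) (norm_nonneg _) (by positivity))
      calc _ ≤ ‖N a‖ * (((‖T‖ + 1) * B) * (B * decay (p a) q)) := by
            gcongr
            exact he2 a
        _ = _ := by rw [hG]; ring
    refine (Finset.sum_le_sum fun a _ => hb a).trans ?_
    rw [← Finset.sum_inter_add_sum_sdiff t S, ← Finset.mul_sum, ← Finset.mul_sum]
    have h1 : G * ∑ a ∈ t ∩ S, ‖N a‖ * decay (p a) q ≤ ε ^ 2 / 2 := by
      refine le_trans ?_ hq.le
      gcongr
      · exact fun a _ _ => mul_nonneg (norm_nonneg (N a)) (decay_nonneg (p a) q)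
      · exact Finset.inter_subset_right
    have h2 : G * ∑ a ∈ t \ S, ‖N a‖ * decay (p a) q ≤ ε ^ 2 / 2 := by
      have h3 := sum_mul_decay_le (n := fun a => ‖N a‖) (t := t \ S)
        ((le_abs_self _).trans (hS (t \ S) Finset.sdiff_disjoint).le) h.sum_decay q
      rw [Real.sqrt_sq (by positivity)] at h3
      simp only [decay_comm q] at h3
      calc _ ≤ G * (ε ^ 2 / 2 / (G * √M + 1) * √M) := by gcongr
        _ = ε ^ 2 / 2 * ((G * √M) / (G * √M + 1)) := by field_simp
        _ ≤ _ := by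
          refine mul_le_of_le_one_right (by positivity) ?_
          rw [div_le_one (by positivity)]
          linarith
    linarith

end Weyl

namespace DefectCrystal
variable {d m : ℕ} (X : DefectCrystal d m)

/-! ### Geometry of the defective configuration -/

lemma mem_sites_iff {x : Space d} (hx : X.coreRadius ≤ ‖x‖) :
    x ∈ X.sites ↔ x ∈ bravais X.A := by
  have h : x ∉ Metric.ball (0 : Space d) X.coreRadius := by simpa using hx
  have h1 := Set.ext_iff.1 X.sites_diff_core x
  simpa [h] using h1

/-- The lattice map on real coordinates. -/
def latCLE : (Fin d → ℝ) ≃L[ℝ] Space d :=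
  ((Matrix.toLinearEquiv' X.A (Matrix.invertibleOfIsUnitDet _ (Ne.isUnit X.det_ne_zero))).trans
    (WithLp.linearEquiv 2 ℝ (Fin d → ℝ)).symm).toContinuousLinearEquiv

lemma latCLE_apply (z : Fin d → ℤ) : X.latCLE (fun i => (z i : ℝ)) = X.lat z := rfl

lemma norm_intCast (z : Fin d → ℤ) : ‖(fun i => (z i : ℝ) : Fin d → ℝ)‖ = ‖z‖ := by
  simp only [Pi.norm_def]
  congr 2

lemma exists_norm_lat_le : ∃ C : ℝ, 0 ≤ C ∧ ∀ z, ‖X.lat z‖ ≤ C * ‖z‖ :=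
  ⟨‖(X.latCLE : (Fin d → ℝ) →L[ℝ] Space d)‖, norm_nonneg _, fun z => by
    rw [← latCLE_apply, ← norm_intCast]
    exact (X.latCLE : (Fin d → ℝ) →L[ℝ] Space d).le_opNorm _⟩

lemma exists_norm_le_lat : ∃ C : ℝ, 0 ≤ C ∧ ∀ z, ‖z‖ ≤ C * ‖X.lat z‖ :=
  ⟨‖(X.latCLE.symm : Space d →L[ℝ] (Fin d → ℝ))‖, norm_nonneg _, fun z => by
    have h := (X.latCLE.symm : Space d →L[ℝ] (Fin d → ℝ)).le_opNorm (X.lat z)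
    rw [← norm_intCast]
    have h1 : X.latCLE.symm (X.lat z) = fun i => (z i : ℝ) := by
      rw [← latCLE_apply]
      exact X.latCLE.symm_apply_apply _
    exact (congrArg norm h1).symm.trans_le h⟩

lemma finite_lat_core : {ξ : Fin d → ℤ | ‖X.lat ξ‖ < X.coreRadius}.Finite := by
  obtain ⟨C, hC, h⟩ := X.exists_norm_le_lat
  refine (Metric.finite_isBounded_inter_isClosed DiscreteTopology.isDiscrete
    (Metric.isBounded_closedBall (x := (0 : Fin d → ℤ)) (r := C * X.coreRadius))
    (isClosed_univ (X := Fin d → ℤ))).subset ?_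
  intro ξ hξ
  refine ⟨?_, mem_univ _⟩
  rw [mem_closedBall_zero_iff]
  exact (h ξ).trans (by gcongr; exact le_of_lt hξ)

lemma finite_siteCore : {ℓ : X.sites | ‖ℓ.1‖ < X.coreRadius}.Finite := by
  refine Set.Finite.of_finite_image (f := Subtype.val) (X.finite_core.subset ?_)
    Subtype.val_injective.injOn
  rintro _ ⟨ℓ, hℓ, rfl⟩
  exact ⟨ℓ.2, by simpa using hℓ⟩

/-- The sites in the defect core. -/
def core : Finset X.sites := X.finite_siteCore.toFinset

lemma mem_core {ℓ : X.sites} : ℓ ∈ X.core ↔ ‖ℓ.1‖ < X.coreRadius := by simp [core]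

lemma mem_core_of_notMem_bravais {ℓ : X.sites} (h : ℓ.1 ∉ bravais X.A) : ℓ ∈ X.core := by
  rw [mem_core]
  by_contra h'
  exact h ((X.mem_sites_iff (not_lt.1 h')).1 ℓ.2)

open Classical in
/-- The sites that are not lattice points. -/
def interstitials : Finset X.sites := X.core.filter fun ℓ => ℓ.1 ∉ bravais X.A

lemma mem_interstitials {ℓ : X.sites} : ℓ ∈ X.interstitials ↔ ℓ.1 ∉ bravais X.A := by
  simp only [interstitials, Finset.mem_filter, and_iff_right_iff_imp]
  exact X.mem_core_of_notMem_bravais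

lemma finite_vacancies : {ξ : Fin d → ℤ | X.lat ξ ∉ X.sites}.Finite := by
  refine X.finite_lat_core.subset fun ξ hξ => ?_
  by_contra h
  exact hξ ((X.mem_sites_iff (not_lt.1 h)).2 (X.lat_mem ξ))

/-- The lattice points that are not sites. -/
def vacancies : Finset (Fin d → ℤ) := X.finite_vacancies.toFinset

lemma mem_vacancies {ξ : Fin d → ℤ} : ξ ∈ X.vacancies ↔ X.lat ξ ∉ X.sites := by simp [vacancies]

open Classical in
/-- The integer coordinates of a site, `0` for interstitials. -/
def pos (ℓ : X.sites) : Fin d → ℤ := if ℓ.1 ∈ bravais X.A then X.coord ℓ.1 else 0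

lemma pos_of_mem {ℓ : X.sites} (h : ℓ.1 ∈ bravais X.A) : X.pos ℓ = X.coord ℓ.1 := if_pos h

lemma pos_of_notMem {ℓ : X.sites} (h : ℓ.1 ∉ bravais X.A) : X.pos ℓ = 0 := if_neg h

lemma pos_lat {ξ : Fin d → ℤ} (h : X.lat ξ ∈ X.sites) : X.pos ⟨X.lat ξ, h⟩ = ξ := by
  rw [pos_of_mem X (ℓ := ⟨X.lat ξ, h⟩) (X.lat_mem ξ), X.coord_lat]

/-- Interstitials lie in the core, so giving them the coordinate 0 costs at most the core radius. -/
lemma norm_sub_lat_pos_le (ℓ : X.sites) : ‖ℓ.1 - X.lat (X.pos ℓ)‖ ≤ X.coreRadius := by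
  by_cases hℓ : ℓ.1 ∈ bravais X.A
  · rw [X.pos_of_mem hℓ, X.lat_coord hℓ, sub_self, norm_zero]
    exact X.coreRadius_pos.le
  · rw [X.pos_of_notMem hℓ, X.lat_zero, sub_zero]
    exact (X.mem_core.1 (X.mem_core_of_notMem_bravais hℓ)).le

/-- The coordinates of two sites determine their distance up to constants. -/
lemma exists_dist_le : ∃ C : ℝ, 0 < C ∧ ∀ ℓ n : X.sites,
    dist ℓ.1 n.1 ≤ C * (1 + ‖X.pos ℓ - X.pos n‖) := by
  obtain ⟨C, hC, h⟩ := X.exists_norm_lat_le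
  have key := X.norm_sub_lat_pos_le
  refine ⟨C + 2 * X.coreRadius, by have := X.coreRadius_pos; positivity, fun ℓ n => ?_⟩
  rw [dist_eq_norm]
  have h1 : ℓ.1 - n.1 = (ℓ.1 - X.lat (X.pos ℓ)) + X.lat (X.pos ℓ - X.pos n) -
      (n.1 - X.lat (X.pos n)) := by rw [lat_sub]; abel
  have h2 : ‖ℓ.1 - n.1‖ ≤ X.coreRadius + C * ‖X.pos ℓ - X.pos n‖ + X.coreRadius := by
    rw [h1]
    refine (norm_sub_le _ _).trans (add_le_add ((norm_add_le _ _).trans ?_) (key n))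
    exact add_le_add (key ℓ) (h _)
  have := X.coreRadius_pos
  have := norm_nonneg (X.pos ℓ - X.pos n)
  nlinarith

/-! ### Comparison with the homogeneous lattice -/

/-- Transfer of sums between the sites and `ℤ^d`. -/
lemma hasSum_sites_iff {β : Type*} [AddCommMonoid β] [TopologicalSpace β] {F : X.sites → β}
    {G : (Fin d → ℤ) → β} {a : β} (hFG : ∀ ξ (h : X.lat ξ ∈ X.sites), F ⟨X.lat ξ, h⟩ = G ξ)
    (hF : ∀ ℓ : X.sites, ℓ.1 ∉ bravais X.A → F ℓ = 0)
    (hG : ∀ ξ, X.lat ξ ∉ X.sites → G ξ = 0) : HasSum F a ↔ HasSum G a := by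
  let i₁ : {ξ // X.lat ξ ∈ X.sites} → X.sites := fun ξ => ⟨X.lat ξ.1, ξ.2⟩
  let i₂ : {ξ // X.lat ξ ∈ X.sites} → (Fin d → ℤ) := Subtype.val
  have h₁ : Function.Injective i₁ := fun ξ η h =>
    Subtype.ext (X.lat_injective (congrArg Subtype.val h))
  have h₂ : Function.Injective i₂ := Subtype.val_injective
  rw [← h₁.hasSum_iff, ← h₂.hasSum_iff]
  · have : F ∘ i₁ = G ∘ i₂ := funext fun ξ => hFG ξ.1 ξ.2
    rw [this]
  · intro ξ hξ
    exact hG ξ fun h => hξ ⟨⟨ξ, h⟩, rfl⟩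
  · intro ℓ hℓ
    refine hF ℓ fun h => hℓ ?_
    have hs : X.lat (X.coord ℓ.1) ∈ X.sites := by rw [X.lat_coord h]; exact ℓ.2
    exact ⟨⟨X.coord ℓ.1, hs⟩, Subtype.ext (X.lat_coord h)⟩

open Classical in
/-- Extension by zero of a function on the sites to `ℤ^d`. -/
def extendFun {Y : Type*} [Zero Y] (f : X.sites → Y) (ξ : Fin d → ℤ) : Y :=
  if h : X.lat ξ ∈ X.sites then f ⟨X.lat ξ, h⟩ else 0

lemma extendFun_of_mem {Y : Type*} [Zero Y] (f : X.sites → Y) {ξ : Fin d → ℤ}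
    (h : X.lat ξ ∈ X.sites) : X.extendFun f ξ = f ⟨X.lat ξ, h⟩ := dif_pos h

lemma extendFun_of_notMem {Y : Type*} [Zero Y] (f : X.sites → Y) {ξ : Fin d → ℤ}
    (h : X.lat ξ ∉ X.sites) : X.extendFun f ξ = 0 := dif_neg h

open Classical in
lemma hasSum_norm_sq_extendFun (f : X.L2) :
    ∃ a ≤ ‖f‖ ^ 2, HasSum (fun ξ => ‖X.extendFun f ξ‖ ^ 2) a := by
  have h1 : HasSum (fun ℓ => ‖f ℓ‖ ^ 2) (‖f‖ ^ 2) := by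
    have := lp.hasSum_norm (p := 2) (by norm_num) f
    simpa using this
  have h2 : Summable (fun ℓ : X.sites => if ℓ.1 ∈ bravais X.A then ‖f ℓ‖ ^ 2 else 0) :=
    Summable.of_nonneg_of_le (fun ℓ => by split_ifs <;> positivity)
      (fun ℓ => by split_ifs <;> simp) h1.summable
  refine ⟨_, ?_, (X.hasSum_sites_iff ?_ ?_ ?_).1 h2.hasSum⟩
  · rw [← h1.tsum_eq]
    exact h2.tsum_le_tsum (fun ℓ => by split_ifs <;> simp) h1.summable
  · intro ξ h
    rw [if_pos (X.lat_mem ξ), X.extendFun_of_mem f h]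
  · intro ℓ hℓ
    rw [if_neg hℓ]
  · intro ξ h
    rw [X.extendFun_of_notMem f h]
    simp

lemma memℓp_extendFun (f : X.L2) : Memℓp (X.extendFun f) 2 := by
  obtain ⟨a, -, h⟩ := X.hasSum_norm_sq_extendFun f
  rw [memℓp_gen_iff (by norm_num)]
  simpa using h.summable

/-- Extension by zero as an operator. -/
def extend : X.L2 →L[ℂ] LatL2 d m :=
  LinearMap.mkContinuous
    { toFun := fun f => (⟨X.extendFun f, X.memℓp_extendFun f⟩ : LatL2 d m)
      map_add' := fun f g => by
        ext ξ : 2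
        change X.extendFun (⇑(f + g)) ξ = X.extendFun f ξ + X.extendFun g ξ
        by_cases h : X.lat ξ ∈ X.sites
        · simp only [X.extendFun_of_mem _ h]; rfl
        · simp only [X.extendFun_of_notMem _ h, add_zero]
      map_smul' := fun c f => by
        ext ξ : 2
        change X.extendFun (⇑(c • f)) ξ = c • X.extendFun f ξ
        by_cases h : X.lat ξ ∈ X.sites
        · simp only [X.extendFun_of_mem _ h]; rfl
        · simp only [X.extendFun_of_notMem _ h, smul_zero] }
    1 fun f => by
      obtain ⟨a, ha, h⟩ := X.hasSum_norm_sq_extendFun f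
      rw [one_mul]
      refine abs_le_of_sq_le_sq' ?_ (norm_nonneg _) |>.2
      have h1 := lp.norm_rpow_eq_tsum (p := 2) (by norm_num)
        (⟨X.extendFun f, X.memℓp_extendFun f⟩ : LatL2 d m)
      simp only [ENNReal.toReal_ofNat, Real.rpow_two] at h1
      refine le_trans (le_of_eq ?_) ha
      rw [← h.tsum_eq]
      exact h1

lemma extend_apply (f : X.L2) (ξ : Fin d → ℤ) : X.extend f ξ = X.extendFun f ξ := rfl

lemma norm_extend_le (f : X.L2) : ‖X.extend f‖ ≤ ‖f‖ := by
  have h := (X.extend).le_of_opNorm_le (LinearMap.mkContinuous_norm_le _ zero_le_one _) f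
  rwa [one_mul] at h

/-- Restriction from `ℤ^d` to the sites, the adjoint of the extension by zero. -/
def restrict : LatL2 d m →L[ℂ] X.L2 := ContinuousLinearMap.adjoint X.extend

lemma inner_restrict_left (k : LatL2 d m) (f : X.L2) :
    inner ℂ (X.restrict k) f = inner ℂ k (X.extend f) :=
  ContinuousLinearMap.adjoint_inner_left _ _ _

open Classical in
/-- The standard basis of `ℓ²(Λ; ℂ^m)`. -/
def siteBasis (ℓ : X.sites) (i : Fin m) : X.L2 := lp.single 2 ℓ (EuclideanSpace.single i 1)

lemma inner_siteBasis (ℓ : X.sites) (i : Fin m) (f : X.L2) :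
    inner ℂ (X.siteBasis ℓ i) f = f ℓ i := by
  classical
  rw [siteBasis]
  have h := lp.inner_single_left (𝕜 := ℂ) ℓ (EuclideanSpace.single i (1 : ℂ) : CDisp m) f
  convert h using 1
  rw [EuclideanSpace.inner_single_left]
  simp

lemma siteBasis_apply_self (ℓ : X.sites) (i : Fin m) :
    X.siteBasis ℓ i ℓ = EuclideanSpace.single i 1 := by
  classical
  exact lp.single_apply_self 2 ℓ _

lemma siteBasis_apply_ne {ℓ n : X.sites} (h : n ≠ ℓ) (i : Fin m) :
    X.siteBasis ℓ i n = 0 := by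
  classical
  exact lp.single_apply_ne 2 ℓ _ h

lemma norm_siteBasis (ℓ : X.sites) (i : Fin m) : ‖X.siteBasis ℓ i‖ = 1 := by
  have h := X.inner_siteBasis ℓ i (X.siteBasis ℓ i)
  rw [siteBasis_apply_self, inner_self_eq_norm_sq_to_K] at h
  have h2 : ‖X.siteBasis ℓ i‖ ^ 2 = 1 := by
    have h3 : ((‖X.siteBasis ℓ i‖ ^ 2 : ℝ) : ℂ) = ((1 : ℝ) : ℂ) := by
      push_cast
      simpa using h
    exact_mod_cast h3
  exact (pow_eq_one_iff_of_nonneg (norm_nonneg _) two_ne_zero).1 h2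

open Classical in
lemma extend_siteBasis_of_mem {ℓ : X.sites} (h : ℓ.1 ∈ bravais X.A) (i : Fin m) :
    X.extend (X.siteBasis ℓ i) = lp.single 2 (X.pos ℓ) (EuclideanSpace.single i 1) := by
  ext ξ : 2
  rw [extend_apply]
  by_cases hξ : ξ = X.pos ℓ
  · subst hξ
    have h1 : X.lat (X.pos ℓ) = ℓ.1 := by rw [X.pos_of_mem h, X.lat_coord h]
    have h2 : X.lat (X.pos ℓ) ∈ X.sites := h1 ▸ ℓ.2
    rw [X.extendFun_of_mem _ h2]
    have h3 : (⟨X.lat (X.pos ℓ), h2⟩ : X.sites) = ℓ := Subtype.ext h1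
    rw [h3, siteBasis_apply_self]
    exact (lp.single_apply_self (E := fun _ : Fin d → ℤ => CDisp m) 2 (X.pos ℓ)
      (EuclideanSpace.single i (1 : ℂ))).symm
  · refine Eq.trans ?_ (lp.single_apply_ne (E := fun _ : Fin d → ℤ => CDisp m) 2 (X.pos ℓ)
      (EuclideanSpace.single i (1 : ℂ)) hξ).symm
    by_cases h2 : X.lat ξ ∈ X.sites
    · rw [X.extendFun_of_mem _ h2, siteBasis_apply_ne]
      intro h3
      apply hξ
      rw [← h3, X.pos_lat h2]
    · exact X.extendFun_of_notMem _ h2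

lemma extend_siteBasis_of_notMem {ℓ : X.sites} (h : ℓ.1 ∉ bravais X.A) (i : Fin m) :
    X.extend (X.siteBasis ℓ i) = 0 := by
  ext ξ : 2
  rw [extend_apply]
  by_cases h2 : X.lat ξ ∈ X.sites
  · rw [X.extendFun_of_mem _ h2, siteBasis_apply_ne]
    · rfl
    · intro h3
      apply h
      rw [← h3]
      exact X.lat_mem ξ
  · exact X.extendFun_of_notMem _ h2

lemma restrict_apply_of_mem {ℓ : X.sites} (h : ℓ.1 ∈ bravais X.A) (k : LatL2 d m) :
    X.restrict k ℓ = k (X.pos ℓ) := by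
  classical
  ext i
  rw [← inner_siteBasis, restrict, ContinuousLinearMap.adjoint_inner_right,
    X.extend_siteBasis_of_mem h]
  have h := lp.inner_single_left (𝕜 := ℂ) (X.pos ℓ) (EuclideanSpace.single i (1 : ℂ) : CDisp m) k
  convert h using 1
  rw [EuclideanSpace.inner_single_left]
  simp

lemma restrict_apply_of_notMem {ℓ : X.sites} (h : ℓ.1 ∉ bravais X.A) (k : LatL2 d m) :
    X.restrict k ℓ = 0 := by
  ext i
  rw [← inner_siteBasis, restrict, ContinuousLinearMap.adjoint_inner_right,
    X.extend_siteBasis_of_notMem h, inner_zero_left]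
  rfl

lemma truncate_apply {I E : Type*} [NormedAddCommGroup E] [InnerProductSpace ℂ E] (s : Finset I)
    (f : lp (fun _ : I => E) 2) (n : I) [Decidable (n ∈ s)] :
    truncate s f n = if n ∈ s then f n else 0 := by
  classical
  rw [truncate, lp.coeFn_sum, Finset.sum_apply]
  split_ifs with h
  · rw [Finset.sum_eq_single n]
    · exact lp.single_apply_self 2 n _
    · intro k _ hk
      exact lp.single_apply_ne 2 k _ hk.symm
    · exact fun h' => absurd h h'
  · refine Finset.sum_eq_zero fun k hk => lp.single_apply_ne 2 k _ ?_
    rintro rfl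
    exact h hk

lemma extend_restrict (k : LatL2 d m) :
    X.extend (X.restrict k) = k - truncate X.vacancies k := by
  classical
  ext ξ : 2
  change X.extendFun (X.restrict k) ξ = k ξ - truncate X.vacancies k ξ
  rw [truncate_apply]
  by_cases h : X.lat ξ ∈ X.sites
  · rw [X.extendFun_of_mem _ h, X.restrict_apply_of_mem (ℓ := ⟨X.lat ξ, h⟩) (X.lat_mem ξ),
      X.pos_lat h, if_neg (by simpa [mem_vacancies] using h), sub_zero]
  · rw [X.extendFun_of_notMem _ h, if_pos (by simpa [mem_vacancies] using h), sub_self]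

/-- The inner product of restricted vectors. -/
lemma inner_restrict_restrict (k k' : LatL2 d m) :
    inner ℂ (X.restrict k) (X.restrict k') =
      inner ℂ k k' - ∑ ξ ∈ X.vacancies, inner ℂ (k ξ) (k' ξ) := by
  rw [inner_restrict_left, extend_restrict, inner_sub_right, inner_truncate_right]

/-- The inner product splits into a lattice part and an interstitial part. -/
lemma inner_eq_extend_add (g f : X.L2) :
    inner ℂ g f = inner ℂ (X.extend g) (X.extend f) +
      ∑ ℓ ∈ X.interstitials, inner ℂ (g ℓ) (f ℓ) := by
  classical
  have h1 : HasSum (fun ℓ : X.sites => if ℓ.1 ∈ bravais X.A then inner ℂ (g ℓ) (f ℓ) else 0)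
      (inner ℂ (X.extend g) (X.extend f)) := by
    refine (X.hasSum_sites_iff ?_ ?_ ?_).2 (lp.hasSum_inner (X.extend g) (X.extend f))
    · intro ξ h
      rw [if_pos (X.lat_mem ξ), extend_apply, extend_apply, X.extendFun_of_mem _ h,
        X.extendFun_of_mem _ h]
    · intro ℓ h
      rw [if_neg h]
    · intro ξ h
      rw [extend_apply, X.extendFun_of_notMem _ h, inner_zero_left]
  have h2 : HasSum (fun ℓ : X.sites => if ℓ.1 ∈ bravais X.A then 0 else inner ℂ (g ℓ) (f ℓ))
      (∑ ℓ ∈ X.interstitials, inner ℂ (g ℓ) (f ℓ)) := by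
    have h3 : ∑ ℓ ∈ X.interstitials, inner ℂ (g ℓ) (f ℓ) = ∑ ℓ ∈ X.interstitials,
        if ℓ.1 ∈ bravais X.A then 0 else inner ℂ (g ℓ) (f ℓ) :=
      Finset.sum_congr rfl fun ℓ hℓ => by rw [if_neg (X.mem_interstitials.1 hℓ)]
    rw [h3]
    refine hasSum_sum_of_ne_finset_zero fun ℓ hℓ => ?_
    rw [if_pos]
    simpa [mem_interstitials] using hℓ
  refine (lp.hasSum_inner g f).unique ((h1.add h2).congr_fun fun ℓ => ?_)
  by_cases h : ℓ.1 ∈ bravais X.A <;> simp [h]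

end DefectCrystal

namespace DefectCrystal
variable {d m : ℕ} {X : DefectCrystal d m}

/-! ### The operator `𝐅` in terms of vectors -/

open Classical in
variable (X) in
/-- The vector representing `f ↦ (𝐅f(ℓ))_i`. -/
def obs (ℓ : X.sites) (i : Fin m) : X.L2 :=
  if ℓ.1 ∈ bravais X.A then X.restrict (X.diffKernel 0 (X.coord ℓ.1) i) else X.siteBasis ℓ i

lemma obs_of_mem {ℓ : X.sites} (h : ℓ.1 ∈ bravais X.A) (i : Fin m) :
    X.obs ℓ i = X.restrict (X.diffKernel 0 (X.coord ℓ.1) i) := if_pos h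

lemma obs_of_notMem {ℓ : X.sites} (h : ℓ.1 ∉ bravais X.A) (i : Fin m) :
    X.obs ℓ i = X.siteBasis ℓ i := if_neg h

/-- Subtracting F(-n) turns each row of 𝐅 into a difference of kernels based at the origin. Such
differences are square summable, so the rows are vectors of ℓ². -/
lemma opF_apply (hd : 2 ≤ d) (hX : X.LatticeStable) (f : X.L2) (ℓ : X.sites) (i : Fin m) :
    X.opF f ℓ i = inner ℂ (X.obs ℓ i) f := by
  classical
  by_cases h : ℓ.1 ∈ bravais X.A
  · have hcoord : ∀ i, HasSum (fun n : X.sites => (if n.1 ∈ bravais X.A then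
        ((X.kernel (ℓ.1 - n.1) - X.kernel (-n.1)) *ᵥ (f n).ofLp) else 0) i)
        (inner ℂ (X.obs ℓ i) f) := by
      intro i
      have h1 : HasSum (fun n => inner ℂ (X.obs ℓ i n) (f n)) (inner ℂ (X.obs ℓ i) f) :=
        lp.hasSum_inner _ _
      refine h1.congr_fun fun n => ?_
      by_cases hn : n.1 ∈ bravais X.A
      · rw [if_pos hn, obs_of_mem h, X.restrict_apply_of_mem hn, diffKernel_apply hd hX,
          PiLp.inner_apply]
        simp only [Matrix.mulVec, dotProduct, Matrix.sub_apply]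
        refine Finset.sum_congr rfl fun j _ => ?_
        have h2 : X.lat (0 - X.pos n + X.coord ℓ.1) = ℓ.1 - n.1 := by
          rw [lat_add, lat_sub, lat_zero, X.pos_of_mem hn, X.lat_coord h, X.lat_coord hn]; abel
        have h3 : X.lat (0 - X.pos n) = -n.1 := by
          rw [lat_sub, lat_zero, X.pos_of_mem hn, X.lat_coord hn, zero_sub]
        simp only [RCLike.inner_apply, diffKernelFun, RCLike.conj_conj, kernelDiff, h2, h3]
        ring
      · rw [if_neg hn, obs_of_mem h, X.restrict_apply_of_notMem hn, inner_zero_left]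
        rfl
    have h2 := (Pi.hasSum.2 hcoord).mapL
      (PiLp.continuousLinearEquiv 2 ℂ (fun _ : Fin m => ℂ)).symm.toContinuousLinearMap
    have h3 : X.opF f ℓ = WithLp.toLp 2 fun i => inner ℂ (X.obs ℓ i) f := by
      rw [opF, if_pos h]
      refine HasSum.tsum_eq (h2.congr_fun fun n => ?_)
      by_cases hn : n.1 ∈ bravais X.A
      · rw [if_pos hn, if_pos hn]; rfl
      · rw [if_neg hn, if_neg hn]; rfl
    rw [h3]
  · rw [opF, if_neg h, obs_of_notMem h, inner_siteBasis]

variable (X) in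
/-- The vector representing `f ↦ (D_ρ 𝐅f(ℓ))_i`. -/
def bondVec (ℓ : X.sites) (ρ : X.siteStencil ℓ) (i : Fin m) : X.L2 :=
  X.obs ⟨ℓ.1 + ρ.1, X.siteStencil_mem ℓ ρ.1 ρ.2⟩ i - X.obs ℓ i

lemma D_opF_apply (hd : 2 ≤ d) (hX : X.LatticeStable) (f : X.L2) (ℓ : X.sites)
    (ρ : X.siteStencil ℓ) (i : Fin m) :
    X.D (X.opF f) ℓ ρ i = inner ℂ (X.bondVec ℓ ρ i) f := by
  rw [D, PiLp.sub_apply, opF_apply hd hX, opF_apply hd hX, bondVec, inner_sub_left]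

/-- The normalization at the origin cancels in differences of 𝐅f. -/
lemma diffKernel_sub (hd : 2 ≤ d) (hX : X.LatticeStable) (ξ r : Fin d → ℤ) (i : Fin m) :
    X.diffKernel 0 (ξ + r) i - X.diffKernel 0 ξ i = X.diffKernel ξ r i := by
  ext n j
  change (X.diffKernel 0 (ξ + r) i n - X.diffKernel 0 ξ i n) j = X.diffKernel ξ r i n j
  simp only [diffKernel_apply hd hX, diffKernelFun, PiLp.sub_apply, ← map_sub, kernelDiff]
  rw [show 0 - n + (ξ + r) = ξ - n + r by abel, show 0 - n + ξ = ξ - n by abel]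
  congr 1
  ring

variable (X) in
/-- The vector representing differences of `𝐅f` at a lattice point. -/
def latVec (ξ r : Fin d → ℤ) (i : Fin m) : X.L2 := X.restrict (X.diffKernel ξ r i)

lemma bondVec_eq_latVec (hd : 2 ≤ d) (hX : X.LatticeStable) {ℓ : X.sites}
    (h : ℓ.1 ∈ bravais X.A) (ρ : X.siteStencil ℓ) (hρ : ρ.1 ∈ bravais X.A) (i : Fin m) :
    X.bondVec ℓ ρ i = X.latVec (X.coord ℓ.1) (X.coord ρ.1) i := by
  rw [bondVec, obs_of_mem h,
    obs_of_mem (ℓ := ⟨ℓ.1 + ρ.1, X.siteStencil_mem ℓ ρ.1 ρ.2⟩) (X.bravais_add h hρ),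
    X.coord_add h hρ, latVec,
    ← diffKernel_sub hd hX (X.coord ℓ.1) (X.coord ρ.1), map_sub]

/-! ### Localized vectors -/

variable (X) in
/-- The elementary vectors with centre `q` and shifts in `R`. -/
def basicVectors (R : Finset (Fin d → ℤ)) (q : Fin d → ℤ) : Set X.L2 :=
  {φ | (∃ r ∈ R, ∃ i, φ = X.latVec q r i) ∨
    (∃ ℓ : X.sites, ℓ.1 ∉ bravais X.A ∧ ∃ i, q = 0 ∧ φ = X.siteBasis ℓ i) ∨ φ = 0}

variable (X) in
/-- Differences of elementary vectors with centre `q`. -/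
def localVectors (R : Finset (Fin d → ℤ)) (q : Fin d → ℤ) : Set X.L2 :=
  {φ | ∃ a ∈ X.basicVectors R q, ∃ b ∈ X.basicVectors R q, φ = a - b}

lemma basic_mem_localVectors {R : Finset (Fin d → ℤ)} {q : Fin d → ℤ} {φ : X.L2}
    (h : φ ∈ X.basicVectors R q) : φ ∈ X.localVectors R q :=
  ⟨φ, h, 0, Or.inr (Or.inr rfl), (sub_zero φ).symm⟩

lemma decay_le_one (x y : Fin d → ℤ) : decay x y ≤ 1 :=
  inv_le_one_of_one_le₀ (one_le_pow₀ (by simp))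

/-- One constant for finitely many shifts; having it at least 1 makes it serve for basis vectors at
interstitials too. -/
lemma exists_norm_diffKernel_apply_le' (hd : 2 ≤ d) (hX : X.LatticeStable)
    (R : Finset (Fin d → ℤ)) : ∃ C : ℝ, 1 ≤ C ∧ ∀ r ∈ R, ∀ ξ i n,
      ‖X.diffKernel ξ r i n‖ ≤ C * decay ξ n := by
  choose C hC h using fun r => exists_norm_diffKernel_apply_le hd hX r
  refine ⟨1 + ∑ r ∈ R, C r, ?_, fun r hr ξ i n => (h r ξ i n).trans ?_⟩
  · have := Finset.sum_nonneg fun r (_ : r ∈ R) => hC r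
    linarith
  · have := Finset.single_le_sum (N := ℝ) (f := C) (fun r _ => hC r) hr
    have := decay_nonneg ξ n
    change C r * decay ξ n ≤ _
    gcongr
    linarith

lemma exists_norm_inner_diffKernel_le' (hd : 2 ≤ d) (hX : X.LatticeStable)
    (R : Finset (Fin d → ℤ)) : ∃ C : ℝ, 0 ≤ C ∧ ∀ r ∈ R, ∀ r' ∈ R, ∀ ξ η i j,
      ‖inner ℂ (X.diffKernel ξ r i) (X.diffKernel η r' j)‖ ≤ C * decay ξ η := by
  choose C hC h using fun r r' => exists_norm_inner_diffKernel_le hd hX r r'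
  refine ⟨∑ r ∈ R, ∑ r' ∈ R, C r r', Finset.sum_nonneg fun r _ => Finset.sum_nonneg fun r' _ =>
    hC r r', fun r hr r' hr' ξ η i j => (h r r' ξ η i j).trans ?_⟩
  have h1 := Finset.single_le_sum (N := ℝ) (f := fun r' => C r r') (fun r' _ => hC r r') hr'
  have h2 := Finset.single_le_sum (N := ℝ) (f := fun r => ∑ r' ∈ R, C r r')
    (fun r _ => Finset.sum_nonneg fun r' _ => hC r r') hr
  have := decay_nonneg ξ η
  change C r r' * decay ξ η ≤ _
  gcongr
  exact h1.trans h2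

lemma exists_norm_inner_basic_siteBasis_le (hd : 2 ≤ d) (hX : X.LatticeStable)
    (R : Finset (Fin d → ℤ)) : ∃ C : ℝ, 0 ≤ C ∧ ∀ q, ∀ φ ∈ X.basicVectors R q, ∀ n i,
      ‖inner ℂ φ (X.siteBasis n i)‖ ≤ C * decay q (X.pos n) := by
  classical
  obtain ⟨C, hC, h⟩ := exists_norm_diffKernel_apply_le' hd hX R
  refine ⟨C, by linarith, fun q φ hφ n i => ?_⟩
  have hdec := decay_nonneg q (X.pos n)
  have hnn : 0 ≤ C * decay q (X.pos n) := by positivity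
  rcases hφ with ⟨r, hr, j, rfl⟩ | ⟨ℓ, hℓ, j, rfl, rfl⟩ | rfl
  · rw [latVec, inner_restrict_left]
    by_cases hn : n.1 ∈ bravais X.A
    · rw [X.extend_siteBasis_of_mem hn]
      have h1 := lp.inner_single_right (𝕜 := ℂ) (X.pos n)
        (EuclideanSpace.single i (1 : ℂ) : CDisp m) (X.diffKernel q r j)
      have h2 : ‖inner ℂ (X.diffKernel q r j (X.pos n)) (EuclideanSpace.single i (1 : ℂ))‖ ≤
          C * decay q (X.pos n) := by
        refine (norm_inner_le_norm _ _).trans ?_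
        rw [PiLp.norm_single, norm_one, mul_one]
        exact h r hr _ _ _
      convert h2 using 2
    · rw [X.extend_siteBasis_of_notMem hn, inner_zero_right, norm_zero]
      exact hnn
  · rw [inner_siteBasis]
    by_cases hn : ℓ = n
    · subst hn
      rw [siteBasis_apply_self, X.pos_of_notMem hℓ, decay_self, mul_one]
      refine le_trans ?_ hC
      refine (PiLp.norm_apply_le _ j).trans ?_
      rw [PiLp.norm_single, norm_one]
    · rw [X.siteBasis_apply_ne hn]
      simpa using hnn
  · rw [inner_zero_left, norm_zero]
    exact hnn

/-- Restriction to the sites alters lattice inner products only by the finitely many vacancy terms.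
Each of these is a product of two weights through the vacancy, hence again of critical decay in the
distance of the centres. -/
lemma exists_norm_inner_basic_le (hd : 2 ≤ d) (hX : X.LatticeStable)
    (R : Finset (Fin d → ℤ)) : ∃ C : ℝ, 0 ≤ C ∧ ∀ q q', ∀ φ ∈ X.basicVectors R q,
      ∀ φ' ∈ X.basicVectors R q', ‖inner ℂ φ φ'‖ ≤ C * decay q q' := by
  obtain ⟨C₁, hC₁, h₁⟩ := exists_norm_diffKernel_apply_le' hd hX R
  obtain ⟨C₂, hC₂, h₂⟩ := exists_norm_inner_diffKernel_le' hd hX R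
  obtain ⟨C₃, hC₃, h₃⟩ := exists_norm_inner_basic_siteBasis_le hd hX R
  refine ⟨C₃ + (C₂ + X.vacancies.card * (C₁ * C₁ * (2 ^ d * 2))), by positivity,
    fun q q' φ hφ φ' hφ' => ?_⟩
  have hdec := decay_nonneg q q'
  have e1 : 0 ≤ C₃ * decay q q' := by positivity
  have e2 : 0 ≤ (C₂ + X.vacancies.card * (C₁ * C₁ * (2 ^ d * 2))) * decay q q' := by positivity
  have hle : ∀ {t : ℝ}, t ≤ C₃ * decay q q' →
      t ≤ (C₃ + (C₂ + X.vacancies.card * (C₁ * C₁ * (2 ^ d * 2)))) * decay q q' := fun ht => by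
    rw [add_mul]; linarith
  rcases id hφ' with ⟨r', hr', j, rfl⟩ | ⟨ℓ, hℓ, j, rfl, rfl⟩ | rfl
  · rcases hφ with ⟨r, hr, i, rfl⟩ | ⟨ℓ, hℓ, i, rfl, rfl⟩ | rfl
    · rw [latVec, latVec, inner_restrict_restrict]
      have h3 : ‖∑ ξ ∈ X.vacancies, inner ℂ (X.diffKernel q r i ξ) (X.diffKernel q' r' j ξ)‖ ≤
          X.vacancies.card * (C₁ * C₁ * (2 ^ d * 2)) * decay q q' := by
        refine (norm_sum_le _ _).trans ?_
        have : ∀ ξ ∈ X.vacancies, ‖inner ℂ (X.diffKernel q r i ξ) (X.diffKernel q' r' j ξ)‖ ≤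
            C₁ * C₁ * (2 ^ d * 2) * decay q q' := by
          intro ξ _
          refine (norm_inner_le_norm _ _).trans ?_
          have d1 := decay_nonneg q ξ
          have d2 := decay_nonneg q' ξ
          calc _ ≤ (C₁ * decay q ξ) * (C₁ * decay q' ξ) :=
                mul_le_mul (h₁ r hr _ _ _) (h₁ r' hr' _ _ _) (norm_nonneg _) (by positivity)
            _ = C₁ * C₁ * (decay q ξ * decay ξ q') := by rw [decay_comm q' ξ]; ring
            _ ≤ C₁ * C₁ * (2 ^ d * (decay q q' * (1 + 1))) := by
                refine mul_le_mul_of_nonneg_left ?_ (by positivity)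
                refine (decay_mul_decay_le q ξ q').trans ?_
                gcongr <;> exact decay_le_one _ _
            _ = _ := by ring
        refine (Finset.sum_le_card_nsmul _ _ _ this).trans_eq ?_
        rw [nsmul_eq_mul]; ring
      have h4 := norm_sub_le (inner ℂ (X.diffKernel q r i) (X.diffKernel q' r' j))
        (∑ ξ ∈ X.vacancies, inner ℂ (X.diffKernel q r i ξ) (X.diffKernel q' r' j ξ))
      have h5 := h₂ r hr r' hr' q q' i j
      refine h4.trans ((add_le_add h5 h3).trans ?_)
      rw [add_mul, add_mul]
      linarith
    · have h3 := h₃ q' _ hφ' ℓ i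
      rw [X.pos_of_notMem hℓ, decay_comm, norm_inner_symm] at h3
      exact hle h3
    · rw [inner_zero_left, norm_zero]
      exact hle e1
  · have h3 := h₃ q _ hφ ℓ j
    rw [X.pos_of_notMem hℓ] at h3
    exact hle h3
  · rw [inner_zero_right, norm_zero]
    exact hle e1

lemma exists_norm_inner_local_siteBasis_le (hd : 2 ≤ d) (hX : X.LatticeStable)
    (R : Finset (Fin d → ℤ)) : ∃ C : ℝ, 0 ≤ C ∧ ∀ q, ∀ φ ∈ X.localVectors R q, ∀ n i,
      ‖inner ℂ φ (X.siteBasis n i)‖ ≤ C * decay q (X.pos n) := by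
  obtain ⟨C, hC, h⟩ := exists_norm_inner_basic_siteBasis_le hd hX R
  refine ⟨C + C, by positivity, fun q φ hφ n i => ?_⟩
  obtain ⟨a, ha, b, hb, rfl⟩ := hφ
  rw [inner_sub_left, add_mul]
  exact (norm_sub_le _ _).trans (add_le_add (h q a ha n i) (h q b hb n i))

lemma exists_norm_inner_local_le (hd : 2 ≤ d) (hX : X.LatticeStable)
    (R : Finset (Fin d → ℤ)) : ∃ C : ℝ, 0 ≤ C ∧ ∀ q q', ∀ φ ∈ X.localVectors R q,
      ∀ φ' ∈ X.localVectors R q', ‖inner ℂ φ φ'‖ ≤ C * decay q q' := by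
  obtain ⟨C, hC, h⟩ := exists_norm_inner_basic_le hd hX R
  refine ⟨C + C + (C + C), by positivity, fun q q' φ hφ φ' hφ' => ?_⟩
  obtain ⟨a, ha, b, hb, rfl⟩ := hφ
  obtain ⟨a', ha', b', hb', rfl⟩ := hφ'
  rw [inner_sub_left, inner_sub_right, inner_sub_right, add_mul, add_mul]
  refine (norm_sub_le _ _).trans (add_le_add ?_ ?_)
  · exact (norm_sub_le _ _).trans (add_le_add (h _ _ _ ha _ ha') (h _ _ _ ha _ hb'))
  · exact (norm_sub_le _ _).trans (add_le_add (h _ _ _ hb _ ha') (h _ _ _ hb _ hb'))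

/-- The bond vectors of one direction form a Bessel family. -/
lemma exists_isBessel_latVec (hd : 2 ≤ d) (hX : X.LatticeStable) (r : Fin d → ℤ) :
    ∃ C : ℝ, 0 ≤ C ∧ ∀ i, IsBessel (fun ξ => X.latVec ξ r i) C := by
  obtain ⟨C, hC, h⟩ := exists_isBessel_diffKernel hd hX r
  refine ⟨C, hC, fun i f s => ?_⟩
  simp only [latVec, inner_restrict_left]
  refine (h i (X.extend f) s).trans ?_
  gcongr
  exact X.norm_extend_le f

end DefectCrystal

/-! ### Second derivatives of site potentials -/

/-- Index set of the second partial derivatives of a site potential. -/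
abbrev BondPair {d : ℕ} (R : Finset (Space d)) (m : ℕ) : Type := R × Fin m × R × Fin m

section SecondDerivatives
variable {d m : ℕ} {R : Finset (Space d)} {V : (R → Disp m) → ℝ}

/-- The second partial derivative with the index `q`. -/
def hessEntry (V : (R → Disp m) → ℝ) (g : R → Disp m) (q : BondPair R m) : ℝ :=
  partial₂ V g q.1 q.2.1 q.2.2.1 q.2.2.2

lemma contDiff_hessEntry (hV : ContDiff ℝ 3 V) (q : BondPair R m) :
    ContDiff ℝ 1 fun g => hessEntry V g q := by
  have h : ContDiff ℝ 1 (fderiv ℝ (fderiv ℝ V)) :=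
    (hV.fderiv_right (m := 2) (by norm_num)).fderiv_right (m := 1) (by norm_num)
  exact (h.clm_apply contDiff_const).clm_apply contDiff_const

lemma partial₂_comm (hV : ContDiff ℝ 3 V) (g : R → Disp m) (ρ : R) (i : Fin m) (σ : R)
    (j : Fin m) : partial₂ V g ρ i σ j = partial₂ V g σ j ρ i :=
  (hV.contDiffAt.isSymmSndFDerivAt (by simp; norm_num)) _ _

/-- Bounds of the second derivatives and their derivatives on bounded sets. -/
lemma exists_hessEntry_bound (hV : ContDiff ℝ 3 V) (M : ℝ) :
    ∃ L : ℝ, 0 ≤ L ∧ ∀ (g : R → Disp m), ‖g‖ ≤ M → ∀ q,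
      ‖fderiv ℝ (fun g => hessEntry V g q) g‖ ≤ L ∧ |hessEntry V g q| ≤ L ∧
        |hessEntry V g q - hessEntry V 0 q| ≤ L * ‖g‖ := by
  have hcomp : IsCompact (Metric.closedBall (0 : R → Disp m) M) := isCompact_closedBall _ _
  have h1 : ∀ q : BondPair R m, ∃ L : ℝ, ∀ g ∈ Metric.closedBall (0 : R → Disp m) M,
      ‖fderiv ℝ (fun g => hessEntry V g q) g‖ ≤ L := fun q =>
    hcomp.exists_bound_of_continuousOn
      ((contDiff_hessEntry hV q).continuous_fderiv (by norm_num)).continuousOn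
  have h2 : ∀ q : BondPair R m, ∃ L : ℝ, ∀ g ∈ Metric.closedBall (0 : R → Disp m) M,
      ‖hessEntry V g q‖ ≤ L := fun q =>
    hcomp.exists_bound_of_continuousOn (contDiff_hessEntry hV q).continuous.continuousOn
  choose L₁ hL₁ using h1
  choose L₂ hL₂ using h2
  set L := ∑ q : BondPair R m, (|L₁ q| + |L₂ q|) with hL
  have hsingle : ∀ q : BondPair R m, |L₁ q| + |L₂ q| ≤ L := fun q =>
    Finset.single_le_sum (N := ℝ) (s := (Finset.univ : Finset (BondPair R m)))
      (f := fun q => |L₁ q| + |L₂ q|) (fun q _ => by positivity) (Finset.mem_univ q)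
  have hfd : ∀ q, ∀ g ∈ Metric.closedBall (0 : R → Disp m) M,
      ‖fderiv ℝ (fun g => hessEntry V g q) g‖ ≤ L := fun q g hg => by
    have := hL₁ q g hg
    have := hsingle q
    have := le_abs_self (L₁ q)
    have := abs_nonneg (L₂ q)
    linarith
  refine ⟨L, Finset.sum_nonneg fun q _ => by positivity, fun g hg q => ?_⟩
  have hg' : g ∈ Metric.closedBall (0 : R → Disp m) M := by simpa using hg
  refine ⟨hfd q g hg', ?_, ?_⟩
  · have := hL₂ q g hg'
    rw [Real.norm_eq_abs] at this
    have := hsingle q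
    have := le_abs_self (L₂ q)
    have := abs_nonneg (L₁ q)
    linarith
  · have h0 : (0 : R → Disp m) ∈ Metric.closedBall (0 : R → Disp m) M :=
      Metric.mem_closedBall_self ((norm_nonneg g).trans hg)
    have h3 := (convex_closedBall (0 : R → Disp m) M).norm_image_sub_le_of_norm_fderiv_le
      (𝕜 := ℝ) (f := fun g => hessEntry V g q)
      (fun x _ => (contDiff_hessEntry hV q).differentiable (by norm_num) x) (hfd q) h0 hg'
    rwa [sub_zero, Real.norm_eq_abs] at h3

end SecondDerivatives

/-! ### Hessian coefficients away from the core -/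

namespace DefectCrystal
variable {d m : ℕ} {X : DefectCrystal d m}

/-- Outside the core, a site has the homogeneous stencil and potential. -/
lemma far_induction {ℓ : X.sites} (h : X.coreRadius ≤ ‖ℓ.1‖)
    (P : ∀ R : Finset (Space d), ((R → Disp m) → ℝ) → (∀ ρ ∈ R, ℓ.1 + ρ ∈ X.sites) → Prop)
    (hP : ∀ hmem, P X.stencil X.pot hmem) :
    P (X.siteStencil ℓ) (X.sitePot ℓ) (X.siteStencil_mem ℓ) := by
  obtain ⟨h1, h2⟩ := X.homogeneous ℓ h
  -- The stencil occurs in types, so the membership proof and the potential are generalized with it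
  -- before the equality of stencils can be substituted.
  generalize X.siteStencil_mem ℓ = hm
  generalize X.sitePot ℓ = V at h2
  generalize X.siteStencil ℓ = R at *
  subst h1
  have : V = X.pot := funext h2
  rw [this]
  exact hP _

open Classical in
variable (X) in
/-- Extension by zero to all of space. -/
def siteExt {Y : Type*} [Zero Y] (u : X.sites → Y) (x : Space d) : Y :=
  if h : x ∈ X.sites then u ⟨x, h⟩ else 0

lemma siteExt_of_mem {Y : Type*} [Zero Y] (u : X.sites → Y) {x : Space d} (h : x ∈ X.sites) :
    X.siteExt u x = u ⟨x, h⟩ := dif_pos h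

variable (X) in
/-- The displacement stencil at a lattice point. -/
def latD (u : X.sites → Disp m) (ξ : Fin d → ℤ) (ρ : X.stencil) : Disp m :=
  X.siteExt u (X.lat ξ + ρ.1) - X.siteExt u (X.lat ξ)

lemma lat_mem_sites {ξ : Fin d → ℤ} (h : X.coreRadius ≤ ‖X.lat ξ‖) : X.lat ξ ∈ X.sites :=
  (X.mem_sites_iff h).2 (X.lat_mem ξ)

lemma energy_far {u : X.sites → Disp m} {ξ : Fin d → ℤ} (h : X.coreRadius ≤ ‖X.lat ξ‖) :
    ∑ ρ, ‖X.D u ⟨X.lat ξ, lat_mem_sites h⟩ ρ‖ ^ 2 = ∑ ρ, ‖X.latD u ξ ρ‖ ^ 2 := by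
  refine far_induction (ℓ := ⟨X.lat ξ, lat_mem_sites h⟩) h (fun R V hm =>
    ∑ ρ : R, ‖u ⟨X.lat ξ + ρ.1, hm ρ.1 ρ.2⟩ - u ⟨X.lat ξ, lat_mem_sites h⟩‖ ^ 2 =
      ∑ ρ, ‖X.latD u ξ ρ‖ ^ 2) fun hm => ?_
  refine Finset.sum_congr rfl fun ρ _ => ?_
  rw [latD, siteExt_of_mem u (hm ρ.1 ρ.2), siteExt_of_mem u (lat_mem_sites h)]

variable (X) in
/-- The energy density at lattice points outside the core. -/
def farEnergy (u : X.sites → Disp m) (ξ : Fin d → ℤ) : ℝ :=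
  if X.coreRadius ≤ ‖X.lat ξ‖ then ∑ ρ, ‖X.latD u ξ ρ‖ ^ 2 else 0

lemma farEnergy_nonneg (u : X.sites → Disp m) (ξ : Fin d → ℤ) : 0 ≤ X.farEnergy u ξ := by
  unfold farEnergy
  split_ifs
  · exact Finset.sum_nonneg fun _ _ => sq_nonneg _
  · exact le_rfl

lemma summable_farEnergy {u : X.sites → Disp m} (hu : u ∈ X.energySpace) :
    Summable (X.farEnergy u) := by
  classical
  have h1 : Summable fun ℓ : X.sites =>
      if X.coreRadius ≤ ‖ℓ.1‖ then ∑ ρ, ‖X.D u ℓ ρ‖ ^ 2 else 0 := by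
    refine Summable.of_nonneg_of_le (fun ℓ => ?_) (fun ℓ => ?_) hu
    · split_ifs
      · exact Finset.sum_nonneg fun _ _ => sq_nonneg _
      · exact le_rfl
    · split_ifs
      · exact le_rfl
      · exact Finset.sum_nonneg fun _ _ => sq_nonneg _
  refine ((X.hasSum_sites_iff (fun ξ h => ?_) (fun ℓ hℓ => ?_) fun ξ h => ?_).1 h1.hasSum).summable
  · unfold farEnergy
    split_ifs with hf
    · exact energy_far hf
    · rfl
  · rw [if_neg]
    exact fun h => hℓ ((X.mem_sites_iff h).1 ℓ.2)
  · rw [farEnergy, if_neg]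
    exact fun hf => h (lat_mem_sites hf)

lemma norm_latD_sq_le {u : X.sites → Disp m} {ξ : Fin d → ℤ}
    (hf : X.coreRadius ≤ ‖X.lat ξ‖) : ‖X.latD u ξ‖ ^ 2 ≤ X.farEnergy u ξ := by
  rw [farEnergy, if_pos hf]
  have h : ‖X.latD u ξ‖ ≤ √(∑ ρ, ‖X.latD u ξ ρ‖ ^ 2) := by
    refine (pi_norm_le_iff_of_nonneg (Real.sqrt_nonneg _)).2 fun ρ => ?_
    refine Real.le_sqrt_of_sq_le ?_
    exact Finset.single_le_sum (N := ℝ) (s := Finset.univ) (f := fun ρ => ‖X.latD u ξ ρ‖ ^ 2)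
      (fun _ _ => sq_nonneg _) (Finset.mem_univ ρ)
  calc _ ≤ √(∑ ρ, ‖X.latD u ξ ρ‖ ^ 2) ^ 2 := by gcongr
    _ = _ := Real.sq_sqrt (Finset.sum_nonneg fun _ _ => sq_nonneg _)

lemma exists_norm_latD_le {u : X.sites → Disp m} (hu : u ∈ X.energySpace) :
    ∃ M : ℝ, ∀ ξ, X.coreRadius ≤ ‖X.lat ξ‖ → ‖X.latD u ξ‖ ≤ M := by
  refine ⟨√(∑' ξ, X.farEnergy u ξ), fun ξ hf => Real.le_sqrt_of_sq_le ?_⟩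
  exact (norm_latD_sq_le hf).trans
    ((summable_farEnergy hu).le_tsum ξ fun η _ => farEnergy_nonneg u η)

variable (X) in
/-- The coefficients of the Hessian at lattice points outside the core. -/
def farCoeff (u : X.sites → Disp m) (q : BondPair X.stencil m) (ξ : Fin d → ℤ) : ℝ :=
  if X.coreRadius ≤ ‖X.lat ξ‖ then hessEntry X.pot (X.latD u ξ) q else 0

/-- V is C³, so on the bounded range of Du the mean value theorem bounds the change of its second
derivatives by a multiple of |Du|, and the energy is summable. At core points the coefficient is set
to 0 and the difference is a constant, but there are only finitely many of them. -/
lemma exists_farCoeff_bound {u : X.sites → Disp m} (hu : u ∈ X.energySpace) :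
    ∃ L : ℝ, 0 ≤ L ∧ (∀ q ξ, |X.farCoeff u q ξ| ≤ L) ∧
      ∀ q, Summable fun ξ => (X.farCoeff u q ξ - hessEntry X.pot 0 q) ^ 2 := by
  obtain ⟨M, hM⟩ := exists_norm_latD_le hu
  obtain ⟨L, hL, h⟩ := exists_hessEntry_bound X.pot_contDiff M
  refine ⟨L, hL, fun q ξ => ?_, fun q => ?_⟩
  · unfold farCoeff
    split_ifs with hf
    · exact (h _ (hM ξ hf) q).2.1
    · simpa using hL
  · have hfin : Summable fun ξ => if X.coreRadius ≤ ‖X.lat ξ‖ then 0 else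
        (hessEntry X.pot 0 q) ^ 2 := by
      refine summable_of_hasFiniteSupport (X.finite_lat_core.subset fun ξ hξ => ?_)
      by_contra hf
      exact hξ (if_pos (not_lt.1 hf))
    refine Summable.of_nonneg_of_le (fun _ => sq_nonneg _) (fun ξ => ?_)
      (((summable_farEnergy hu).mul_left (L ^ 2)).add hfin)
    unfold farCoeff
    split_ifs with hf
    · have h1 := (h _ (hM ξ hf) q).2.2
      calc _ = |hessEntry X.pot (X.latD u ξ) q - hessEntry X.pot 0 q| ^ 2 := (sq_abs _).symm
        _ ≤ (L * ‖X.latD u ξ‖) ^ 2 := by gcongr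
        _ = L ^ 2 * ‖X.latD u ξ‖ ^ 2 := by ring
        _ ≤ _ := by
          have := norm_latD_sq_le (u := u) hf
          rw [add_zero]
          gcongr
    · have := farEnergy_nonneg u ξ
      rw [zero_sub, neg_sq]
      have : 0 ≤ L ^ 2 * X.farEnergy u ξ := by positivity
      linarith

/-! ### The Hessian in terms of bond vectors -/

lemma hessianSite_opF (hd : 2 ≤ d) (hX : X.LatticeStable) (u : X.sites → Disp m) (f g : X.L2)
    (ℓ : X.sites) : X.hessianSite u (X.opF g) (X.opF f) ℓ =
      ∑ q : BondPair (X.siteStencil ℓ) m, (hessEntry (X.sitePot ℓ) (X.D u ℓ) q : ℂ) *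
        (inner ℂ g (X.bondVec ℓ q.1 q.2.1) * inner ℂ (X.bondVec ℓ q.2.2.1 q.2.2.2) f) := by
  simp only [hessianSite, D_opF_apply hd hX, inner_conj_symm, Fintype.sum_prod_type, hessEntry]

lemma hessianSite_far (hd : 2 ≤ d) (hX : X.LatticeStable) (u : X.sites → Disp m) (f g : X.L2)
    {ξ : Fin d → ℤ} (hf : X.coreRadius ≤ ‖X.lat ξ‖) :
    X.hessianSite u (X.opF g) (X.opF f) ⟨X.lat ξ, lat_mem_sites hf⟩ =
      ∑ q : BondPair X.stencil m, (X.farCoeff u q ξ : ℂ) *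
        (inner ℂ g (X.latVec ξ (X.coord q.1.1) q.2.1) *
          inner ℂ (X.latVec ξ (X.coord q.2.2.1.1) q.2.2.2) f) := by
  set ℓ : X.sites := ⟨X.lat ξ, lat_mem_sites hf⟩ with hℓ
  have hobs : ∀ (ρ : Space d) (hρ : ρ ∈ bravais X.A) (hm : ℓ.1 + ρ ∈ X.sites) i,
      X.obs ⟨ℓ.1 + ρ, hm⟩ i - X.obs ℓ i = X.latVec ξ (X.coord ρ) i := by
    intro ρ hρ hm i
    rw [obs_of_mem (ℓ := ℓ) (X.lat_mem ξ),
      obs_of_mem (ℓ := ⟨ℓ.1 + ρ, hm⟩) (X.bravais_add (X.lat_mem ξ) hρ),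
      X.coord_add (X.lat_mem ξ) hρ, X.coord_lat, latVec, ← diffKernel_sub hd hX ξ, map_sub]
  rw [hessianSite_opF hd hX]
  simp only [farCoeff, if_pos hf]
  refine far_induction (ℓ := ℓ) hf (fun R V hm =>
    ∑ q : BondPair R m, (hessEntry V (fun ρ => u ⟨ℓ.1 + ρ.1, hm ρ.1 ρ.2⟩ - u ℓ) q : ℂ) *
      (inner ℂ g (X.obs ⟨ℓ.1 + q.1.1, hm q.1.1 q.1.2⟩ q.2.1 - X.obs ℓ q.2.1) *
        inner ℂ (X.obs ⟨ℓ.1 + q.2.2.1.1, hm q.2.2.1.1 q.2.2.1.2⟩ q.2.2.2 -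
          X.obs ℓ q.2.2.2) f) = _) fun hm => ?_
  have hD : (fun ρ : X.stencil => u ⟨ℓ.1 + ρ.1, hm ρ.1 ρ.2⟩ - u ℓ) = X.latD u ξ := by
    funext ρ
    rw [latD, siteExt_of_mem u (hm ρ.1 ρ.2), siteExt_of_mem u (lat_mem_sites hf)]
  rw [hD]
  refine Finset.sum_congr rfl fun q _ => ?_
  rw [hobs _ (X.stencil_subset q.1.2), hobs _ (X.stencil_subset q.2.2.1.2)]

/-- The far part of the Hessian, summed over `ℤ^d`. -/
lemma hasSum_hessian_iff (hd : 2 ≤ d) (hX : X.LatticeStable) (u : X.sites → Disp m) (f g : X.L2)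
    {a : ℂ} : HasSum (X.hessianSite u (X.opF g) (X.opF f))
      (a + ∑ ℓ ∈ X.core, X.hessianSite u (X.opF g) (X.opF f) ℓ) ↔
    HasSum (fun ξ => ∑ q : BondPair X.stencil m, (X.farCoeff u q ξ : ℂ) *
        (inner ℂ g (X.latVec ξ (X.coord q.1.1) q.2.1) *
          inner ℂ (X.latVec ξ (X.coord q.2.2.1.1) q.2.2.2) f)) a := by
  classical
  set F := X.hessianSite u (X.opF g) (X.opF f) with hF
  have hcore : HasSum (fun ℓ => if ℓ ∈ X.core then F ℓ else 0) (∑ ℓ ∈ X.core, F ℓ) := by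
    have h3 : ∑ ℓ ∈ X.core, F ℓ = ∑ ℓ ∈ X.core, if ℓ ∈ X.core then F ℓ else 0 :=
      Finset.sum_congr rfl fun ℓ hℓ => by rw [if_pos hℓ]
    rw [h3]
    exact hasSum_sum_of_ne_finset_zero fun ℓ hℓ => if_neg hℓ
  have h1 : HasSum F (a + ∑ ℓ ∈ X.core, F ℓ) ↔
      HasSum (fun ℓ => if ℓ ∈ X.core then 0 else F ℓ) a := by
    constructor
    · intro h
      have h2 := h.sub hcore
      rw [add_sub_cancel_right] at h2
      refine h2.congr_fun fun ℓ => ?_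
      split_ifs <;> simp
    · intro h
      refine (h.add hcore).congr_fun fun ℓ => ?_
      split_ifs <;> simp
  rw [h1]
  refine X.hasSum_sites_iff (fun ξ h => ?_) (fun ℓ hℓ => ?_) fun ξ h => ?_
  · by_cases hf : X.coreRadius ≤ ‖X.lat ξ‖
    · rw [if_neg (by rw [mem_core]; simpa using hf), ← hessianSite_far hd hX u f g hf]
    · rw [if_pos (by rw [mem_core]; simpa using hf)]
      simp [farCoeff, hf]
  · rw [if_pos (X.mem_core_of_notMem_bravais hℓ)]
  · have hf : ¬X.coreRadius ≤ ‖X.lat ξ‖ := fun hf => h (lat_mem_sites hf)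
    simp [farCoeff, hf]

/-- The rank one operator `|ψ⟩⟨χ|`. -/
def rankOp {H : Type*} [NormedAddCommGroup H] [InnerProductSpace ℂ H] (ψ χ : H) : H →L[ℂ] H :=
  (innerSL ℂ χ).smulRight ψ

lemma inner_rankOp {H : Type*} [NormedAddCommGroup H] [InnerProductSpace ℂ H] (ψ χ f g : H) :
    inner ℂ g (rankOp ψ χ f) = inner ℂ g ψ * inner ℂ χ f := by
  rw [rankOp, ContinuousLinearMap.smulRight_apply, inner_smul_right, innerSL_apply_apply, mul_comm]

lemma exists_operator_latVec (hd : 2 ≤ d) (hX : X.LatticeStable) (q : BondPair X.stencil m)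
    {N : (Fin d → ℤ) → ℂ} {L : ℝ} (hN : ∀ ξ, ‖N ξ‖ ≤ L) : ∃ T : X.L2 →L[ℂ] X.L2, ∀ f g,
      HasSum (fun ξ => N ξ * (inner ℂ g (X.latVec ξ (X.coord q.1.1) q.2.1) *
          inner ℂ (X.latVec ξ (X.coord q.2.2.1.1) q.2.2.2) f)) (inner ℂ g (T f)) := by
  obtain ⟨C, -, h1⟩ := exists_isBessel_latVec hd hX (X.coord q.1.1)
  obtain ⟨C', -, h2⟩ := exists_isBessel_latVec hd hX (X.coord q.2.2.1.1)
  obtain ⟨T, hT⟩ := (h1 q.2.1).exists_operator (h2 q.2.2.2) hN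
  refine ⟨T, fun f g => ?_⟩
  have := hT f g
  simpa only [inner_conj_symm] using this

/-- The operators `𝐅* H(u) 𝐅` are well defined. -/
theorem isFHF_FHF (hd : 2 ≤ d) (hX : X.LatticeStable) {u : X.sites → Disp m}
    (hu : u ∈ X.energySpace) : X.IsFHF u (X.FHF u) := by
  have hex : ∃ T, X.IsFHF u T := by
    obtain ⟨L, -, hL, -⟩ := exists_farCoeff_bound hu
    have h1 := fun q : BondPair X.stencil m => exists_operator_latVec hd hX q
      (N := fun ξ => (X.farCoeff u q ξ : ℂ)) (L := L) fun ξ => by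
        rw [Complex.norm_real]; exact hL q ξ
    choose T hT using h1
    -- Far sites contribute one Bessel operator per bond pair, and the core an explicit finite rank
    -- operator.
    refine ⟨∑ q, T q + ∑ ℓ ∈ X.core, ∑ q : BondPair (X.siteStencil ℓ) m,
      (hessEntry (X.sitePot ℓ) (X.D u ℓ) q : ℂ) •
        rankOp (X.bondVec ℓ q.1 q.2.1) (X.bondVec ℓ q.2.2.1 q.2.2.2), fun f g => ?_⟩
    rw [_root_.add_apply, inner_add_right]
    have h2 : inner ℂ g ((∑ ℓ ∈ X.core, ∑ q : BondPair (X.siteStencil ℓ) m,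
        (hessEntry (X.sitePot ℓ) (X.D u ℓ) q : ℂ) •
          rankOp (X.bondVec ℓ q.1 q.2.1) (X.bondVec ℓ q.2.2.1 q.2.2.2)) f) =
        ∑ ℓ ∈ X.core, X.hessianSite u (X.opF g) (X.opF f) ℓ := by
      simp only [_root_.sum_apply, _root_.smul_apply, inner_sum, inner_smul_right, inner_rankOp,
        hessianSite_opF hd hX]
    rw [h2, hasSum_hessian_iff hd hX, _root_.sum_apply, inner_sum]
    exact hasSum_sum fun q _ => hT q f g
  rw [FHF, dif_pos hex]
  exact hex.choose_spec

/-- Symmetry of second derivatives, term by term: conjugation exchanges the two bonds of a pair. -/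
lemma IsFHF.isSelfAdjoint (hd : 2 ≤ d) (hX : X.LatticeStable) {u : X.sites → Disp m}
    {T : X.L2 →L[ℂ] X.L2} (hT : X.IsFHF u T) : IsSelfAdjoint T := by
  rw [ContinuousLinearMap.isSelfAdjoint_iff_isSymmetric]
  intro f g
  change inner ℂ (T f) g = inner ℂ f (T g)
  rw [← inner_conj_symm]
  have h1 := (hT f g).map (starRingEnd ℂ) Complex.continuous_conj
  refine (h1.congr_fun fun ℓ => ?_).unique (hT g f)
  let e : BondPair (X.siteStencil ℓ) m ≃ BondPair (X.siteStencil ℓ) m :=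
    { toFun := fun q => (q.2.2.1, q.2.2.2, q.1, q.2.1)
      invFun := fun q => (q.2.2.1, q.2.2.2, q.1, q.2.1)
      left_inv := fun q => rfl
      right_inv := fun q => rfl }
  simp only [Function.comp_apply, hessianSite_opF hd hX, map_sum, map_mul, Complex.conj_ofReal,
    inner_conj_symm]
  refine Fintype.sum_equiv e _ _ fun q => ?_
  have h2 : hessEntry (X.sitePot ℓ) (X.D u ℓ) (e q) = hessEntry (X.sitePot ℓ) (X.D u ℓ) q :=
    partial₂_comm (X.sitePot_contDiff ℓ) _ _ _ _ _
  rw [h2]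
  simp only [e, Equiv.coe_fn_mk]
  ring

end DefectCrystal

/-! ### Square summability of the critical weight, and sums over composite index sets -/

section Sums
variable {d : ℕ}

/-- The exponent 2d exceeds the rank d of the lattice ℤ^d; the origin is treated separately, since
the comparison series omits the 1 in the weight. -/
lemma summable_decay_sq (hd : 0 < d) : Summable fun z : Fin d → ℤ => decay 0 z ^ 2 := by
  let b := Pi.basisFun ℝ (Fin d)
  let L := Submodule.span ℤ (Set.range b)
  have hrank : Module.finrank ℤ L = d := by
    rw [ZLattice.rank ℝ L, Module.finrank_fin_fun]
  have h1 := ZLattice.summable_norm_rpow L (-(2 * d : ℝ)) (by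
    rw [hrank]
    have : (0 : ℝ) < d := by exact_mod_cast hd
    linarith)
  let e : (Fin d → ℤ) → L := fun z => ⟨fun i => (z i : ℝ), by
    rw [Module.Basis.mem_span_iff_repr_mem]
    intro i
    exact ⟨z i, by simp [b]⟩⟩
  have he : Function.Injective e := fun z z' h => by
    ext i
    have : ((z i : ℤ) : ℝ) = (z' i : ℝ) := congrFun (congrArg Subtype.val h) i
    exact_mod_cast this
  have h2 : Summable fun z : Fin d → ℤ => if z = 0 then (1 : ℝ) else 0 :=
    summable_of_hasFiniteSupport ((Set.finite_singleton (0 : Fin d → ℤ)).subset fun z hz => by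
      by_contra h
      exact hz (if_neg h))
  refine Summable.of_nonneg_of_le (fun _ => sq_nonneg _) (fun z => ?_)
    ((h1.comp_injective he).add h2)
  have hnorm : ‖e z‖ = ‖z‖ := DefectCrystal.norm_intCast z
  simp only [Function.comp_apply, hnorm]
  split_ifs with hz
  · subst hz
    rw [decay_self, one_pow]
    have : (0 : ℝ) ≤ ‖(0 : Fin d → ℤ)‖ ^ (-(2 * d : ℝ)) := by positivity
    linarith
  · have hz' : 0 < ‖z‖ := norm_pos_iff.2 hz
    have h3 : ‖z‖ ^ (-(2 * d : ℝ)) = ((‖z‖ ^ d)⁻¹) ^ 2 := by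
      rw [Real.rpow_neg hz'.le, inv_pow, ← pow_mul, ← Real.rpow_natCast]
      congr 2
      push_cast
      ring
    rw [h3, add_zero, decay, zero_sub, norm_neg]
    gcongr
    linarith

lemma hasSum_decay_sq (hd : 0 < d) (x : Fin d → ℤ) :
    HasSum (fun z : Fin d → ℤ => decay x z ^ 2) (∑' z : Fin d → ℤ, decay 0 z ^ 2) := by
  have h := (summable_decay_sq hd).hasSum
  rw [← (Equiv.subLeft x).hasSum_iff] at h
  refine h.congr_fun fun z => ?_
  simp only [Function.comp_apply, Equiv.subLeft_apply, decay]
  rw [zero_sub, norm_neg]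

variable {α β E : Type*} [AddCommMonoid E] [TopologicalSpace E] [ContinuousAdd E]

lemma hasSum_sumType {f : α ⊕ β → E} {a b : E} (ha : HasSum (fun x => f (Sum.inl x)) a)
    (hb : HasSum (fun y => f (Sum.inr y)) b) : HasSum f (a + b) := by
  have h1 : HasSum (Sum.elim (fun x => f (Sum.inl x)) fun _ => 0 : α ⊕ β → E) a := by
    rw [← (Sum.inl_injective (α := α) (β := β)).hasSum_iff]
    · exact ha
    · rintro (x | y) h
      · exact absurd ⟨x, rfl⟩ h
      · rfl
  have h2 : HasSum (Sum.elim (fun _ => 0) fun y => f (Sum.inr y) : α ⊕ β → E) b := by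
    rw [← (Sum.inr_injective (α := α) (β := β)).hasSum_iff]
    · exact hb
    · rintro (x | y) h
      · rfl
      · exact absurd ⟨y, rfl⟩ h
  refine (h1.add h2).congr_fun ?_
  rintro (x | y) <;> simp

lemma hasSum_prod_fintype [Fintype α] {f : α × β → E} {a : α → E}
    (h : ∀ q, HasSum (fun x => f (q, x)) (a q)) : HasSum f (∑ q, a q) := by
  classical
  have h1 : ∀ q, HasSum (fun p : α × β => if p.1 = q then f p else 0) (a q) := fun q => by
    rw [← (Prod.mk_right_injective q).hasSum_iff]
    · refine (h q).congr_fun fun x => ?_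
      simp
    · rintro ⟨q', x⟩ hp
      refine if_neg ?_
      rintro rfl
      exact hp ⟨x, rfl⟩
  refine (hasSum_sum fun q (_ : q ∈ Finset.univ) => h1 q).congr_fun fun p => ?_
  simp

end Sums

/-! ### Shifts and centres of the bond vectors -/

namespace DefectCrystal
variable {d m : ℕ} {X : DefectCrystal d m}

open Classical in
variable (X) in
/-- The shifts that occur in the bond vectors. -/
def shifts : Finset (Fin d → ℤ) :=
  X.stencil.image X.coord ∪ (X.core.image fun ℓ => X.coord ℓ.1) ∪
    X.core.biUnion fun ℓ => (X.siteStencil ℓ).image fun ρ => X.coord (ℓ.1 + ρ)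

open Classical in
variable (X) in
/-- The centre of the bond vectors of a site. -/
def center (ℓ : X.sites) : Fin d → ℤ := if ℓ ∈ X.core then 0 else X.coord ℓ.1

lemma center_of_mem {ℓ : X.sites} (h : ℓ ∈ X.core) : X.center ℓ = 0 := if_pos h

lemma center_of_notMem {ℓ : X.sites} (h : ℓ ∉ X.core) : X.center ℓ = X.coord ℓ.1 := if_neg h

lemma latVec_mem (ξ : Fin d → ℤ) (ρ : X.stencil) (i : Fin m) :
    X.latVec ξ (X.coord ρ.1) i ∈ X.localVectors X.shifts ξ := by
  classical
  refine basic_mem_localVectors (Or.inl ⟨X.coord ρ.1, ?_, i, rfl⟩)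
  exact Finset.mem_union_left _ (Finset.mem_union_left _ (Finset.mem_image_of_mem _ ρ.2))

lemma siteBasis_mem {ℓ : X.sites} (h : ℓ.1 ∉ bravais X.A) (i : Fin m) :
    X.siteBasis ℓ i ∈ X.localVectors X.shifts 0 :=
  basic_mem_localVectors (Or.inr (Or.inl ⟨ℓ, h, i, rfl, rfl⟩))

lemma obs_mem {ℓ : X.sites} (h : X.coord ℓ.1 ∈ X.shifts) (i : Fin m) :
    X.obs ℓ i ∈ X.basicVectors X.shifts 0 := by
  by_cases hb : ℓ.1 ∈ bravais X.A
  · rw [obs_of_mem hb]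
    exact Or.inl ⟨_, h, i, rfl⟩
  · rw [obs_of_notMem hb]
    exact Or.inr (Or.inl ⟨ℓ, hb, i, rfl, rfl⟩)

lemma siteStencil_eq {ℓ : X.sites} (h : ℓ ∉ X.core) : X.siteStencil ℓ = X.stencil :=
  (X.homogeneous ℓ (by rw [mem_core] at h; exact not_lt.1 h)).1

lemma mem_bravais_of_notMem_core {ℓ : X.sites} (h : ℓ ∉ X.core) : ℓ.1 ∈ bravais X.A := by
  by_contra hb
  exact h (X.mem_core_of_notMem_bravais hb)

lemma bondVec_mem (hd : 2 ≤ d) (hX : X.LatticeStable) (ℓ : X.sites) (ρ : X.siteStencil ℓ)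
    (i : Fin m) : X.bondVec ℓ ρ i ∈ X.localVectors X.shifts (X.center ℓ) := by
  classical
  by_cases h : ℓ ∈ X.core
  · rw [center_of_mem h]
    refine ⟨_, obs_mem ?_ i, _, obs_mem ?_ i, rfl⟩
    · exact Finset.mem_union_right _ (Finset.mem_biUnion.2 ⟨ℓ, h,
        Finset.mem_image_of_mem (fun ρ => X.coord (ℓ.1 + ρ)) ρ.2⟩)
    · exact Finset.mem_union_left _ (Finset.mem_union_right _
        (Finset.mem_image_of_mem (fun ℓ : X.sites => X.coord ℓ.1) h))
  · have hρ : ρ.1 ∈ X.stencil := (siteStencil_eq h).subset ρ.2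
    rw [center_of_notMem h,
      bondVec_eq_latVec hd hX (mem_bravais_of_notMem_core h) ρ (X.stencil_subset hρ)]
    exact latVec_mem _ ⟨ρ.1, hρ⟩ i

/-! ### `𝐅* H(u) 𝐅` as a localized perturbation of the identity -/

variable (X) in
/-- Index set of the perturbation: bond pairs on the lattice, bond pairs at core sites, and
interstitials. -/
abbrev PertIndex : Type :=
  (BondPair X.stencil m × (Fin d → ℤ)) ⊕
    ((Σ ℓ : X.core, BondPair (X.siteStencil ℓ.1) m) ⊕ (X.interstitials × Fin m))

variable (X) in
/-- Centres of the perturbation. -/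
def pertCenter : X.PertIndex → Fin d → ℤ
  | Sum.inl (_, ξ) => ξ
  | Sum.inr _ => 0

variable (X) in
/-- Coefficients of the perturbation. -/
def pertCoeff (u : X.sites → Disp m) : X.PertIndex → ℂ
  | Sum.inl (q, ξ) => ((X.farCoeff u q ξ - hessEntry X.pot 0 q : ℝ) : ℂ)
  | Sum.inr (Sum.inl ⟨ℓ, q⟩) => (hessEntry (X.sitePot ℓ.1) (X.D u ℓ.1) q : ℂ)
  | Sum.inr (Sum.inr _) => -1

variable (X) in
/-- Left vectors of the perturbation. -/
def pertLeft : X.PertIndex → X.L2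
  | Sum.inl (q, ξ) => X.latVec ξ (X.coord q.1.1) q.2.1
  | Sum.inr (Sum.inl ⟨ℓ, q⟩) => X.bondVec ℓ.1 q.1 q.2.1
  | Sum.inr (Sum.inr (ℓ, i)) => X.siteBasis ℓ.1 i

variable (X) in
/-- Right vectors of the perturbation. -/
def pertRight : X.PertIndex → X.L2
  | Sum.inl (q, ξ) => X.latVec ξ (X.coord q.2.2.1.1) q.2.2.2
  | Sum.inr (Sum.inl ⟨ℓ, q⟩) => X.bondVec ℓ.1 q.2.2.1 q.2.2.2
  | Sum.inr (Sum.inr (ℓ, i)) => X.siteBasis ℓ.1 i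

lemma pertLeft_mem (hd : 2 ≤ d) (hX : X.LatticeStable) (a : X.PertIndex) :
    X.pertLeft a ∈ X.localVectors X.shifts (X.pertCenter a) := by
  rcases a with ⟨q, ξ⟩ | ⟨ℓ, q⟩ | ⟨ℓ, i⟩
  · exact latVec_mem _ _ _
  · have := bondVec_mem hd hX ℓ.1 q.1 q.2.1
    rwa [center_of_mem ℓ.2] at this
  · exact siteBasis_mem (X.mem_interstitials.1 ℓ.2) i

lemma pertRight_mem (hd : 2 ≤ d) (hX : X.LatticeStable) (a : X.PertIndex) :
    X.pertRight a ∈ X.localVectors X.shifts (X.pertCenter a) := by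
  rcases a with ⟨q, ξ⟩ | ⟨ℓ, q⟩ | ⟨ℓ, i⟩
  · exact latVec_mem _ _ _
  · have := bondVec_mem hd hX ℓ.1 q.2.2.1 q.2.2.2
    rwa [center_of_mem ℓ.2] at this
  · exact siteBasis_mem (X.mem_interstitials.1 ℓ.2) i

/-- On the lattice part the identity is itself the homogeneous Hessian between 𝐅* and 𝐅, so
subtracting it leaves differences of coefficients. At core lattice points the whole of -∇²V(0)
remains and the true core Hessian is added separately. The identity at interstitials has no lattice
counterpart and is removed by terms with coefficient -1. -/
lemma hasSum_pert (hd : 2 ≤ d) (hX : X.LatticeStable) {u : X.sites → Disp m}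
    (hu : u ∈ X.energySpace) {T : X.L2 →L[ℂ] X.L2} (hT : X.IsFHF u T) (f g : X.L2) :
    HasSum (fun a => X.pertCoeff u a * (inner ℂ g (X.pertLeft a) * inner ℂ (X.pertRight a) f))
      (inner ℂ g (T f) - inner ℂ g f) := by
  obtain ⟨L, hL0, hL, -⟩ := exists_farCoeff_bound hu
  have hN : ∀ q ξ, ‖((X.farCoeff u q ξ - hessEntry X.pot 0 q : ℝ) : ℂ)‖ ≤
      L + |hessEntry X.pot 0 q| := fun q ξ => by
    rw [Complex.norm_real]
    exact (norm_sub_le _ _).trans (add_le_add (hL q ξ) le_rfl)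
  choose A hA using fun q : BondPair X.stencil m => exists_operator_latVec hd hX q (hN q)
  set S := ∑ ℓ ∈ X.core, X.hessianSite u (X.opF g) (X.opF f) ℓ with hS
  have hfar : ∑ q, inner ℂ g (A q f) =
      (inner ℂ g (T f) - S) - inner ℂ (X.extend g) (X.extend f) := by
    have h1 := hT f g
    rw [show inner ℂ g (T f) = (inner ℂ g (T f) - S) + S by ring,
      hasSum_hessian_iff hd hX] at h1
    have h2 := hasSum_homForm_latDiff hd hX (X.extend f) (X.extend g)
    refine (hasSum_sum fun q _ => hA q f g).unique ((h1.sub h2).congr_fun fun ξ => ?_)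
    have h3 : X.homForm (X.latDiff (X.extend g) ξ) (X.latDiff (X.extend f) ξ) =
        ∑ q : BondPair X.stencil m, (hessEntry X.pot 0 q : ℂ) *
          (inner ℂ g (X.latVec ξ (X.coord q.1.1) q.2.1) *
            inner ℂ (X.latVec ξ (X.coord q.2.2.1.1) q.2.2.2) f) := by
      simp only [homForm, latDiff, Fintype.sum_prod_type, hessEntry, latVec,
        ← inner_restrict_left, inner_conj_symm]
    rw [h3, ← Finset.sum_sub_distrib]
    refine Finset.sum_congr rfl fun q _ => ?_
    push_cast
    ring
  have hcore : S = ∑ a : Σ ℓ : X.core, BondPair (X.siteStencil ℓ.1) m,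
      X.pertCoeff u (Sum.inr (Sum.inl a)) * (inner ℂ g (X.pertLeft (Sum.inr (Sum.inl a))) *
        inner ℂ (X.pertRight (Sum.inr (Sum.inl a))) f) := by
    rw [Fintype.sum_sigma, hS, ← Finset.sum_coe_sort]
    refine Finset.sum_congr rfl fun ℓ _ => ?_
    rw [hessianSite_opF hd hX]
    rfl
  have hint : -(∑ ℓ ∈ X.interstitials, inner ℂ (g ℓ) (f ℓ)) = ∑ a : X.interstitials × Fin m,
      X.pertCoeff u (Sum.inr (Sum.inr a)) * (inner ℂ g (X.pertLeft (Sum.inr (Sum.inr a))) *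
        inner ℂ (X.pertRight (Sum.inr (Sum.inr a))) f) := by
    rw [Fintype.sum_prod_type, ← Finset.sum_coe_sort, ← Finset.sum_neg_distrib]
    refine Finset.sum_congr rfl fun ℓ _ => ?_
    rw [PiLp.inner_apply, ← Finset.sum_neg_distrib]
    refine Finset.sum_congr rfl fun i _ => ?_
    simp only [pertCoeff, pertLeft, pertRight]
    rw [← inner_conj_symm g, inner_siteBasis, inner_siteBasis, RCLike.inner_apply]
    ring
  have key := hasSum_sumType
    (f := fun a => X.pertCoeff u a * (inner ℂ g (X.pertLeft a) * inner ℂ (X.pertRight a) f))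
    (hasSum_prod_fintype fun q => hA q f g)
    (hasSum_sumType (hasSum_fintype _) (hasSum_fintype _))
  convert! key using 1
  rw [hfar, ← hcore, ← hint, X.inner_eq_extend_add g f]
  ring

/-- `𝐅* H(u) 𝐅` is a localized perturbation of the identity. -/
theorem exists_isLocalizedPerturbation (hd : 2 ≤ d) (hX : X.LatticeStable) {u : X.sites → Disp m}
    (hu : u ∈ X.energySpace) {T : X.L2 →L[ℂ] X.L2} (hT : X.IsFHF u T) :
    ∃ C M : ℝ, IsLocalizedPerturbation T X.pertCenter (X.pertCoeff u) X.pertLeft X.pertRight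
      C M := by
  obtain ⟨C, hC, h⟩ := exists_norm_inner_local_le hd hX X.shifts
  obtain ⟨L, -, -, hsum⟩ := exists_farCoeff_bound hu
  -- Each bond pair contributes one copy of the lattice sum of squared weights; the finitely many
  -- other indices contribute at most 1 each.
  set M : ℝ := ∑ _q : BondPair X.stencil m, ∑' z : Fin d → ℤ, decay 0 z ^ 2 +
    Fintype.card ((Σ ℓ : X.core, BondPair (X.siteStencil ℓ.1) m) ⊕ (X.interstitials × Fin m))
    with hM
  have hdec : ∀ x, ∃ c, HasSum (fun a => decay x (X.pertCenter a) ^ 2) c ∧ c ≤ M := by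
    intro x
    refine ⟨_, hasSum_sumType (f := fun a => decay x (X.pertCenter a) ^ 2)
      (hasSum_prod_fintype fun q => hasSum_decay_sq (by omega) x) (hasSum_fintype _), ?_⟩
    rw [hM]
    refine add_le_add le_rfl ?_
    refine (Finset.sum_le_card_nsmul _ _ 1 fun a _ => ?_).trans_eq ?_
    · exact pow_le_one₀ (decay_nonneg _ _) (decay_le_one _ _)
    · rw [nsmul_eq_mul, mul_one, Finset.card_univ]
  refine ⟨C, M, hC, hasSum_pert hd hX hu hT, ?_, fun x t => ?_, fun a a' => ?_, fun a a' => ?_⟩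
  · have h1 : ∀ q : BondPair X.stencil m, HasSum (fun ξ =>
        ‖X.pertCoeff u (Sum.inl (q, ξ))‖ ^ 2)
        (∑' ξ, (X.farCoeff u q ξ - hessEntry X.pot 0 q) ^ 2) := fun q => by
      refine (hsum q).hasSum.congr_fun fun ξ => ?_
      rw [pertCoeff, Complex.norm_real, Real.norm_eq_abs, sq_abs]
    exact (hasSum_sumType (f := fun a => ‖X.pertCoeff u a‖ ^ 2) (hasSum_prod_fintype h1)
      (hasSum_fintype _)).summable
  · obtain ⟨c, hc, hle⟩ := hdec x
    exact (sum_le_hasSum t (fun _ _ => sq_nonneg _) hc).trans hle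
  · exact h _ _ _ (pertRight_mem hd hX a) _ (pertLeft_mem hd hX a')
  · exact h _ _ _ (pertRight_mem hd hX a) _ (pertRight_mem hd hX a')

/-- `1` belongs to the spectrum of `𝐅* H(u) 𝐅`. -/
theorem one_mem_spectrum (hd : 2 ≤ d) (hX : X.LatticeStable) [NeZero m] {u : X.sites → Disp m}
    (hu : u ∈ X.energySpace) {T : X.L2 →L[ℂ] X.L2} (hT : X.IsFHF u T) :
    (1 : ℂ) ∈ spectrum ℂ T := by
  have : NeZero d := ⟨by omega⟩
  obtain ⟨C, M, h⟩ := exists_isLocalizedPerturbation hd hX hu hT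
  obtain ⟨C₁, hC₁, h₁⟩ := exists_norm_inner_local_siteBasis_le hd hX X.shifts
  obtain ⟨C₂, hC₂, h₂⟩ := exists_norm_inner_local_le hd hX X.shifts
  refine h.one_mem_spectrum (B := C₁ + √C₂) (by positivity) (fun a => ?_) ?_
  · have h3 := h₂ _ _ _ (pertLeft_mem hd hX a) _ (pertLeft_mem hd hX a)
    rw [decay_self, mul_one, inner_self_eq_norm_sq_to_K] at h3
    have h4 : ‖X.pertLeft a‖ ^ 2 ≤ C₂ := by simpa using h3
    have := Real.le_sqrt_of_sq_le h4
    linarith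
  -- The basis vectors at lattice sites outside the core serve as a Weyl sequence moving off to
  -- infinity.
  · refine Filter.Eventually.frequently ?_
    filter_upwards [X.finite_lat_core.compl_mem_cofinite] with ξ hξ
    have hf : X.coreRadius ≤ ‖X.lat ξ‖ := not_lt.1 hξ
    refine ⟨X.siteBasis ⟨X.lat ξ, lat_mem_sites hf⟩ 0, X.norm_siteBasis _ _, fun a => ?_⟩
    have h3 := h₁ _ _ (pertRight_mem hd hX a) ⟨X.lat ξ, lat_mem_sites hf⟩ 0
    rw [X.pos_lat] at h3
    refine h3.trans ?_
    have := decay_nonneg (X.pertCenter a) ξ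
    gcongr
    have := Real.sqrt_nonneg C₂
    linarith

end DefectCrystal

/-! ### Dependence on the displacement of one atom -/

/-- Chain rule for a complex differentiable function along a real family of operators that is
affine in real coefficient functions. -/
lemma hasFDerivAt_re_comp {E 𝔸 ι : Type*} [NormedAddCommGroup E] [NormedSpace ℝ E]
    [NormedAddCommGroup 𝔸] [NormedSpace ℂ 𝔸] {s : Finset ι} {c : ι → E → ℝ} {c' : ι → E →L[ℝ] ℝ}
    {x₀ : E} (hc : ∀ k ∈ s, HasFDerivAt (c k) (c' k) x₀) {K : ι → 𝔸} {T : E → 𝔸} {T₀ : 𝔸}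
    (hT : ∀ x, T x = T₀ + ∑ k ∈ s, ((c k x - c k x₀ : ℝ) : ℂ) • K k) {Φ : 𝔸 → ℂ} {L : 𝔸 →L[ℂ] ℂ}
    (hΦ : HasFDerivAt Φ L T₀) :
    HasFDerivAt (fun x => (Φ (T x)).re) (∑ k ∈ s, (L (K k)).re • c' k) x₀ := by
  let _ : NormedSpace ℝ 𝔸 := NormedSpace.restrictScalars ℝ ℂ 𝔸
  have hs : IsScalarTower ℝ ℂ 𝔸 := RestrictScalars.isScalarTower ℝ ℂ 𝔸
  have h1 : T = fun x => T₀ + ∑ k ∈ s, (c k x - c k x₀) • K k := by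
    funext x
    rw [hT]
    rfl
  have h2 : HasFDerivAt T (∑ k ∈ s, (c' k).smulRight (K k)) x₀ := by
    rw [h1]
    refine (HasFDerivAt.fun_sum fun k hk => ?_).const_add T₀
    exact ((hc k hk).sub_const _).smul_const (K k)
  have h0 : T x₀ = T₀ := by rw [hT]; simp
  have h3 : HasFDerivAt Φ (L.restrictScalars ℝ) (T x₀) := by
    rw [h0]
    exact hΦ.restrictScalars ℝ
  have h4 := (Complex.reCLM.hasFDerivAt (x := Φ (T x₀))).comp x₀ (h3.comp x₀ h2)
  convert! h4 using 1
  ext h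
  simp only [ContinuousLinearMap.coe_comp, Function.comp_apply, _root_.sum_apply, map_sum,
    _root_.smul_apply, ContinuousLinearMap.smulRight_apply, map_smul, smul_eq_mul,
    Complex.reCLM_apply]
  exact Finset.sum_congr rfl fun k _ => mul_comm _ _

namespace DefectCrystal
variable {d m : ℕ} {X : DefectCrystal d m}

lemma IsFHF.unique {u : X.sites → Disp m} {T T' : X.L2 →L[ℂ] X.L2} (h : X.IsFHF u T)
    (h' : X.IsFHF u T') : T = T' :=
  ContinuousLinearMap.ext fun f => ext_inner_left ℂ fun g => (h f g).unique (h' f g)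

/-! ### Uniform bounds over the sites -/

/-- Outside a finite core the data are homogeneous, so a bound there is uniform after adding the
finitely many core values. -/
lemma exists_forall_le_of_far {f : X.sites → ℝ} {M : ℝ} (h : ∀ ℓ ∉ X.core, f ℓ ≤ M) :
    ∃ N : ℝ, 0 ≤ N ∧ ∀ ℓ, f ℓ ≤ N := by
  refine ⟨|M| + ∑ ℓ ∈ X.core, |f ℓ|, by positivity, fun ℓ => ?_⟩
  by_cases hℓ : ℓ ∈ X.core
  · have := Finset.single_le_sum (N := ℝ) (f := fun ℓ => |f ℓ|) (fun _ _ => abs_nonneg _) hℓ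
    have := le_abs_self (f ℓ)
    have := abs_nonneg M
    linarith
  · have := h ℓ hℓ
    have := le_abs_self M
    have : 0 ≤ ∑ ℓ ∈ X.core, |f ℓ| := Finset.sum_nonneg fun _ _ => abs_nonneg _
    linarith

lemma exists_card_le : ∃ N : ℝ, 0 ≤ N ∧
    ∀ ℓ : X.sites, (Fintype.card (BondPair (X.siteStencil ℓ) m) : ℝ) ≤ N :=
  exists_forall_le_of_far (M := Fintype.card (BondPair X.stencil m)) fun ℓ hℓ => by
    rw [siteStencil_eq hℓ]

lemma exists_norm_stencil_le : ∃ N : ℝ, 0 ≤ N ∧ ∀ ℓ : X.sites, ∀ ρ ∈ X.siteStencil ℓ, ‖ρ‖ ≤ N := by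
  obtain ⟨N, hN, h⟩ := exists_forall_le_of_far (X := X)
    (f := fun ℓ => ∑ ρ ∈ X.siteStencil ℓ, ‖ρ‖) (M := ∑ ρ ∈ X.stencil, ‖ρ‖) fun ℓ hℓ => by
      rw [siteStencil_eq hℓ]
  refine ⟨N, hN, fun ℓ ρ hρ => le_trans ?_ (h ℓ)⟩
  exact Finset.single_le_sum (N := ℝ) (f := fun ρ : Space d => ‖ρ‖) (fun _ _ => norm_nonneg _) hρ

lemma exists_fderiv_hessEntry_le {u : X.sites → Disp m} (hu : u ∈ X.energySpace) :
    ∃ N : ℝ, 0 ≤ N ∧ ∀ ℓ q, ‖fderiv ℝ (fun g => hessEntry (X.sitePot ℓ) g q) (X.D u ℓ)‖ ≤ N := by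
  obtain ⟨M, hM⟩ := exists_norm_latD_le hu
  obtain ⟨L, hL, hb⟩ := exists_hessEntry_bound X.pot_contDiff M
  obtain ⟨N, hN, h⟩ := exists_forall_le_of_far (X := X) (f := fun ℓ =>
      ∑ q, ‖fderiv ℝ (fun g => hessEntry (X.sitePot ℓ) g q) (X.D u ℓ)‖)
      (M := ∑ _q : BondPair X.stencil m, L) fun ℓ hℓ => by
    have hf : X.coreRadius ≤ ‖ℓ.1‖ := not_lt.1 fun h => hℓ (X.mem_core.2 h)
    refine far_induction hf (fun R V hm => ∑ q : BondPair R m,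
      ‖fderiv ℝ (fun g => hessEntry V g q) (fun ρ => u ⟨ℓ.1 + ρ.1, hm ρ.1 ρ.2⟩ - u ℓ)‖ ≤ _)
      fun hm => ?_
    refine Finset.sum_le_sum fun q _ => (hb _ ?_ q).1
    have hb := X.lat_coord (mem_bravais_of_notMem_core hℓ)
    have hD : (fun ρ : X.stencil => u ⟨ℓ.1 + ρ.1, hm ρ.1 ρ.2⟩ - u ℓ) = X.latD u (X.coord ℓ.1) := by
      funext ρ
      rw [latD, hb, siteExt_of_mem u (hm ρ.1 ρ.2), siteExt_of_mem u ℓ.2]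
    rw [hD]
    exact hM _ (by rwa [hb])
  refine ⟨N, hN, fun ℓ q => le_trans ?_ (h ℓ)⟩
  exact Finset.single_le_sum (N := ℝ)
    (f := fun q => ‖fderiv ℝ (fun g => hessEntry (X.sitePot ℓ) g q) (X.D u ℓ)‖)
    (fun _ _ => norm_nonneg _) (Finset.mem_univ q)

/-! ### Sites that interact with a given site -/

open Classical in
variable (X) in
/-- The sites whose potential depends on the displacement of the site `n`. -/
def neighbours (n : X.sites) : Finset X.sites :=
  (insert n (X.core.filter fun ℓ => n.1 - ℓ.1 ∈ X.siteStencil ℓ)) ∪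
    (X.stencil.image fun ρ => n.1 - ρ).subtype (· ∈ X.sites)

lemma D_update_of_notMem [DecidableEq X.sites] {Y : Type*} [Sub Y] (u : X.sites → Y)
    {n ℓ : X.sites} (h : ℓ ∉ X.neighbours n) (x : Y) : X.D (Function.update u n x) ℓ = X.D u ℓ := by
  classical
  simp only [neighbours, Finset.mem_union, Finset.mem_insert, Finset.mem_filter,
    Finset.mem_subtype, Finset.mem_image, not_or, not_and, not_exists] at h
  obtain ⟨⟨h1, h2⟩, h3⟩ := h
  funext ρ
  have h4 : (⟨ℓ.1 + ρ.1, X.siteStencil_mem ℓ ρ.1 ρ.2⟩ : X.sites) ≠ n := by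
    intro h
    have h5 : n.1 = ℓ.1 + ρ.1 := (congrArg Subtype.val h).symm
    by_cases hc : ℓ ∈ X.core
    · refine h2 hc ?_
      rw [h5, add_sub_cancel_left]
      exact ρ.2
    · refine h3 ρ.1 ((siteStencil_eq hc).subset ρ.2) ?_
      rw [h5, add_sub_cancel_right]
  rw [D, D, Function.update_of_ne h4, Function.update_of_ne h1]

lemma exists_neighbours_card_le : ∃ N : ℝ, 0 ≤ N ∧ ∀ n, ((X.neighbours n).card : ℝ) ≤ N := by
  classical
  refine ⟨((X.core.card + 1 + X.stencil.card : ℕ) : ℝ), Nat.cast_nonneg _, fun n => ?_⟩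
  rw [Nat.cast_le, neighbours]
  refine (Finset.card_union_le _ _).trans (add_le_add ?_ ?_)
  · refine (Finset.card_insert_le _ _).trans ?_
    gcongr
    exact Finset.filter_subset _ _
  · rw [Finset.card_subtype]
    exact (Finset.card_filter_le _ _).trans Finset.card_image_le

lemma exists_norm_neighbours_le : ∃ N : ℝ, 0 ≤ N ∧ ∀ n, ∀ ℓ ∈ X.neighbours n, ‖ℓ.1 - n.1‖ ≤ N := by
  classical
  obtain ⟨N, hN, h⟩ := exists_norm_stencil_le (X := X)
  refine ⟨N + ∑ ρ ∈ X.stencil, ‖ρ‖, by positivity, fun n ℓ hℓ => ?_⟩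
  have hS : 0 ≤ ∑ ρ ∈ X.stencil, ‖ρ‖ := by positivity
  simp only [neighbours, Finset.mem_union, Finset.mem_insert, Finset.mem_filter,
    Finset.mem_subtype, Finset.mem_image] at hℓ
  rcases hℓ with (rfl | ⟨-, h1⟩) | ⟨ρ, hρ, h1⟩
  · simpa using add_nonneg hN hS
  · have := h _ _ h1
    rw [norm_sub_rev] at this
    linarith
  · rw [← h1, sub_sub_cancel_left, norm_neg]
    have := Finset.single_le_sum (N := ℝ) (f := fun ρ : Space d => ‖ρ‖)
      (fun _ _ => norm_nonneg _) hρ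
    linarith

lemma norm_sub_lat_center_le (ℓ : X.sites) : ‖ℓ.1 - X.lat (X.center ℓ)‖ ≤ X.coreRadius := by
  by_cases hℓ : ℓ ∈ X.core
  · rw [center_of_mem hℓ, X.lat_zero, sub_zero]
    exact (X.mem_core.1 hℓ).le
  · rw [center_of_notMem hℓ, X.lat_coord (mem_bravais_of_notMem_core hℓ), sub_self, norm_zero]
    exact X.coreRadius_pos.le

/-- Sites interacting with n have their centres within bounded distance of n, and the weight varies
slowly. -/
lemma exists_decay_center_le : ∃ C : ℝ, 0 ≤ C ∧ ∀ n, ∀ ℓ ∈ X.neighbours n, ∀ y,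
    decay (X.center ℓ) y ≤ C * decay (X.pos n) y := by
  obtain ⟨N, hN, h⟩ := exists_norm_neighbours_le (X := X)
  obtain ⟨C, hC, hl⟩ := X.exists_norm_le_lat
  have hr := X.coreRadius_pos
  refine ⟨(1 + C * (N + 2 * X.coreRadius)) ^ d, by positivity, fun n ℓ hℓ y => ?_⟩
  rw [decay_comm, decay_comm (X.pos n)]
  refine (decay_le_mul y (X.center ℓ) (X.pos n)).trans ?_
  have h1 : ‖X.lat (X.center ℓ - X.pos n)‖ ≤ N + 2 * X.coreRadius := by
    have h2 : X.lat (X.center ℓ - X.pos n) = (ℓ.1 - n.1) + (n.1 - X.lat (X.pos n)) -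
        (ℓ.1 - X.lat (X.center ℓ)) := by rw [lat_sub]; abel
    rw [h2]
    refine (norm_sub_le _ _).trans ((add_le_add ((norm_add_le _ _).trans
      (add_le_add (h n ℓ hℓ) (X.norm_sub_lat_pos_le n))) (norm_sub_lat_center_le ℓ)).trans ?_)
    linarith
  have h3 := hl (X.center ℓ - X.pos n)
  have h4 : ‖X.center ℓ - X.pos n‖ ≤ C * (N + 2 * X.coreRadius) :=
    h3.trans (mul_le_mul_of_nonneg_left h1 hC)
  have := decay_nonneg y (X.pos n)
  have := norm_nonneg (X.center ℓ - X.pos n)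
  gcongr

/-! ### Dependence on the displacement of one site -/

lemma update_mem_energySpace [DecidableEq X.sites] {u : X.sites → Disp m} (hu : u ∈ X.energySpace)
    (n : X.sites) (x : Disp m) : Function.update u n x ∈ X.energySpace := by
  have h1 : Summable fun ℓ => ∑ ρ, ‖X.D (Function.update u n x) ℓ ρ‖ ^ 2 - ∑ ρ, ‖X.D u ℓ ρ‖ ^ 2 :=
    summable_of_ne_finset_zero (s := X.neighbours n) fun ℓ hℓ => by
      rw [D_update_of_notMem u hℓ, sub_self]
  have h2 := h1.add hu
  simp only [sub_add_cancel] at h2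
  exact h2

/-- Moving one atom changes only the terms of its neighbours, a finite rank operator. The reference
value is written with the trivial update so that it matches the base point in the chain rule. -/
lemma FHF_update (hd : 2 ≤ d) (hX : X.LatticeStable) [DecidableEq X.sites] {u : X.sites → Disp m}
    (hu : u ∈ X.energySpace) (n : X.sites) (x : Disp m) :
    X.FHF (Function.update u n x) = X.FHF u +
      ∑ k ∈ (X.neighbours n).sigma fun ℓ => (Finset.univ : Finset (BondPair (X.siteStencil ℓ) m)),
        ((hessEntry (X.sitePot k.1) (X.D (Function.update u n x) k.1) k.2 -
          hessEntry (X.sitePot k.1) (X.D (Function.update u n (u n)) k.1) k.2 : ℝ) : ℂ) •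
            rankOp (X.bondVec k.1 k.2.1 k.2.2.1) (X.bondVec k.1 k.2.2.2.1 k.2.2.2.2) := by
  refine (isFHF_FHF hd hX (update_mem_energySpace hu n x)).unique fun f g => ?_
  rw [Function.update_eq_self, _root_.add_apply, inner_add_right]
  set w := Function.update u n x with hw
  have h2 : ∑ ℓ ∈ X.neighbours n, (X.hessianSite w (X.opF g) (X.opF f) ℓ -
      X.hessianSite u (X.opF g) (X.opF f) ℓ) = inner ℂ g ((∑ k ∈ (X.neighbours n).sigma fun ℓ =>
        (Finset.univ : Finset (BondPair (X.siteStencil ℓ) m)),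
        ((hessEntry (X.sitePot k.1) (X.D w k.1) k.2 -
          hessEntry (X.sitePot k.1) (X.D u k.1) k.2 : ℝ) : ℂ) •
            rankOp (X.bondVec k.1 k.2.1 k.2.2.1) (X.bondVec k.1 k.2.2.2.1 k.2.2.2.2)) f) := by
    rw [Finset.sum_sigma]
    simp only [_root_.sum_apply, _root_.smul_apply, inner_sum, inner_smul_right, inner_rankOp,
      hessianSite_opF hd hX, ← Finset.sum_sub_distrib]
    refine Finset.sum_congr rfl fun ℓ _ => Finset.sum_congr rfl fun q _ => ?_
    push_cast
    ring
  rw [← h2]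
  have h3 : HasSum (fun ℓ => X.hessianSite w (X.opF g) (X.opF f) ℓ -
      X.hessianSite u (X.opF g) (X.opF f) ℓ) (∑ ℓ ∈ X.neighbours n,
      (X.hessianSite w (X.opF g) (X.opF f) ℓ - X.hessianSite u (X.opF g) (X.opF f) ℓ)) :=
    hasSum_sum_of_ne_finset_zero fun ℓ hℓ => by
      rw [hessianSite, hessianSite, hw, D_update_of_notMem u hℓ, sub_self]
  refine ((isFHF_FHF hd hX hu f g).add h3).congr_fun fun ℓ => ?_
  simp

lemma exists_hasFDerivAt_D_update [DecidableEq X.sites] (u : X.sites → Disp m) (n ℓ : X.sites)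
    (x : Disp m) : ∃ A : Disp m →L[ℝ] (X.siteStencil ℓ → Disp m), ‖A‖ ≤ 2 ∧
      HasFDerivAt (fun x => X.D (Function.update u n x) ℓ) A x := by
  have h1 : ∀ k : X.sites, ∃ A : Disp m →L[ℝ] Disp m, ‖A‖ ≤ 1 ∧
      HasFDerivAt (fun x => Function.update u n x k) A x := fun k => by
    by_cases h : k = n
    · subst h
      refine ⟨ContinuousLinearMap.id ℝ _, ContinuousLinearMap.norm_id_le, ?_⟩
      simp only [Function.update_self]
      exact hasFDerivAt_id x
    · refine ⟨0, by simp, ?_⟩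
      simp only [Function.update_of_ne h]
      exact hasFDerivAt_const (u k) x
  choose A hA hA' using h1
  refine ⟨ContinuousLinearMap.pi fun ρ =>
    A ⟨ℓ.1 + ρ.1, X.siteStencil_mem ℓ ρ.1 ρ.2⟩ - A ℓ, ?_, ?_⟩
  · refine ContinuousLinearMap.opNorm_le_bound _ (by norm_num) fun y => ?_
    refine (pi_norm_le_iff_of_nonneg (by positivity)).2 fun ρ => ?_
    have h2 : ‖A ⟨ℓ.1 + ρ.1, X.siteStencil_mem ℓ ρ.1 ρ.2⟩ - A ℓ‖ ≤ 2 :=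
      (norm_sub_le _ _).trans (by linarith [hA ⟨ℓ.1 + ρ.1, X.siteStencil_mem ℓ ρ.1 ρ.2⟩, hA ℓ])
    exact (ContinuousLinearMap.le_opNorm _ _).trans (mul_le_mul_of_nonneg_right h2 (norm_nonneg _))
  · exact hasFDerivAt_pi.2 fun ρ => (hA' _).sub (hA' ℓ)

/-- The coefficients of the Hessian depend differentiably on the displacement of one site, with
uniformly bounded derivatives. -/
lemma exists_hasFDerivAt_hessEntry {u : X.sites → Disp m} (hu : u ∈ X.energySpace) :
    ∃ N : ℝ, 0 ≤ N ∧ ∀ [DecidableEq X.sites] (n ℓ : X.sites) (q : BondPair (X.siteStencil ℓ) m),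
      ∃ A : Disp m →L[ℝ] ℝ, ‖A‖ ≤ N ∧ HasFDerivAt
        (fun x => hessEntry (X.sitePot ℓ) (X.D (Function.update u n x) ℓ) q) A (u n) := by
  obtain ⟨N, hN, h⟩ := exists_fderiv_hessEntry_le hu
  refine ⟨N * 2, by positivity, fun n ℓ q => ?_⟩
  obtain ⟨A, hA, hA'⟩ := exists_hasFDerivAt_D_update u n ℓ (u n)
  have h1 : HasFDerivAt (fun g => hessEntry (X.sitePot ℓ) g q)
      (fderiv ℝ (fun g => hessEntry (X.sitePot ℓ) g q) (X.D u ℓ))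
      (X.D (Function.update u n (u n)) ℓ) := by
    rw [Function.update_eq_self]
    exact ((contDiff_hessEntry (X.sitePot_contDiff ℓ) q).differentiable
      (by norm_num) _).hasFDerivAt
  refine ⟨_, ?_, HasFDerivAt.comp (g := fun g => hessEntry (X.sitePot ℓ) g q)
    (f := fun x => X.D (Function.update u n x) ℓ) (u n) h1 hA'⟩
  exact (ContinuousLinearMap.opNorm_comp_le _ _).trans
    (mul_le_mul (h ℓ q) hA (norm_nonneg _) hN)

end DefectCrystal

/-! ### The derivative of the site entropy -/

namespace DefectCrystal
variable {d m : ℕ} {X : DefectCrystal d m}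

/-- Every bond vector occurs among the right vectors of the perturbation, so the resolvent decay
stated for those applies at every site. -/
lemma exists_pertRight_eq (hd : 2 ≤ d) (hX : X.LatticeStable) [NeZero m] (ℓ : X.sites)
    (ρ : X.siteStencil ℓ) (i : Fin m) :
    ∃ a, X.pertRight a = X.bondVec ℓ ρ i ∧ X.pertCenter a = X.center ℓ := by
  by_cases h : ℓ ∈ X.core
  · exact ⟨Sum.inr (Sum.inl ⟨⟨ℓ, h⟩, (ρ, i, ρ, i)⟩), rfl, (center_of_mem h).symm⟩
  · have hρ : ρ.1 ∈ X.stencil := (siteStencil_eq h).subset ρ.2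
    refine ⟨Sum.inl ((⟨ρ.1, hρ⟩, i, ⟨ρ.1, hρ⟩, i), X.coord ℓ.1), ?_, (center_of_notMem h).symm⟩
    rw [bondVec_eq_latVec hd hX (mem_bravais_of_notMem_core h) ρ (X.stencil_subset hρ)]
    rfl

/-! ### The resolvent on the circle -/

section Circle
variable {σ₁ σ₂ c r : ℝ} {u : X.sites → Disp m}

/-- The spectrum is real and the circle meets the real axis only at c ± r, which are positive and
outside [σ₁, σ₂]. -/
lemma sphere_subset_resolventSet (hd : 2 ≤ d) (hX : X.LatticeStable) (h0 : 0 < c - r)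
    (h1 : c - r < σ₁) (h2 : σ₂ < c + r) (h12 : σ₁ < σ₂) (hu : u ∈ X.stableClass σ₁ σ₂) :
    Metric.sphere (c : ℂ) r ⊆ resolventSet ℂ (X.FHF u) := by
  intro z hz
  refine IsSelfAdjoint.mem_resolventSet_of_forall
    ((isFHF_FHF hd hX hu.1).isSelfAdjoint hd hX) fun hre hspec => ?_
  rw [mem_sphere_iff_norm, hre, ← Complex.ofReal_sub, Complex.norm_real, Real.norm_eq_abs] at hz
  have h3 : z.re = c - r ∨ z.re = c + r := by
    rcases abs_cases (z.re - c) with h | h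
    · right; linarith
    · left; linarith
  have h4 := hu.2 z.re (by rcases h3 with h | h <;> linarith) hspec
  rcases h3 with h | h
  · linarith [h4.1]
  · linarith [h4.2]

lemma conj_mem_sphere {z : ℂ} (hz : z ∈ Metric.sphere (c : ℂ) r) :
    starRingEnd ℂ z ∈ Metric.sphere (c : ℂ) r := by
  rw [mem_sphere_iff_norm] at *
  rw [← hz, ← Complex.norm_conj (z - c), map_sub, Complex.conj_ofReal]

lemma continuousOn_log_sphere (h0 : 0 < c - r) :
    ContinuousOn Complex.log (Metric.sphere (c : ℂ) r) := by
  intro z hz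
  refine (continuousAt_clog (Or.inl ?_)).continuousWithinAt
  rw [mem_sphere_iff_norm] at hz
  have h1 := (abs_le.1 ((Complex.abs_re_le_norm (z - c)).trans_eq hz)).1
  rw [Complex.sub_re, Complex.ofReal_re] at h1
  linarith

/-- Off-diagonal decay of the resolvent of `𝐅* H(u) 𝐅`, uniformly on the circle. -/
lemma exists_inner_bondVec_resolvent_le (hd : 2 ≤ d) (hX : X.LatticeStable) [NeZero m]
    (h0 : 0 < c - r) (h1 : c - r < σ₁) (h2 : σ₂ < c + r) (h12 : σ₁ < σ₂)
    (hu : u ∈ X.stableClass σ₁ σ₂) :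
    ∃ C : ℝ, 0 ≤ C ∧ ∀ z ∈ Metric.sphere (c : ℂ) r, ∀ ℓ i k ρ j,
      ‖inner ℂ (X.bondVec k ρ j) (resolvent (X.FHF u) z (X.siteBasis ℓ i))‖ ≤
        C * decay (X.center k) (X.pos ℓ) := by
  set T := X.FHF u with hT
  have hF : X.IsFHF u T := isFHF_FHF hd hX hu.1
  have hsub : Metric.sphere (c : ℂ) r ⊆ resolventSet ℂ T :=
    sphere_subset_resolventSet hd hX h0 h1 h2 h12 hu
  -- As a positive point of the spectrum, 1 must lie in [σ₁, σ₂], hence strictly inside the circle;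
  -- r - |c - 1| is its distance to the circle.
  have hone : (1 : ℝ) ∈ Set.Icc σ₁ σ₂ := hu.2 1 one_pos (by
    simpa using one_mem_spectrum hd hX hu.1 hF)
  have hδ : 0 < r - |c - 1| := by
    have := hone.1
    have := hone.2
    rw [sub_pos, abs_lt]
    constructor <;> linarith
  obtain ⟨K, hK⟩ := (isCompact_sphere (c : ℂ) r).exists_bound_of_continuousOn
    ((continuousOn_resolvent T).mono hsub)
  obtain ⟨C, M, hP⟩ := exists_isLocalizedPerturbation hd hX hu.1 hF
  obtain ⟨C', hC', hdec⟩ := hP.exists_resolvent_decay (hF.isSelfAdjoint hd hX) hδ (K := K)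
  obtain ⟨B, hB, hb⟩ := exists_norm_inner_local_siteBasis_le hd hX X.shifts
  refine ⟨C' * B, by positivity, fun z hz ℓ i k ρ j => ?_⟩
  obtain ⟨a, ha, ha'⟩ := exists_pertRight_eq hd hX k ρ j
  rw [← ha, ← ha']
  refine hdec z (hsub hz) (hsub (conj_mem_sphere hz)) ?_ (hK _ (conj_mem_sphere hz)) _ _ B hB
    (fun a => hb _ _ (pertRight_mem hd hX a) ℓ i) (fun a => hb _ _ (pertLeft_mem hd hX a) ℓ i) a
  rw [mem_sphere_iff_norm] at hz
  have h3 : ‖(c : ℂ) - 1‖ = |c - 1| := by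
    rw [← Complex.ofReal_one, ← Complex.ofReal_sub, Complex.norm_real, Real.norm_eq_abs]
  have h4 := norm_sub_norm_le (z - c) (1 - c)
  rw [hz, norm_sub_rev 1, h3, sub_sub_sub_cancel_right] at h4
  exact h4

/-- The derivative of `S_ℓ` with respect to the displacement of the site `n`. -/
lemma exists_hasFDerivAt_siteEntropyAlong (hd : 2 ≤ d) (hX : X.LatticeStable) [NeZero m]
    (h0 : 0 < c - r) (h1 : c - r < σ₁) (h2 : σ₂ < c + r) (h12 : σ₁ < σ₂)
    (hu : u ∈ X.stableClass σ₁ σ₂) :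
    ∃ C : ℝ, 0 ≤ C ∧ ∀ ℓ n : X.sites, ∃ A : Disp m →L[ℝ] ℝ,
      ‖A‖ ≤ C * decay (X.pos n) (X.pos ℓ) ^ 2 ∧
        HasFDerivAt (X.siteEntropyAlong c r ℓ n u) A (u n) := by
  classical
  have hr : 0 ≤ r := by linarith
  set T := X.FHF u with hT
  have hSA : IsSelfAdjoint T := (isFHF_FHF hd hX hu.1).isSelfAdjoint hd hX
  have hsub : Metric.sphere (c : ℂ) r ⊆ resolventSet ℂ T :=
    sphere_subset_resolventSet hd hX h0 h1 h2 h12 hu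
  have hlog := continuousOn_log_sphere h0
  obtain ⟨G, hG⟩ := (isCompact_sphere (c : ℂ) r).exists_bound_of_continuousOn hlog
  obtain ⟨C₁, hC₁, hres⟩ := exists_inner_bondVec_resolvent_le hd hX h0 h1 h2 h12 hu
  obtain ⟨C₂, hC₂, hdec⟩ := exists_decay_center_le (X := X)
  obtain ⟨N₁, hN₁, hcard⟩ := exists_neighbours_card_le (X := X)
  obtain ⟨N₂, hN₂, hcard'⟩ := exists_card_le (X := X)
  obtain ⟨N₃, hN₃, hcoef⟩ := exists_hasFDerivAt_hessEntry hu.1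
  obtain ⟨L, hL, hLd⟩ := hasFDerivAt_circleIntegral_resolvent hr hlog hsub
  have hG0 : 0 ≤ |G| := abs_nonneg G
  set P := ‖(2 * Real.pi * Complex.I : ℂ)⁻¹‖ * (m * (2 * Real.pi * r * (|G| * (C₁ * C₂) ^ 2)))
    with hP
  have hP0 : 0 ≤ P := by positivity
  refine ⟨1 / 2 * (N₁ * (N₂ * (P * N₃))), by positivity, fun ℓ n => ?_⟩
  set D := decay (X.pos n) (X.pos ℓ) with hD
  have hD0 : 0 ≤ D := decay_nonneg _ _
  -- The block trace at ℓ as a bounded functional, to be composed with the derivative of the contour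
  -- integral.
  let Ψ : (X.L2 →L[ℂ] X.L2) →L[ℂ] ℂ := ∑ i : Fin m,
    (innerSL ℂ (X.siteBasis ℓ i)).comp (ContinuousLinearMap.apply ℂ X.L2 (X.siteBasis ℓ i))
  have hΨ : ∀ b, Ψ b = ∑ i : Fin m, inner ℂ (X.siteBasis ℓ i) (b (X.siteBasis ℓ i)) := fun b => by
    simp only [Ψ, _root_.sum_apply]
    rfl
  choose A hA hA' using fun k : Σ ℓ, BondPair (X.siteStencil ℓ) m => hcoef n k.1 k.2
  have hΦ : HasFDerivAt (fun b => (2 * Real.pi * Complex.I : ℂ)⁻¹ •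
      Ψ (∮ z in C((c : ℂ), r), Complex.log z • resolvent b z))
      ((2 * Real.pi * Complex.I : ℂ)⁻¹ • (Ψ.comp L)) T :=
    HasFDerivAt.fun_const_smul (HasFDerivAt.comp (g := Ψ) T Ψ.hasFDerivAt hLd) _
  have hder := (hasFDerivAt_re_comp (fun k _ => hA' k) (FHF_update hd hX hu.1 n) hΦ).const_mul
    (-(1 / 2))
  refine ⟨_, ?_, hder.congr_of_eventuallyEq (Filter.Eventually.of_forall fun x => ?_)⟩
  · have hk : ∀ k ∈ (X.neighbours n).sigma fun ℓ =>
        (Finset.univ : Finset (BondPair (X.siteStencil ℓ) m)),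
        ‖((2 * Real.pi * Complex.I : ℂ)⁻¹ • (Ψ.comp L))
          (rankOp (X.bondVec k.1 k.2.1 k.2.2.1) (X.bondVec k.1 k.2.2.2.1 k.2.2.2.2))‖ ≤
            P * D ^ 2 := by
      intro k hk
      have hkn : k.1 ∈ X.neighbours n := (Finset.mem_sigma.1 hk).1
      set ψ := X.bondVec k.1 k.2.1 k.2.2.1 with hψ
      set χ := X.bondVec k.1 k.2.2.2.1 k.2.2.2.2 with hχ
      -- The decay is first measured from the centre of the neighbour k and then, at the price of
      -- C₂, from n itself.
      have hb : ∀ z ∈ Metric.sphere (c : ℂ) r, ∀ i ρ j,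
          ‖inner ℂ (X.bondVec k.1 ρ j) (resolvent T z (X.siteBasis ℓ i))‖ ≤ C₁ * C₂ * D :=
        fun z hz i ρ j => (hres z hz ℓ i k.1 ρ j).trans
          ((mul_le_mul_of_nonneg_left (hdec n k.1 hkn _) hC₁).trans_eq (mul_assoc _ _ _).symm)
      have hone : ∀ i, ‖inner ℂ (X.siteBasis ℓ i) (L (rankOp ψ χ) (X.siteBasis ℓ i))‖ ≤
          2 * Real.pi * r * (|G| * (C₁ * C₂) ^ 2) * D ^ 2 := by
        intro i
        have hRc := (continuousOn_resolvent T).mono hsub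
        have hint : CircleIntegrable (fun z => Complex.log z •
            (resolvent T z * rankOp ψ χ * resolvent T z)) c r :=
          ContinuousOn.circleIntegrable hr (hlog.smul ((hRc.mul continuousOn_const).mul hRc))
        rw [hL, inner_circleIntegral hint]
        refine (circleIntegral.norm_integral_le_of_norm_le_const
          (C := |G| * ((C₁ * C₂ * D) * (C₁ * C₂ * D))) hr fun z hz => ?_).trans_eq (by ring)
        -- On a rank one perturbation the entry of R(z) E R(z) factors into two resolvent matrix
        -- elements. The left resolvent is moved to the other side as its adjoint, at the conjugate
        -- point of the circle.
        have h3 : inner ℂ (X.siteBasis ℓ i)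
            ((Complex.log z • (resolvent T z * rankOp ψ χ * resolvent T z)) (X.siteBasis ℓ i)) =
            Complex.log z * (inner ℂ (resolvent T (starRingEnd ℂ z) (X.siteBasis ℓ i)) ψ *
              inner ℂ χ (resolvent T z (X.siteBasis ℓ i))) := by
          rw [_root_.smul_apply, inner_smul_right, ← inner_rankOp,
            ← adjoint_resolvent hSA (hsub hz) (hsub (conj_mem_sphere hz))]
          rfl
        rw [h3, norm_mul, norm_mul, norm_inner_symm _ ψ]
        gcongr
        · exact (hG z hz).trans (le_abs_self G)
        · exact hb _ (conj_mem_sphere hz) _ _ _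
        · exact hb _ hz _ _ _
      rw [_root_.smul_apply, norm_smul, ContinuousLinearMap.comp_apply, hΨ, hP,
        mul_assoc ‖_‖]
      refine mul_le_mul_of_nonneg_left ?_ (norm_nonneg _)
      refine (norm_sum_le_of_le _ fun i _ => hone i).trans_eq ?_
      rw [Finset.sum_const, Finset.card_univ, Fintype.card_fin, nsmul_eq_mul]
      ring
    rw [norm_smul, norm_neg, Real.norm_of_nonneg (by norm_num : (0 : ℝ) ≤ 1 / 2),
      mul_assoc (1 / 2 : ℝ)]
    refine mul_le_mul_of_nonneg_left ?_ (by norm_num : (0 : ℝ) ≤ 1 / 2)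
    refine (norm_sum_le_of_le _ (fun k hk' => (norm_smul_le _ _).trans
      (mul_le_mul ((Complex.abs_re_le_norm _).trans (hk k hk')) (hA k) (norm_nonneg _)
        (by positivity : 0 ≤ P * D ^ 2)))).trans ?_
    rw [Finset.sum_sigma]
    calc _ ≤ ∑ _ℓ ∈ X.neighbours n, N₂ * (P * D ^ 2 * N₃) := by
          refine Finset.sum_le_sum fun k _ => ?_
          rw [Finset.sum_const, Finset.card_univ, nsmul_eq_mul]
          exact mul_le_mul_of_nonneg_right (hcard' k) (by positivity)
      _ ≤ N₁ * (N₂ * (P * D ^ 2 * N₃)) := by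
          rw [Finset.sum_const, nsmul_eq_mul]
          exact mul_le_mul_of_nonneg_right (hcard n) (by positivity)
      _ = _ := by ring
  · simp only [hΨ]
    rw [siteEntropyAlong, siteEntropy, blockTrace, logPlus]
    congr 2
    simp only [_root_.smul_apply, inner_smul_right, ← Finset.mul_sum, smul_eq_mul]
    rfl

end Circle

/-- Squaring the critical weight doubles the exponent to 2d; the comparison of distances turns
lattice coordinates into physical ones. -/
lemma decay_sq_le {C : ℝ} {x y : Fin d → ℤ} {s : ℝ} (hs : 0 < s)
    (h : s ≤ C * (1 + ‖x - y‖)) : decay y x ^ 2 ≤ C ^ (2 * d) * s ^ (-(2 * (d : ℤ))) := by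
  have h1 : s ^ (-(2 * (d : ℤ))) = (s ^ (2 * d))⁻¹ := by
    rw [zpow_neg]
    norm_cast
  have h2 : 0 < 1 + ‖x - y‖ := by positivity
  rw [h1, decay_comm, decay, inv_pow, ← pow_mul, mul_comm d 2, ← div_eq_mul_inv,
    le_div_iff₀ (by positivity), inv_mul_le_iff₀ (by positivity), ← mul_pow, mul_comm _ C]
  gcongr

end DefectCrystal

end SiteEntropy

end

/-! ### The locality theorem -/

theorem theorem3p1 {d m : ℕ} (hd : d = 2 ∨ d = 3) (X : DefectCrystal d m)
    (hstab : X.LatticeStable) :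
    -- the operators `𝐅* H(u) 𝐅` are well defined on the whole energy space
    (∀ u ∈ X.energySpace, X.IsFHF u (X.FHF u)) ∧
    -- locality, for every stability class and every circle in the right half-plane around it
    ∀ σ₁ σ₂ c r : ℝ, 0 < σ₁ → σ₁ < σ₂ → 0 < c - r → c - r < σ₁ → σ₂ < c + r →
      ∀ u ∈ X.stableClass σ₁ σ₂,
        (∀ ℓ n : X.sites, DifferentiableAt ℝ (X.siteEntropyAlong c r ℓ n u) (u n)) ∧
        ∃ C₂ r₀ : ℝ, 0 < C₂ ∧ 0 < r₀ ∧ ∀ ℓ n : X.sites, r₀ ≤ dist ℓ.1 n.1 →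
          ‖fderiv ℝ (X.siteEntropyAlong c r ℓ n u) (u n)‖ ≤
            C₂ * dist ℓ.1 n.1 ^ (-(2 * (d : ℤ))) := by
  have hd2 : 2 ≤ d := by omega
  refine ⟨fun u hu => DefectCrystal.isFHF_FHF hd2 hstab hu,
    fun σ₁ σ₂ c r _ h12 h0 h1 h2 u hu => ?_⟩
  have key : ∃ C : ℝ, 0 ≤ C ∧ ∀ ℓ n : X.sites, ∃ A : Disp m →L[ℝ] ℝ,
      ‖A‖ ≤ C * decay (X.pos n) (X.pos ℓ) ^ 2 ∧
        HasFDerivAt (X.siteEntropyAlong c r ℓ n u) A (u n) := by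
    -- For m = 0 the Weyl sequence does not exist, but displacements form a single point and every
    -- derivative is zero.
    rcases Nat.eq_zero_or_pos m with rfl | hm
    · exact ⟨0, le_rfl, fun ℓ n => ⟨0, by simp, hasFDerivAt_of_subsingleton _ _⟩⟩
    · have : NeZero m := ⟨hm.ne'⟩
      exact DefectCrystal.exists_hasFDerivAt_siteEntropyAlong hd2 hstab h0 h1 h2 h12 hu
  obtain ⟨C, hC, hA⟩ := key
  obtain ⟨C', hC', hdist⟩ := X.exists_dist_le
  -- The summand 1 only makes the constant strictly positive; any r₀ > 0 would do, since r₀ merely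
  -- keeps the distance away from zero.
  refine ⟨fun ℓ n => ?_, C * C' ^ (2 * d) + 1, 1, by positivity, one_pos, fun ℓ n hln => ?_⟩
  · obtain ⟨A, -, h⟩ := hA ℓ n
    exact h.differentiableAt
  · obtain ⟨A, hle, h⟩ := hA ℓ n
    have hpos : 0 < dist ℓ.1 n.1 := one_pos.trans_le hln
    rw [h.fderiv, add_mul, mul_assoc]
    have h3 := mul_le_mul_of_nonneg_left (DefectCrystal.decay_sq_le hpos (hdist ℓ n)) hC
    have h4 : 0 ≤ 1 * dist ℓ.1 n.1 ^ (-(2 * (d : ℤ))) := by positivity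
    linarith
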